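/- **Setting.** For $n\in\mathbb N$ and $p,q\in[0,1]$ let $\mathcal G(n,p,q)$ be the random $\pm1$-labelled graph on $n$ vertices in which the labels $\sigma_u$ are independent and uniform on $\{\pm1\}$ and, given the labels, each pair $\{u,v\}$ is an edge independently, with probability $p$ if $\sigma_u=\sigma_v$ and $q$ if $\sigma_u\neq\sigma_v$. Let $p_n,q_n\in[0,1]$, $a_n=np_n$, $b_n=nq_n$, $\hat p_n=\frac{p_n+q_n}{2}$, let $\mathbb P_n$ be the law $\mathcal G(n,p_n,q_n)$ and $\mathbb P_n'$ the (Erdős–Rényi) law $\mathcal G(n,\hat p_n,\hat p_n)$. Assume that $\hat p_n$ is bounded away from $1$, i.e. $\limsup_n\hat p_n<1$. With $x_{i,j}$ the indicator of the edge $\{i,j\}$, the signed cycle of length $k$ is $$C_{n,k}(G)=\left(\frac{1}{\sqrt{n p_{n,\mathrm{av}}(1-p_{n,\mathrm{av}})}}\right)^{k}\sum_{i_0,\dots,i_{k-1}\ \text{distinct}}(x_{i_0,i_1}-p_{n,\mathrm{av}})\cdots(x_{i_{k-1},i_0}-p_{n,\mathrm{av}}),\qquad p_{n,\mathrm{av}}=\frac{1}{n(n-1)}\sum_{i\ne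 j}\mathbb E[x_{i,j}]$$ (for both $\mathbb P_n$ and $\mathbb P_n'$ one has $p_{n,\mathrm{av}}=\hat p_n$). **Proposition.** Fix $l$, and let $3\le k_1<\dots<k_l$ be integers that may depend on $n$. (i) If $G\sim\mathbb P_n'$, $n(p_n+q_n)\to\infty$ and $k_l=o(\log(n\hat p_n))$, then $$\left(\frac{C_{n,k_1}(G)}{\sqrt{2k_1}},\dots,\frac{C_{n,k_l}(G)}{\sqrt{2k_l}}\right)\xrightarrow{d}N_l(0,I_l).$$ (ii) If $G\sim\mathbb P_n$, $np_n\to\infty$, $c=c_n=\frac{(a_n-b_n)^2}{a_n+b_n}=\Theta(1)$ and $k_l=o\big(\min(\log(n\hat p_n),\sqrt{\log n})\big)$, then $$\left(\frac{C_{n,k_1}(G)-\mu_1}{\sqrt{2k_1}},\dots,\frac{C_{n,k_l}(G)-\mu_l}{\sqrt{2k_l}}\right)\xrightarrow{d}N_l(0,I_l),\qquad \mu_i=\left(\operatorname{sgn}(p_n-q_n)\sqrt{\frac{c}{2(1-\hat p_n)}}\right)^{k_i};$$ in particular $\mu_i=\left(\frac{c}{2(1-\hat p_n)}\right)^{k_i/2}$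 when $p_n>q_n$ or $k_i$ is even. -/

import Mathlib

open MeasureTheory ProbabilityTheory Filter Asymptotics Topology unitInterval

namespace SignedCycles

/-- A `±1`-labelled graph on the vertex set `Fin n`. -/
abbrev LabelledGraph (n : ℕ) : Type := (Fin n → ℤˣ) × SimpleGraph (Fin n)

/-- Given the labels `τ`, the probability that a pair of vertices is joined: `p` if the two labels
agree and `q` if they differ. -/
def edgeProb {V : Type*} (p q : I) (τ : V → ℤˣ) : Sym2 V → I :=
  Sym2.lift ⟨fun u v => if τ u = τ v then p else q, fun u v => by simp only [eq_comm]⟩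

/-- The law of the graph given the labels `τ`: all pairs of vertices are tossed independently, the
pair `e` being an edge with probability `edgeProb p q τ e` (`fromEdgeSet` ignores the outcomes on
the diagonal of `Sym2 V`, so that the graph has no loops). -/
noncomputable def graphLaw {V : Type*} [Fintype V] (p q : I) (τ : V → ℤˣ) :
    Measure (SimpleGraph V) :=
  (Measure.pi fun e : Sym2 V => bernoulliMeasure True False (edgeProb p q τ e)).map
    fun E => SimpleGraph.fromEdgeSet {e | E e}

/-- The stochastic block model `𝒢(n, p, q)`: the labels are independent and uniform on `{±1}`,
i.e. the labelling is uniform on `{±1}ⁿ`, and given the labels the graph has law `graphLaw`. -/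
noncomputable def sbm (n : ℕ) (p q : I) : Measure (LabelledGraph n) :=
  ((2 : ENNReal) ^ n)⁻¹ • ∑ τ : Fin n → ℤˣ, (Measure.dirac τ).prod (graphLaw p q τ)

instance {V : Type*} [Fintype V] (p q : I) (τ : V → ℤˣ) :
    IsProbabilityMeasure (graphLaw p q τ) := by
  unfold graphLaw
  refine Measure.isProbabilityMeasure_map (Measurable.aemeasurable ?_)
  exact SimpleGraph.measurable_fromEdgeSet.comp MeasurableEquiv.setOfPred.measurable

instance (n : ℕ) (p q : I) : IsProbabilityMeasure (sbm n p q) := by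
  constructor
  simp only [sbm, Measure.smul_apply, Measure.finsetSum_apply, measure_univ, Finset.sum_const,
    Finset.card_univ, Fintype.card_pi, Fintype.card_units_int, Finset.prod_const, Fintype.card_fin,
    smul_eq_mul, nsmul_eq_mul, mul_one]
  push_cast
  exact ENNReal.inv_mul_cancel (by simp) (by finiteness)

/-- The average `(p + q) / 2` of two probabilities. -/
noncomputable def avgProb (p q : I) : I :=
  ⟨((p : ℝ) + q) / 2, by
    have hp := p.2.1
    have hp' := p.2.2
    have hq := q.2.1
    have hq' := q.2.2
    constructor <;> linarith⟩

open Classical in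
/-- The edge indicator `x_{u,v}` of a graph. -/
noncomputable def edgeInd {V : Type*} (G : SimpleGraph V) (u v : V) : ℝ :=
  if G.Adj u v then 1 else 0

/-- The average connection probability `1 / (n (n - 1)) * ∑_{i ≠ j} E[x_{i,j}]` of a random
labelled graph with law `P`. -/
noncomputable def avgConnProb {n : ℕ} (P : Measure (LabelledGraph n)) : ℝ :=
  1 / ((n : ℝ) * ((n : ℝ) - 1)) *
    ∑ i : Fin n, ∑ j ∈ Finset.univ.erase i, ∫ ω, edgeInd ω.2 i j ∂P

/-- The signed cycle count of length `k` of the graph `G` on `n` vertices, with centering `r`: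
`(1 / √(n r (1 - r)))ᵏ * ∑ (x_{i₀,i₁} - r) ⋯ (x_{i_{k-1},i₀} - r)`, the sum ranging over all tuples
`i₀, …, i_{k-1}` of distinct vertices. Here `finRotate k` is `j ↦ j + 1` modulo `k`. -/
noncomputable def signedCycleCount {n : ℕ} (r : ℝ) (k : ℕ) (G : SimpleGraph (Fin n)) : ℝ :=
  (1 / √(n * r * (1 - r))) ^ k *
    ∑ i : Fin k ↪ Fin n, ∏ j : Fin k, (edgeInd G (i j) (i (finRotate k j)) - r)

/-- The signed cycle `C_{n,k}` as a random variable on the space of labelled graphs with law `P`,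
centered and scaled by the average connection probability of `P`. -/
noncomputable def signedCycle {n : ℕ} (P : Measure (LabelledGraph n)) (k : ℕ)
    (ω : LabelledGraph n) : ℝ :=
  signedCycleCount (avgConnProb P) k ω.2

/-- `c = (a - b)² / (a + b)` for `a = n p` and `b = n q`. -/
noncomputable def signal (n : ℕ) (p q : I) : ℝ :=
  ((n : ℝ) * p - n * q) ^ 2 / (n * p + n * q)

/-- The centering `(sgn(p - q) √(c / (2 (1 - p̂))))ᵏ` of the signed cycle of length `k` under
`𝒢(n, p, q)`, where `p̂ = (p + q) / 2`. -/
noncomputable def cycleMean (n : ℕ) (p q : I) (k : ℕ) : ℝ :=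
  (Real.sign ((p : ℝ) - q) * √(signal n p q / (2 * (1 - (avgProb p q : ℝ))))) ^ k

end SignedCycles

/-! Condition on the labels `τ`. The edges are then independent, and with `r = (p + q) / 2` and `ρ²
= r (1 - r)` each centred indicator splits as `x_e - r = ρ ξ_e + (p - q) / 2 * τ_u τ_v`, where the
`ξ_e` are independent, centred, bounded by `ρ⁻¹`, and of variance nearly one. Hence
(`signedCycleCount_eq_fullSum`) a signed cycle count is the sum over injective cycles of the
products of `n^(-1/2) ξ_e + (θ / n) τ_u τ_v`, with `θ = (p - q) √n / (2 ρ)`, and `θ²` equals the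
signal divided by `2 (1 - r)`.

Expanding the products (`fullSum_eq`) gives three pieces. In the pure signal term every label occurs
twice around the cycle, so it is `θ^k` up to the fraction of injective tuples; this is the centering
(`cycleMean_eq`). The mixed terms are negligible in `L²`: they are orthogonal unless their noise
edges agree, and a nonempty proper set of edges of a cycle is a union of paths, with more vertices
than edges, which saves a factor `1 / n` (`sum_cycles_le`, `ex_mixSum_sq_le`). The pure noise term
carries the fluctuations.

For the noise, `stein_bound` is Stein's method on the characteristic function. The linear
combination `F` of cycle sums is split as `∑ X_(x,y)` by the first directed edge. If `Y_(x,y)` is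
the part of `F` through that edge, then `F - Y_(x,y)` does not involve `ξ_(x,y)` while `X_(x,y)` is
a multiple of it, so `X_(x,y)` is orthogonal to functions of `F - Y_(x,y)`. What remains is
concentration of `∑ X Y` and smallness of `∑ E |X| Y²`. Rotations and reflections give `Y = 2 k X`
for a single length `k`, which is why `2 k` is the limiting variance; different lengths are
orthogonal.

Both error terms reduce to a sum over quadruples of cycles, linked by common edges, that cover their
edges at least twice on average (`quad_bound`). To keep the dependence on the total length `K`
merely exponential, each quadruple gets a weight from exploring it as a walk: a new vertex costs `1
/ n`, an old vertex by a new edge costs the inverse number of visited vertices, an old edge costs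
the inverse of the local degree. The weights add up to at most `3^K`. Four cycles forming a graph
without excess must coincide, and then they cover every edge four times; so every quadruple loses at
least one factor `(√n ρ)⁻¹`.

All errors are thus constants times `D^M (√n ρ)⁻¹` or its square root, with `M` bounding the
lengths, and they vanish when `M = o(log (n r))`. The bound is uniform in the labels, so it survives
averaging (`norm_charFun_sub_le`), and Lévy's continuity theorem concludes. The Erdős–Rényi case is
the block model with equal parameters, where `θ = 0`. -/

namespace SignedCycles

set_option linter.unusedSectionVars false

/-! ### Weights of walks exploring a graph -/

section Exploration

lemma sum_ite_inv_card_le {V : Type*} [Fintype V] (p : V → Prop) [DecidablePred p] (c : ℝ)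
    (hc : ((Finset.univ.filter p).card : ℝ) ≤ c) :
    ∑ x, (if p x then c⁻¹ else 0) ≤ 1 := by
  rw [← Finset.sum_filter, Finset.sum_const, nsmul_eq_mul]
  have h0 : (0 : ℝ) ≤ ((Finset.univ.filter p).card : ℝ) := by positivity
  rcases (h0.trans hc).eq_or_lt with h | h
  · rw [← h]; simp
  · rw [← div_eq_mul_inv]; exact (div_le_one h).2 hc

variable {V : Type*} [Fintype V] [DecidableEq V]

/-- Neighbours of `y` along the edges in `H`. -/
def nbrs (H : Finset (Sym2 V)) (y : V) : Finset V := Finset.univ.filter fun z => s(y, z) ∈ H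

/-- Weight of starting a walk at `x` when the set of visited vertices is `U`. -/
noncomputable def startWt (U : Finset V) (x : V) : ℝ :=
  if x ∈ U then (U.card : ℝ)⁻¹ else (Fintype.card V : ℝ)⁻¹

/-- Weight of stepping from `y` to `x` when the visited vertices are `U` and the visited edges
are `H`. -/
noncomputable def stepWt (U : Finset V) (H : Finset (Sym2 V)) (y x : V) : ℝ :=
  if x ∉ U then (Fintype.card V : ℝ)⁻¹
  else if s(y, x) ∈ H then ((nbrs H y).card : ℝ)⁻¹ else (U.card : ℝ)⁻¹

/-- Total weight of a walk. -/
noncomputable def pathWt : Finset V → Finset (Sym2 V) → V → List V → ℝ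
  | _, _, _, [] => 1
  | U, H, y, x :: l => stepWt U H y x * pathWt (insert x U) (insert s(y, x) H) x l

/-- Total weight of a walk including its starting point. -/
noncomputable def startPathWt (U : Finset V) (H : Finset (Sym2 V)) : List V → ℝ
  | [] => 1
  | x :: l => startWt U x * pathWt (insert x U) H x l

/-- The edges of the walk `y, l₀, l₁, …`. -/
def pathEdges : V → List V → Finset (Sym2 V)
  | _, [] => ∅
  | y, x :: l => insert s(y, x) (pathEdges x l)

lemma startWt_nonneg (U : Finset V) (x : V) : 0 ≤ startWt U x := by
  unfold startWt; split_ifs <;> positivity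

lemma stepWt_nonneg (U : Finset V) (H : Finset (Sym2 V)) (y x : V) : 0 ≤ stepWt U H y x := by
  unfold stepWt; split_ifs <;> positivity

lemma pathWt_nonneg (U : Finset V) (H : Finset (Sym2 V)) (y : V) (l : List V) :
    0 ≤ pathWt U H y l := by
  induction l generalizing U H y with
  | nil => simp [pathWt]
  | cons x l ih => exact mul_nonneg (stepWt_nonneg _ _ _ _) (ih _ _ _)

lemma startPathWt_nonneg (U : Finset V) (H : Finset (Sym2 V)) (l : List V) :
    0 ≤ startPathWt U H l := by
  cases l with
  | nil => simp [startPathWt]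
  | cons x l => exact mul_nonneg (startWt_nonneg _ _) (pathWt_nonneg _ _ _ _)

/-- There are three kinds of steps (new vertex, old edge, old vertex by a new edge), and the weights
of each kind have total at most one. -/
lemma sum_stepWt_le (U : Finset V) (H : Finset (Sym2 V)) (y : V) :
    ∑ x, stepWt U H y x ≤ 3 := by
  calc ∑ x, stepWt U H y x ≤ ∑ x, ((if True then (Fintype.card V : ℝ)⁻¹ else 0) +
        (if s(y, x) ∈ H then ((nbrs H y).card : ℝ)⁻¹ else 0) +
        (if x ∈ U then (U.card : ℝ)⁻¹ else 0)) := by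
        refine Finset.sum_le_sum fun x _ => ?_
        have h1 : (0 : ℝ) ≤ (Fintype.card V : ℝ)⁻¹ := by positivity
        have h2 : (0 : ℝ) ≤ ((nbrs H y).card : ℝ)⁻¹ := by positivity
        have h3 : (0 : ℝ) ≤ (U.card : ℝ)⁻¹ := by positivity
        unfold stepWt
        generalize (Fintype.card V : ℝ)⁻¹ = a at *
        generalize ((nbrs H y).card : ℝ)⁻¹ = b at *
        generalize (U.card : ℝ)⁻¹ = c at *
        split_ifs <;> linarith
    _ ≤ 1 + 1 + 1 := by
        rw [Finset.sum_add_distrib, Finset.sum_add_distrib]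
        gcongr
        · exact sum_ite_inv_card_le _ _ (by simp)
        · exact sum_ite_inv_card_le _ _ (by simp [nbrs])
        · exact sum_ite_inv_card_le _ _ (by simp)
    _ = 3 := by norm_num

lemma sum_startWt_le (U : Finset V) : ∑ x, startWt U x ≤ 3 := by
  calc ∑ x, startWt U x ≤ ∑ x, ((if True then (Fintype.card V : ℝ)⁻¹ else 0) +
        (if x ∈ U then (U.card : ℝ)⁻¹ else 0)) := by
        refine Finset.sum_le_sum fun x _ => ?_
        have h1 : (0 : ℝ) ≤ (Fintype.card V : ℝ)⁻¹ := by positivity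
        have h3 : (0 : ℝ) ≤ (U.card : ℝ)⁻¹ := by positivity
        unfold startWt
        split_ifs <;> simp_all
    _ ≤ 1 + 1 := by
        rw [Finset.sum_add_distrib]
        gcongr
        · exact sum_ite_inv_card_le _ _ (by simp)
        · exact sum_ite_inv_card_le _ _ (by simp)
    _ ≤ 3 := by norm_num

lemma sum_pathWt_le (m : ℕ) (U : Finset V) (H : Finset (Sym2 V)) (y : V) :
    ∑ f : Fin m → V, pathWt U H y (List.ofFn f) ≤ 3 ^ m := by
  induction m generalizing U H y with
  | zero => simp [pathWt]
  | succ m ih =>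
    rw [← (Fin.consEquiv fun _ : Fin (m + 1) => V).sum_comp, Fintype.sum_prod_type]
    simp only [Fin.consEquiv_apply, List.ofFn_succ, Fin.cons_zero, Fin.cons_succ, pathWt]
    calc _ ≤ ∑ x, stepWt U H y x * 3 ^ m := by
          refine Finset.sum_le_sum fun x _ => ?_
          rw [← Finset.mul_sum]
          exact mul_le_mul_of_nonneg_left (ih _ _ _) (stepWt_nonneg _ _ _ _)
      _ ≤ 3 * 3 ^ m := by
          rw [← Finset.sum_mul]
          exact mul_le_mul_of_nonneg_right (sum_stepWt_le U H y) (by positivity)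
      _ = 3 ^ (m + 1) := by ring

lemma sum_startPathWt_le (m : ℕ) (U : Finset V) (H : Finset (Sym2 V)) :
    ∑ f : Fin m → V, startPathWt U H (List.ofFn f) ≤ 3 ^ m := by
  cases m with
  | zero => simp [startPathWt]
  | succ m =>
    rw [← (Fin.consEquiv fun _ : Fin (m + 1) => V).sum_comp, Fintype.sum_prod_type]
    simp only [Fin.consEquiv_apply, List.ofFn_succ, Fin.cons_zero, Fin.cons_succ, startPathWt]
    calc _ ≤ ∑ x, startWt U x * 3 ^ m := by
          refine Finset.sum_le_sum fun x _ => ?_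
          rw [← Finset.mul_sum]
          exact mul_le_mul_of_nonneg_left (sum_pathWt_le _ _ _ _) (startWt_nonneg _ _)
      _ ≤ 3 * 3 ^ m := by
          rw [← Finset.sum_mul]
          exact mul_le_mul_of_nonneg_right (sum_startWt_le U) (by positivity)
      _ = 3 ^ (m + 1) := by ring

lemma one_le_stepWt_mul (U : Finset V) (H : Finset (Sym2 V)) (y x : V) {D : ℝ}
    (hxU : x ∈ U) (hx : s(y, x) ∈ H) (hD : ((nbrs H y).card : ℝ) ≤ D) :
    1 ≤ stepWt U H y x * D := by
  have h0 : 0 < ((nbrs H y).card : ℝ) := by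
    have : x ∈ nbrs H y := by simp [nbrs, hx]
    exact_mod_cast Finset.card_pos.2 ⟨x, this⟩
  simp only [stepWt, hxU, hx, not_true_eq_false, if_true, if_false]
  rw [inv_mul_eq_div, one_le_div h0]
  exact hD

/-- In divided form: the weight is at least `n⁻¹` per new vertex, `K⁻¹` per new edge beyond the
number of new vertices, and `D⁻¹` per step. Multiplying out avoids subtraction of cardinalities. The
degree bound is imposed on the final edge set `Hf`, so that one `D` serves the whole exploration. -/
lemma le_pathWt (l : List V) (U : Finset V) (H Hf : Finset (Sym2 V)) (y : V) {K D : ℝ}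
    (hK : 1 ≤ K) (hD : 1 ≤ D) (hHU : ∀ e ∈ H, ∀ x ∈ e, x ∈ U) (hy : y ∈ U)
    (hUK : ((U ∪ l.toFinset).card : ℝ) ≤ K) (hHf : H ∪ pathEdges y l ⊆ Hf)
    (hdeg : ∀ y, ((nbrs Hf y).card : ℝ) ≤ D) :
    K ^ ((U ∪ l.toFinset).card + H.card) * (Fintype.card V : ℝ) ^ U.card ≤
      pathWt U H y l * D ^ l.length *
        ((Fintype.card V : ℝ) ^ (U ∪ l.toFinset).card * K ^ (U.card + (H ∪ pathEdges y l).card)) := by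
  have hn : (1 : ℝ) ≤ Fintype.card V := by
    have : 0 < Fintype.card V := Fintype.card_pos_iff.2 ⟨y⟩
    exact_mod_cast this
  induction l generalizing U H y with
  | nil =>
    simp only [List.toFinset_nil, Finset.union_empty, pathEdges, pathWt, List.length_nil]
    apply le_of_eq; ring
  | cons x l ih =>
    have e1 : U ∪ (x :: l).toFinset = insert x U ∪ l.toFinset := by ext; simp
    have e2 : H ∪ pathEdges y (x :: l) = insert s(y, x) H ∪ pathEdges x l := by
      ext; simp [pathEdges]
    rw [e1] at hUK
    rw [e2] at hHf
    rw [e1, e2]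
    have key := ih (insert x U) (insert s(y, x) H) x ?_ (by simp) hUK hHf
    swap
    · intro e he z hz
      rcases Finset.mem_insert.1 he with rfl | he
      · rcases Sym2.mem_iff.1 hz with rfl | rfl
        · exact Finset.mem_insert_of_mem hy
        · exact Finset.mem_insert_self _ _
      · exact Finset.mem_insert_of_mem (hHU e he z hz)
    simp only [pathWt, List.length_cons]
    set W := pathWt (insert x U) (insert s(y, x) H) x l
    have hW : 0 ≤ W := pathWt_nonneg _ _ _ _
    set n : ℝ := (Fintype.card V : ℝ)
    set a := (insert x U ∪ l.toFinset).card
    set b := (insert s(y, x) H ∪ pathEdges x l).card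
    have hA : 0 ≤ W * D ^ l.length * (n ^ a * K ^ (U.card + b)) := by positivity
    have hHsub : H ⊆ Hf := fun e he => hHf (by simp [he])
    by_cases hxU : x ∈ U
    · have hU : (insert x U).card = U.card := by rw [Finset.insert_eq_of_mem hxU]
      rw [hU] at key
      by_cases hxH : s(y, x) ∈ H
      · have hH : (insert s(y, x) H).card = H.card := by rw [Finset.insert_eq_of_mem hxH]
        rw [hH] at key
        have hs : 1 ≤ stepWt U H y x * D := by
          refine one_le_stepWt_mul U H y x hxU hxH (le_trans ?_ (hdeg y))
          exact_mod_cast Finset.card_le_card (fun z hz => by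
            simp only [nbrs, Finset.mem_filter, Finset.mem_univ, true_and] at hz ⊢
            exact hHsub hz)
        calc _ ≤ 1 * (W * D ^ l.length * (n ^ a * K ^ (U.card + b))) := by rw [one_mul]; exact key
          _ ≤ (stepWt U H y x * D) * (W * D ^ l.length * (n ^ a * K ^ (U.card + b))) := by gcongr
          _ = _ := by ring
      · have hH : (insert s(y, x) H).card = H.card + 1 := Finset.card_insert_of_notMem hxH
        rw [hH] at key
        have hs : 1 ≤ stepWt U H y x * K := by
          simp only [stepWt, hxU, hxH, not_true_eq_false, if_false]
          have h0 : 0 < (U.card : ℝ) := by exact_mod_cast Finset.card_pos.2 ⟨x, hxU⟩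
          rw [inv_mul_eq_div, one_le_div h0]
          refine le_trans ?_ hUK
          exact_mod_cast Finset.card_le_card (fun z hz => by simp [hz])
        have : K * (K ^ (a + H.card) * n ^ U.card) ≤
            K * (stepWt U H y x * W * D ^ (l.length + 1) * (n ^ a * K ^ (U.card + b))) := by
          calc _ = 1 * 1 * (K ^ (a + (H.card + 1)) * n ^ U.card) := by ring
            _ ≤ (stepWt U H y x * K) * D * (W * D ^ l.length * (n ^ a * K ^ (U.card + b))) := by
              gcongr
            _ = _ := by ring
        exact le_of_mul_le_mul_left this (by linarith)
    · have hU : (insert x U).card = U.card + 1 := Finset.card_insert_of_notMem hxU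
      -- A new vertex is always reached by a new edge, so the exponents of `K` on the two sides move
      -- together and only the factor `n` is paid.
      have hxH : s(y, x) ∉ H := fun h => hxU (hHU _ h x (by simp))
      have hH : (insert s(y, x) H).card = H.card + 1 := Finset.card_insert_of_notMem hxH
      rw [hH, hU] at key
      have hs : stepWt U H y x = n⁻¹ := by simp [stepWt, hxU, n]
      have : K * n * (K ^ (a + H.card) * n ^ U.card) ≤
          K * n * (stepWt U H y x * W * D ^ (l.length + 1) * (n ^ a * K ^ (U.card + b))) := by
        calc _ = 1 * (K ^ (a + (H.card + 1)) * n ^ (U.card + 1)) := by ring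
          _ ≤ D * (W * D ^ l.length * (n ^ a * K ^ (U.card + 1 + b))) := by gcongr
          _ = _ := by rw [hs]; field_simp; ring
      exact le_of_mul_le_mul_left this (by positivity)

end Exploration

/-! ### Combinatorics of a single cycle -/

section CycleEdges

variable {V : Type*} {m : ℕ}

/-- The `j`-th edge of the closed walk `f 0, f 1, …, f (m + 2), f 0`. -/
def cycEdge (f : Fin (m + 3) → V) (j : Fin (m + 3)) : Sym2 V := s(f j, f (j + 1))

lemma fin_add_one_ne (j : Fin (m + 3)) : j + 1 ≠ j := by
  simp

/-- This is where length at least three enters: the two neighbours of a position on the cycle are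
distinct. -/
lemma fin_add_two_ne (j : Fin (m + 3)) : j + 1 + 1 ≠ j := by
  rw [add_assoc]
  intro h
  have h2 : (1 + 1 : Fin (m + 3)) = 0 := by simpa using h
  simp only [Fin.ext_iff, Fin.val_add, Fin.val_one, Fin.val_zero] at h2
  rw [Nat.mod_eq_of_lt (by omega)] at h2
  omega

lemma cycEdge_injective {f : Fin (m + 3) → V} (hf : Function.Injective f) :
    Function.Injective (cycEdge f) := by
  intro i j h
  simp only [cycEdge, Sym2.eq_iff] at h
  rcases h with ⟨h, -⟩ | ⟨h1, h2⟩
  · exact hf h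
  · exfalso
    have h1 := hf h1
    have h2 := hf h2
    rw [h1] at h2
    exact fin_add_two_ne j h2

variable [DecidableEq V]

/-- The set of edges of a cycle. -/
def cycEdges (f : Fin (m + 3) → V) : Finset (Sym2 V) := Finset.univ.image (cycEdge f)

/-- The set of vertices of a cycle. -/
def cycVerts (f : Fin (m + 3) → V) : Finset V := Finset.univ.image f

lemma cycEdge_mem (f : Fin (m + 3) → V) (j) : cycEdge f j ∈ cycEdges f := by
  simp [cycEdges]

lemma card_cycEdges {f : Fin (m + 3) → V} (hf : Function.Injective f) :
    (cycEdges f).card = m + 3 := by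
  simp [cycEdges, Finset.card_image_of_injective _ (cycEdge_injective hf)]

lemma mem_cycVerts_of_mem_cycEdges {f : Fin (m + 3) → V} {e : Sym2 V} (he : e ∈ cycEdges f) {x : V}
    (hx : x ∈ e) : x ∈ cycVerts f := by
  simp only [cycEdges, Finset.mem_image, Finset.mem_univ, true_and, cycEdge] at he
  obtain ⟨j, rfl⟩ := he
  rcases Sym2.mem_iff.1 hx with rfl | rfl <;> simp [cycVerts]

lemma not_isDiag_of_mem_cycEdges {f : Fin (m + 3) → V} (hf : Function.Injective f) {e : Sym2 V}
    (he : e ∈ cycEdges f) : ¬ e.IsDiag := by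
  simp only [cycEdges, Finset.mem_image, Finset.mem_univ, true_and, cycEdge] at he
  obtain ⟨j, rfl⟩ := he
  intro h
  exact fin_add_one_ne j (hf (Sym2.mk_isDiag_iff.1 h)).symm

lemma eq_or_eq_of_mem_cycEdges {f : Fin (m + 3) → V} (hf : Function.Injective f)
    {j : Fin (m + 3)} {y : V} (h : s(f j, y) ∈ cycEdges f) : y = f (j + 1) ∨ y = f (j - 1) := by
  simp only [cycEdges, Finset.mem_image, Finset.mem_univ, true_and, cycEdge, Sym2.eq_iff] at h
  obtain ⟨i, ⟨h1, h2⟩ | ⟨h1, h2⟩⟩ := h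
  · left; rw [← h2, hf h1]
  · right; rw [← h1, ← hf h2]; simp

lemma mem_cycEdges_succ (f : Fin (m + 3) → V) (j) : s(f j, f (j + 1)) ∈ cycEdges f :=
  cycEdge_mem f j

lemma mem_cycEdges_pred (f : Fin (m + 3) → V) (j) : s(f j, f (j - 1)) ∈ cycEdges f := by
  have := cycEdge_mem f (j - 1)
  rw [cycEdge, sub_add_cancel, Sym2.eq_swap] at this
  exact this

/-- A set of indices of a cycle closed under successors is everything. -/
lemma fin_forall_of_succ {k : ℕ} {P : Fin (k + 1) → Prop} {j : Fin (k + 1)} (hj : P j)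
    (h : ∀ i, P i → P (i + 1)) (i : Fin (k + 1)) : P i := by
  have key : ∀ t : ℕ, P (j + Fin.ofNat (k + 1) t) := by
    intro t
    induction t with
    | zero => simpa using hj
    | succ t ih =>
      have h1 := h _ ih
      have h2 : Fin.ofNat (k + 1) (t + 1) = Fin.ofNat (k + 1) t + 1 := by
        ext; simp [Fin.val_add]
      rwa [h2, ← add_assoc]
  have := key (i - j).val
  simpa using this

/-- Two cycles with the same edges and the same first edge coincide. -/
lemma eq_of_cycEdges_eq {f g : Fin (m + 3) → V} (hf : Function.Injective f)
    (hg : Function.Injective g) (h : cycEdges f = cycEdges g) (h0 : f 0 = g 0) (h1 : f 1 = g 1) :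
    f = g := by
  have key : ∀ i, f i = g i ∧ f (i + 1) = g (i + 1) := by
    refine fin_forall_of_succ (j := 0) ⟨h0, by simpa using h1⟩ ?_
    rintro i ⟨hi, hi'⟩
    refine ⟨hi', ?_⟩
    have hm : s(g (i + 1), f (i + 1 + 1)) ∈ cycEdges g := by
      rw [← hi', ← h]; exact mem_cycEdges_succ f (i + 1)
    rcases eq_or_eq_of_mem_cycEdges hg hm with h2 | h2
    · exact h2
    -- The alternative is that `f` turns back to its previous vertex, which injectivity forbids; so
    -- agreement on one directed edge propagates around the cycle.
    · rw [add_sub_cancel_right, ← hi] at h2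
      exact absurd (hf h2) (fin_add_two_ne i)
  exact funext fun i => (key i).1

lemma pathEdges_ofFn_subset {k : ℕ} (g : Fin (k + 1) → V) {e : Sym2 V}
    (he : e ∈ pathEdges (g 0) (List.ofFn fun i : Fin k => g i.succ)) :
    ∃ i : Fin k, e = s(g i.castSucc, g i.succ) := by
  induction k with
  | zero => simp [pathEdges] at he
  | succ k ih =>
    rw [List.ofFn_succ, pathEdges, Finset.mem_insert] at he
    rcases he with rfl | he
    · exact ⟨0, rfl⟩
    · obtain ⟨i, hi⟩ := ih (fun i => g i.succ) he
      exact ⟨i.succ, hi⟩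

variable [Fintype V]

lemma two_le_card_nbrs {f : Fin (m + 3) → V} (hf : Function.Injective f)
    {H : Finset (Sym2 V)} (hH : cycEdges f ⊆ H) {y : V} (hy : y ∈ cycVerts f) :
    2 ≤ (nbrs H y).card := by
  simp only [cycVerts, Finset.mem_image, Finset.mem_univ, true_and] at hy
  obtain ⟨j, rfl⟩ := hy
  have hne : f (j + 1) ≠ f (j - 1) := by
    intro h
    have := hf h
    have h2 := fin_add_two_ne (j - 1)
    rw [sub_add_cancel] at h2
    exact h2 this
  rw [← Finset.card_pair hne]
  refine Finset.card_le_card ?_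
  intro z hz
  simp only [Finset.mem_insert, Finset.mem_singleton] at hz
  rcases hz with rfl | rfl
  · simpa [nbrs] using hH (mem_cycEdges_succ f j)
  · simpa [nbrs] using hH (mem_cycEdges_pred f j)

/-- The cycle already uses two edges at each of its vertices, which exhausts the allowed degree. -/
lemma nbrs_eq_of_card_le_two {f : Fin (m + 3) → V} (hf : Function.Injective f)
    {H : Finset (Sym2 V)} (hH : cycEdges f ⊆ H) (hdeg : ∀ y, (nbrs H y).card ≤ 2) {y z : V}
    (hy : y ∈ cycVerts f) (hz : s(y, z) ∈ H) : s(y, z) ∈ cycEdges f := by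
  have h1 : nbrs (cycEdges f) y = nbrs H y := by
    refine Finset.eq_of_subset_of_card_le ?_ ?_
    · intro z hz
      simp only [nbrs, Finset.mem_filter, Finset.mem_univ, true_and] at hz ⊢
      exact hH hz
    · exact (hdeg y).trans (two_le_card_nbrs hf (Finset.Subset.refl _) hy)
  have : z ∈ nbrs H y := by simpa [nbrs] using hz
  rw [← h1] at this
  simpa [nbrs] using this

/-- In a graph of maximal degree two a cycle is a full connected component: following `g` from the
common edge, one can never leave `f`. -/
lemma cycEdges_subset_of_card_le_two {m' : ℕ} {f : Fin (m + 3) → V} (hf : Function.Injective f)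
    {g : Fin (m' + 3) → V} {H : Finset (Sym2 V)} (hH : cycEdges f ⊆ H) (hgH : cycEdges g ⊆ H)
    (hdeg : ∀ y, (nbrs H y).card ≤ 2) (hfg : ¬ Disjoint (cycEdges f) (cycEdges g)) :
    cycEdges g ⊆ cycEdges f := by
  obtain ⟨e, he, he'⟩ := Finset.not_disjoint_iff.1 hfg
  have hv : ∀ i, g i ∈ cycVerts f := by
    simp only [cycEdges, Finset.mem_image, Finset.mem_univ, true_and] at he'
    obtain ⟨j, rfl⟩ := he'
    refine fin_forall_of_succ (j := j) (mem_cycVerts_of_mem_cycEdges he (by simp [cycEdge])) ?_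
    intro i hi
    exact mem_cycVerts_of_mem_cycEdges
      (nbrs_eq_of_card_le_two hf hH hdeg hi (hgH (mem_cycEdges_succ g i))) (by simp)
  intro e he
  simp only [cycEdges, Finset.mem_image, Finset.mem_univ, true_and] at he
  obtain ⟨j, rfl⟩ := he
  exact nbrs_eq_of_card_le_two hf hH hdeg (hv j) (hgH (mem_cycEdges_succ g j))

lemma sum_card_nbrs {H : Finset (Sym2 V)} (hH : ∀ e ∈ H, ¬ e.IsDiag) :
    ∑ y, (nbrs H y).card = 2 * H.card := by
  classical
  obtain ⟨G, hG⟩ : ∃ G, G = SimpleGraph.fromEdgeSet (H : Set (Sym2 V)) := ⟨_, rfl⟩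
  have h := G.sum_degrees_eq_twice_card_edges
  have h1 : ∀ y, (nbrs H y).card = G.degree y := by
    intro y
    rw [← SimpleGraph.card_neighborFinset_eq_degree]
    congr 1
    ext z
    simp only [nbrs, Finset.mem_filter, Finset.mem_univ, true_and, SimpleGraph.mem_neighborFinset,
      SimpleGraph.fromEdgeSet_adj, Finset.mem_coe, hG]
    exact ⟨fun h => ⟨h, fun hyz => hH _ h (Sym2.mk_isDiag_iff.2 hyz)⟩, fun h => h.1⟩
  rw [Finset.sum_congr rfl fun y _ => h1 y, h]
  congr 2
  ext e
  refine SimpleGraph.mem_edgeFinset.trans ?_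
  rw [hG, SimpleGraph.edgeSet_fromEdgeSet]
  simp only [Set.mem_sdiff, Finset.mem_coe]
  exact ⟨fun h => h.1, fun h => ⟨h, hH e h⟩⟩

/-- In a graph of minimum degree at least two on the vertex set `U`, there are at least as many
edges as vertices, and the excess bounds the degrees. -/
lemma card_le_and_card_nbrs_le {H : Finset (Sym2 V)} {U : Finset V} (hH : ∀ e ∈ H, ¬ e.IsDiag)
    (hU : ∀ y ∈ U, 2 ≤ (nbrs H y).card) (hHU : ∀ e ∈ H, ∀ x ∈ e, x ∈ U) :
    U.card ≤ H.card ∧ ∀ y, (nbrs H y).card ≤ 2 + 2 * (H.card - U.card) := by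
  have h := sum_card_nbrs hH
  have hs : ∑ y ∈ U, (nbrs H y).card = 2 * H.card := by
    rw [← h]
    refine Finset.sum_subset (Finset.subset_univ _) fun y _ hy => ?_
    rw [Finset.card_eq_zero, Finset.eq_empty_iff_forall_notMem]
    intro z hz
    simp only [nbrs, Finset.mem_filter, Finset.mem_univ, true_and] at hz
    exact hy (hHU _ hz y (by simp))
  have hle : U.card * 2 ≤ ∑ y ∈ U, (nbrs H y).card := by
    rw [← smul_eq_mul]; exact Finset.card_nsmul_le_sum _ _ _ hU
  refine ⟨by omega, fun y => ?_⟩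
  by_cases hy : y ∈ U
  -- By the handshake identity `2 |H|` is the degree of `y` plus at least `2 (|U| - 1)` from the
  -- other vertices.
  · have h1 := Finset.add_sum_erase U (fun y => (nbrs H y).card) hy
    have h2 : (U.erase y).card * 2 ≤ ∑ y ∈ U.erase y, (nbrs H y).card := by
      rw [← smul_eq_mul]
      exact Finset.card_nsmul_le_sum _ _ _ fun z hz => hU z (Finset.mem_of_mem_erase hz)
    rw [Finset.card_erase_of_mem hy] at h2
    have h3 : 0 < U.card := Finset.card_pos.2 ⟨y, hy⟩
    omega
  · have : (nbrs H y).card = 0 := by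
      rw [Finset.card_eq_zero, Finset.eq_empty_iff_forall_notMem]
      intro z hz
      simp only [nbrs, Finset.mem_filter, Finset.mem_univ, true_and] at hz
      exact hy (hHU _ hz y (by simp))
    omega

/-- Lower bound for the weight of exploring one cycle. -/
lemma le_startPathWt (f : Fin (m + 3) → V) (U : Finset V) (H Hf : Finset (Sym2 V)) {K D : ℝ}
    (hK : 1 ≤ K) (hD : 1 ≤ D) (hHU : ∀ e ∈ H, ∀ x ∈ e, x ∈ U)
    (hUK : ((U ∪ cycVerts f).card : ℝ) ≤ K) (hHf : H ∪ cycEdges f ⊆ Hf)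
    (hdeg : ∀ y, ((nbrs Hf y).card : ℝ) ≤ D) :
    K ^ ((U ∪ cycVerts f).card + H.card) * (Fintype.card V : ℝ) ^ U.card ≤
      startPathWt U H (List.ofFn f) * D ^ (m + 3) *
        ((Fintype.card V : ℝ) ^ (U ∪ cycVerts f).card *
          K ^ (U.card + (H ∪ cycEdges f).card + 1)) := by
  rw [List.ofFn_succ]
  set l := List.ofFn fun i : Fin (m + 2) => f i.succ with hl
  have hlen : l.length = m + 2 := by simp [l]
  -- The explored walk omits the closing edge of the cycle. Adding that edge only enlarges the power
  -- of `K ≥ 1` on the right.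
  have hpe : pathEdges (f 0) l ⊆ cycEdges f := by
    intro e he
    obtain ⟨i, rfl⟩ := pathEdges_ofFn_subset f he
    have := mem_cycEdges_succ f i.castSucc
    rwa [Fin.coeSucc_eq_succ] at this
  have e1 : insert (f 0) U ∪ l.toFinset = U ∪ cycVerts f := by
    ext z
    simp only [Finset.mem_union, Finset.mem_insert, List.mem_toFinset, hl, List.mem_ofFn,
      cycVerts, Finset.mem_image, Finset.mem_univ, true_and, Fin.exists_fin_succ (P := fun i => f i = z)]
    tauto
  have e2 : H ∪ pathEdges (f 0) l ⊆ H ∪ cycEdges f := Finset.union_subset_union_right hpe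
  have hn : (1 : ℝ) ≤ Fintype.card V := by
    have : 0 < Fintype.card V := Fintype.card_pos_iff.2 ⟨f 0⟩
    exact_mod_cast this
  have key := le_pathWt l (insert (f 0) U) H Hf (f 0) hK hD
    (fun e he x hx => Finset.mem_insert_of_mem (hHU e he x hx)) (by simp)
    (by rw [e1]; exact hUK) (e2.trans hHf) hdeg
  rw [e1, hlen] at key
  simp only [startPathWt]
  set W := pathWt (insert (f 0) U) H (f 0) l
  have hW : 0 ≤ W := pathWt_nonneg _ _ _ _
  have hb : (H ∪ pathEdges (f 0) l).card ≤ (H ∪ cycEdges f).card := Finset.card_le_card e2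
  set n : ℝ := (Fintype.card V : ℝ)
  set a := (U ∪ cycVerts f).card
  set b := (H ∪ cycEdges f).card
  -- The extra factor `K` pays for the starting point: an old one has weight at least `K⁻¹`, and a
  -- new one is a new vertex that no new edge accompanies.
  by_cases hU : f 0 ∈ U
  · have hc : (insert (f 0) U).card = U.card := by rw [Finset.insert_eq_of_mem hU]
    rw [hc] at key
    have hs : 1 ≤ startWt U (f 0) * K := by
      simp only [startWt, hU, if_true]
      have h0 : 0 < (U.card : ℝ) := by exact_mod_cast Finset.card_pos.2 ⟨_, hU⟩
      rw [inv_mul_eq_div, one_le_div h0]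
      refine le_trans ?_ hUK
      exact_mod_cast Finset.card_le_card (fun z hz => by simp [hz])
    calc _ ≤ W * D ^ (m + 2) * (n ^ a * K ^ (U.card + (H ∪ pathEdges (f 0) l).card)) := key
      _ = 1 * 1 * (W * D ^ (m + 2) * (n ^ a * K ^ (U.card + (H ∪ pathEdges (f 0) l).card))) := by
          ring
      _ ≤ (startWt U (f 0) * K) * D * (W * D ^ (m + 2) * (n ^ a * K ^ (U.card + b))) := by
          gcongr
      _ = _ := by ring
  · have hc : (insert (f 0) U).card = U.card + 1 := Finset.card_insert_of_notMem hU
    rw [hc] at key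
    have hs : startWt U (f 0) = n⁻¹ := by simp [startWt, hU, n]
    have : n * (K ^ (a + H.card) * n ^ U.card) ≤
        n * (startWt U (f 0) * W * D ^ (m + 3) * (n ^ a * K ^ (U.card + b + 1))) := by
      calc _ = 1 * (K ^ (a + H.card) * n ^ (U.card + 1)) := by ring
        _ ≤ D * (W * D ^ (m + 2) * (n ^ a * K ^ (U.card + 1 + b))) := by
          rw [one_mul]
          refine (key.trans ?_).trans (le_mul_of_one_le_left (by positivity) hD)
          gcongr
        _ = _ := by rw [hs]; field_simp; ring
    exact le_of_mul_le_mul_left this (by linarith)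

end CycleEdges

/-! ### Counting linked quadruples of cycles -/

section Quadruples

variable {V : Type*} [Fintype V] [DecidableEq V] {m₁ m₂ m₃ m₄ : ℕ}

lemma sum_embedding_le (m : ℕ) (U : Finset V) (H : Finset (Sym2 V)) :
    ∑ f : Fin m ↪ V, startPathWt U H (List.ofFn f) ≤ 3 ^ m := by
  classical
  refine le_trans ?_ (sum_startPathWt_le m U H)
  rw [← Finset.sum_image (s := Finset.univ) (g := fun f : Fin m ↪ V => (f : Fin m → V))
    (f := fun f : Fin m → V => startPathWt U H (List.ofFn f))
    (fun _ _ _ _ h => DFunLike.coe_injective h)]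
  exact Finset.sum_le_sum_of_subset_of_nonneg (Finset.subset_univ _)
    fun _ _ _ => startPathWt_nonneg _ _ _

/-- The edges of a quadruple of cycles. -/
def quadEdges (a : Fin (m₁ + 3) → V) (b : Fin (m₂ + 3) → V) (c : Fin (m₃ + 3) → V)
    (d : Fin (m₄ + 3) → V) : Finset (Sym2 V) :=
  cycEdges a ∪ cycEdges b ∪ cycEdges c ∪ cycEdges d

/-- The vertices of a quadruple of cycles. -/
def quadVerts (a : Fin (m₁ + 3) → V) (b : Fin (m₂ + 3) → V) (c : Fin (m₃ + 3) → V)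
    (d : Fin (m₄ + 3) → V) : Finset V :=
  cycVerts a ∪ cycVerts b ∪ cycVerts c ∪ cycVerts d

/-- A quadruple of cycles whose first two and last two members share edges, and so do the
two pairs. -/
def QuadConn (a : Fin (m₁ + 3) → V) (b : Fin (m₂ + 3) → V) (c : Fin (m₃ + 3) → V)
    (d : Fin (m₄ + 3) → V) : Prop :=
  ¬ Disjoint (cycEdges a) (cycEdges b) ∧ ¬ Disjoint (cycEdges c) (cycEdges d) ∧
    ¬ Disjoint (cycEdges a ∪ cycEdges b) (cycEdges c ∪ cycEdges d)

/-- Weight of the exploration of a quadruple of cycles. -/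
noncomputable def quadWt (a : Fin (m₁ + 3) → V) (b : Fin (m₂ + 3) → V) (c : Fin (m₃ + 3) → V)
    (d : Fin (m₄ + 3) → V) : ℝ :=
  startPathWt ∅ ∅ (List.ofFn a) *
    (startPathWt (cycVerts a) (cycEdges a) (List.ofFn b) *
      (startPathWt (cycVerts a ∪ cycVerts b) (cycEdges a ∪ cycEdges b) (List.ofFn c) *
        startPathWt (cycVerts a ∪ cycVerts b ∪ cycVerts c)
          (cycEdges a ∪ cycEdges b ∪ cycEdges c) (List.ofFn d)))

lemma quadWt_nonneg (a : Fin (m₁ + 3) → V) (b : Fin (m₂ + 3) → V) (c : Fin (m₃ + 3) → V)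
    (d : Fin (m₄ + 3) → V) : 0 ≤ quadWt a b c d :=
  mul_nonneg (startPathWt_nonneg _ _ _) (mul_nonneg (startPathWt_nonneg _ _ _)
    (mul_nonneg (startPathWt_nonneg _ _ _) (startPathWt_nonneg _ _ _)))

variable (V m₁ m₂ m₃ m₄) in
lemma sum_quadWt_le :
    ∑ a : Fin (m₁ + 3) ↪ V, ∑ b : Fin (m₂ + 3) ↪ V, ∑ c : Fin (m₃ + 3) ↪ V,
      ∑ d : Fin (m₄ + 3) ↪ V, quadWt a b c d ≤
      3 ^ ((m₁ + 3) + (m₂ + 3) + (m₃ + 3) + (m₄ + 3)) := by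
  -- The weight of each cycle depends only on the cycles before it, so the sums are bounded from the
  -- innermost outwards.
  unfold quadWt
  simp only [← Finset.mul_sum]
  calc _ ≤ ∑ a : Fin (m₁ + 3) ↪ V, startPathWt ∅ ∅ (List.ofFn a) *
        ((3 : ℝ) ^ (m₂ + 3) * (3 ^ (m₃ + 3) * 3 ^ (m₄ + 3))) := by
        refine Finset.sum_le_sum fun a _ => ?_
        refine mul_le_mul_of_nonneg_left ?_ (startPathWt_nonneg _ _ _)
        calc _ ≤ ∑ b : Fin (m₂ + 3) ↪ V, startPathWt (cycVerts a) (cycEdges a) (List.ofFn b) *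
              ((3 : ℝ) ^ (m₃ + 3) * 3 ^ (m₄ + 3)) := by
              refine Finset.sum_le_sum fun b _ => ?_
              refine mul_le_mul_of_nonneg_left ?_ (startPathWt_nonneg _ _ _)
              calc _ ≤ ∑ c : Fin (m₃ + 3) ↪ V, startPathWt (cycVerts a ∪ cycVerts b)
                    (cycEdges a ∪ cycEdges b) (List.ofFn c) * (3 : ℝ) ^ (m₄ + 3) := by
                    refine Finset.sum_le_sum fun c _ => ?_
                    exact mul_le_mul_of_nonneg_left (sum_embedding_le _ _ _)
                      (startPathWt_nonneg _ _ _)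
                _ ≤ _ := by
                    rw [← Finset.sum_mul]
                    exact mul_le_mul_of_nonneg_right (sum_embedding_le _ _ _) (by positivity)
          _ ≤ _ := by
              rw [← Finset.sum_mul]
              exact mul_le_mul_of_nonneg_right (sum_embedding_le _ _ _) (by positivity)
    _ ≤ 3 ^ (m₁ + 3) * ((3 : ℝ) ^ (m₂ + 3) * (3 ^ (m₃ + 3) * 3 ^ (m₄ + 3))) := by
        rw [← Finset.sum_mul]
        exact mul_le_mul_of_nonneg_right (sum_embedding_le _ _ _) (by positivity)
    _ = _ := by ring

lemma mem_quadVerts_of_mem_quadEdges {a : Fin (m₁ + 3) → V} {b : Fin (m₂ + 3) → V}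
    {c : Fin (m₃ + 3) → V} {d : Fin (m₄ + 3) → V} {e : Sym2 V} (he : e ∈ quadEdges a b c d)
    {x : V} (hx : x ∈ e) : x ∈ quadVerts a b c d := by
  simp only [quadEdges, quadVerts, Finset.mem_union] at he ⊢
  rcases he with ((he | he) | he) | he <;> simp [mem_cycVerts_of_mem_cycEdges he hx]

/-- The four bounds of `le_startPathWt` are multiplied and the intermediate cardinalities telescope.
The `4` in the exponent of `K` counts the four starting points. -/
lemma le_quadWt (a : Fin (m₁ + 3) → V) (b : Fin (m₂ + 3) → V) (c : Fin (m₃ + 3) → V)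
    (d : Fin (m₄ + 3) → V) {K D : ℝ} (hK : 1 ≤ K) (hD : 1 ≤ D)
    (hUK : ((quadVerts a b c d).card : ℝ) ≤ K)
    (hdeg : ∀ y, ((nbrs (quadEdges a b c d) y).card : ℝ) ≤ D) :
    K ^ (quadVerts a b c d).card ≤
      quadWt a b c d * D ^ ((m₁ + 3) + (m₂ + 3) + (m₃ + 3) + (m₄ + 3)) *
        ((Fintype.card V : ℝ) ^ (quadVerts a b c d).card * K ^ ((quadEdges a b c d).card + 4)) := by
  have hn : (1 : ℝ) ≤ Fintype.card V := by
    have : 0 < Fintype.card V := Fintype.card_pos_iff.2 ⟨a 0⟩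
    exact_mod_cast this
  have hv : ∀ {U : Finset V}, U ⊆ quadVerts a b c d → (U.card : ℝ) ≤ K := fun h =>
    le_trans (by exact_mod_cast Finset.card_le_card h) hUK
  have A1 := le_startPathWt a ∅ ∅ (quadEdges a b c d) hK hD (by simp)
    (hv (by intro x; simp only [quadVerts, Finset.mem_union]; simp; tauto))
    (by intro x; simp only [quadEdges, Finset.mem_union]; simp; tauto) hdeg
  have A2 := le_startPathWt b (cycVerts a) (cycEdges a) (quadEdges a b c d) hK hD
    (fun e he x hx => mem_cycVerts_of_mem_cycEdges he hx)
    (hv (by intro x; simp only [quadVerts, Finset.mem_union]; tauto))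
    (by intro x; simp only [quadEdges, Finset.mem_union]; tauto) hdeg
  have A3 := le_startPathWt c (cycVerts a ∪ cycVerts b) (cycEdges a ∪ cycEdges b)
    (quadEdges a b c d) hK hD
    (fun e he x hx => by
      simp only [Finset.mem_union] at he ⊢
      rcases he with he | he <;> simp [mem_cycVerts_of_mem_cycEdges he hx])
    (hv (by intro x; simp only [quadVerts, Finset.mem_union]; tauto))
    (by intro x; simp only [quadEdges, Finset.mem_union]; tauto) hdeg
  have A4 := le_startPathWt d (cycVerts a ∪ cycVerts b ∪ cycVerts c)
    (cycEdges a ∪ cycEdges b ∪ cycEdges c)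
    (quadEdges a b c d) hK hD
    (fun e he x hx => by
      simp only [Finset.mem_union] at he ⊢
      rcases he with (he | he) | he <;> simp [mem_cycVerts_of_mem_cycEdges he hx])
    hUK (Finset.Subset.refl _) hdeg
  simp only [Finset.empty_union, Finset.card_empty, pow_zero, mul_one, add_zero, zero_add] at A1
  change K ^ ((quadVerts a b c d).card + _) * _ ≤ _ * _ *
    (_ ^ (quadVerts a b c d).card * K ^ (_ + (quadEdges a b c d).card + 1)) at A4
  unfold quadWt
  set n : ℝ := (Fintype.card V : ℝ)
  set w₁ := startPathWt ∅ ∅ (List.ofFn a)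
  set w₂ := startPathWt (cycVerts a) (cycEdges a) (List.ofFn b)
  set w₃ := startPathWt (cycVerts a ∪ cycVerts b) (cycEdges a ∪ cycEdges b) (List.ofFn c)
  set w₄ := startPathWt (cycVerts a ∪ cycVerts b ∪ cycVerts c)
          (cycEdges a ∪ cycEdges b ∪ cycEdges c) (List.ofFn d)
  set v₁ := (cycVerts a).card
  set v₂ := (cycVerts a ∪ cycVerts b).card
  set v₃ := (cycVerts a ∪ cycVerts b ∪ cycVerts c).card
  set v₄ := (quadVerts a b c d).card
  set e₁ := (cycEdges a).card
  set e₂ := (cycEdges a ∪ cycEdges b).card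
  set e₃ := (cycEdges a ∪ cycEdges b ∪ cycEdges c).card
  set e₄ := (quadEdges a b c d).card
  have hw₁ : 0 ≤ w₁ := startPathWt_nonneg _ _ _
  have hw₂ : 0 ≤ w₂ := startPathWt_nonneg _ _ _
  have hw₃ : 0 ≤ w₃ := startPathWt_nonneg _ _ _
  have hw₄ : 0 ≤ w₄ := startPathWt_nonneg _ _ _
  have B := mul_le_mul (mul_le_mul (mul_le_mul A1 A2 (by positivity) (by positivity)) A3
    (by positivity) (by positivity)) A4 (by positivity) (by positivity)
  have hc : 0 < K ^ (v₁ + v₂ + v₃ + e₁ + e₂ + e₃) * n ^ (v₁ + v₂ + v₃) := by positivity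
  refine le_of_mul_le_mul_left ?_ hc
  calc _ = K ^ v₁ * (K ^ (v₂ + e₁) * n ^ v₁) * (K ^ (v₃ + e₂) * n ^ v₂) *
        (K ^ (v₄ + e₃) * n ^ v₃) := by ring
    _ ≤ _ := B
    _ = _ := by ring

/-- With all degrees at most two, cycles sharing an edge have the same edge set. The links of the
quadruple therefore identify all four. -/
lemma quad_defect {a : Fin (m₁ + 3) → V} {b : Fin (m₂ + 3) → V} {c : Fin (m₃ + 3) → V}
    {d : Fin (m₄ + 3) → V} (ha : Function.Injective a) (hb : Function.Injective b)
    (hc : Function.Injective c) (hd : Function.Injective d) (h : QuadConn a b c d)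
    (hdeg : ∀ y, (nbrs (quadEdges a b c d) y).card ≤ 2) :
    (quadEdges a b c d).card = m₁ + 3 ∧ m₁ = m₂ ∧ m₁ = m₃ ∧ m₁ = m₄ := by
  obtain ⟨hab, hcd, habcd⟩ := h
  have sa : cycEdges a ⊆ quadEdges a b c d := by
    intro x; simp only [quadEdges, Finset.mem_union]; tauto
  have sb : cycEdges b ⊆ quadEdges a b c d := by
    intro x; simp only [quadEdges, Finset.mem_union]; tauto
  have sc : cycEdges c ⊆ quadEdges a b c d := by
    intro x; simp only [quadEdges, Finset.mem_union]; tauto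
  have sd : cycEdges d ⊆ quadEdges a b c d := by
    intro x; simp only [quadEdges, Finset.mem_union]; tauto
  have eab : cycEdges a = cycEdges b := subset_antisymm
    (cycEdges_subset_of_card_le_two hb sb sa hdeg (fun h => hab h.symm))
    (cycEdges_subset_of_card_le_two ha sa sb hdeg hab)
  have ecd : cycEdges c = cycEdges d := subset_antisymm
    (cycEdges_subset_of_card_le_two hd sd sc hdeg (fun h => hcd h.symm))
    (cycEdges_subset_of_card_le_two hc sc sd hdeg hcd)
  rw [← eab, ← ecd, Finset.union_self, Finset.union_self] at habcd
  have eac : cycEdges a = cycEdges c := subset_antisymm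
    (cycEdges_subset_of_card_le_two hc sc sa hdeg (fun h => habcd h.symm))
    (cycEdges_subset_of_card_le_two ha sa sc hdeg habcd)
  have c1 := card_cycEdges ha
  have c2 := card_cycEdges hb
  have c3 := card_cycEdges hc
  have c4 := card_cycEdges hd
  rw [← eab] at c2
  rw [← eac] at c3
  rw [← ecd, ← eac] at c4
  refine ⟨?_, by omega, by omega, by omega⟩
  rw [quadEdges, ← ecd, ← eac, ← eab]
  simpa using c1

/-- Pointwise bound: a connected quadruple of cycles covering every edge at least twice on average
has a small weight compared with its exploration weight. -/
lemma quad_pointwise {a : Fin (m₁ + 3) → V} {b : Fin (m₂ + 3) → V} {c : Fin (m₃ + 3) → V}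
    {d : Fin (m₄ + 3) → V} (ha : Function.Injective a) (hb : Function.Injective b)
    (hc : Function.Injective c) (hd : Function.Injective d) (h : QuadConn a b c d) {K : ℕ}
    (hK : K = (m₁ + 3) + (m₂ + 3) + (m₃ + 3) + (m₄ + 3))
    (hE : 2 * (quadEdges a b c d).card ≤ K) {w : ℝ} (hw : 0 < w) (hw1 : w ≤ 1)
    (hN : 1 ≤ √(Fintype.card V) * w) (hKn : (K : ℝ) * 2 ^ K ≤ √(Fintype.card V)) :
    (√(Fintype.card V))⁻¹ ^ K * w⁻¹ ^ (K - 2 * (quadEdges a b c d).card) ≤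
      quadWt a b c d * (K ^ 4 * 2 ^ K * (√(Fintype.card V) * w)⁻¹) := by
  have hU2 : ∀ y ∈ quadVerts a b c d, 2 ≤ (nbrs (quadEdges a b c d) y).card := by
    intro y hy
    simp only [quadVerts, Finset.mem_union] at hy
    rcases hy with ((hy | hy) | hy) | hy
    · exact two_le_card_nbrs ha (by intro x; simp only [quadEdges, Finset.mem_union]; tauto) hy
    · exact two_le_card_nbrs hb (by intro x; simp only [quadEdges, Finset.mem_union]; tauto) hy
    · exact two_le_card_nbrs hc (by intro x; simp only [quadEdges, Finset.mem_union]; tauto) hy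
    · exact two_le_card_nbrs hd (by intro x; simp only [quadEdges, Finset.mem_union]; tauto) hy
  have hdiag : ∀ e ∈ quadEdges a b c d, ¬ e.IsDiag := by
    intro e he
    simp only [quadEdges, Finset.mem_union] at he
    rcases he with ((he | he) | he) | he
    exacts [not_isDiag_of_mem_cycEdges ha he, not_isDiag_of_mem_cycEdges hb he,
      not_isDiag_of_mem_cycEdges hc he, not_isDiag_of_mem_cycEdges hd he]
  obtain ⟨hvE, hdeg⟩ := card_le_and_card_nbrs_le hdiag hU2
    (fun e he x hx => mem_quadVerts_of_mem_quadEdges he hx)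
  have hdef := quad_defect ha hb hc hd h
  have hq := le_quadWt a b c d (K := (K : ℝ))
    (D := 2 + 2 * (((quadEdges a b c d).card - (quadVerts a b c d).card : ℕ) : ℝ))
    (by exact_mod_cast (by omega : 1 ≤ K)) (by
      have : (0 : ℝ) ≤ (((quadEdges a b c d).card - (quadVerts a b c d).card : ℕ) : ℝ) := by
        positivity
      linarith) (by exact_mod_cast (by omega)) (fun y => by exact_mod_cast hdeg y)
  rw [← hK] at hq
  have hW := quadWt_nonneg a b c d
  set W := quadWt a b c d
  set v := (quadVerts a b c d).card
  obtain ⟨x, hx⟩ : ∃ x, (quadEdges a b c d).card = v + x := ⟨_, (Nat.add_sub_cancel' hvE).symm⟩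
  obtain ⟨y, hy⟩ : ∃ y, K = 2 * (v + x) + y :=
    ⟨_, by rw [← hx]; exact (Nat.add_sub_cancel' hE).symm⟩
  rw [hx] at hq hdeg hdef ⊢
  rw [Nat.add_sub_cancel_left] at hq hdeg
  -- Here `x` is the excess of edges over vertices and `y` the surplus of the total length over a
  -- double cover. If `x = 0`, all degrees are at most two and the four cycles coincide; the common
  -- edge set is then covered four times, so `y > 0`.
  have hxy : 1 ≤ x + y := by
    by_contra h0
    have hx0 : x = 0 := by omega
    subst hx0
    obtain ⟨h1, h2, h3, h4⟩ := hdef (by simpa using hdeg)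
    omega
  have hyK : K - 2 * (v + x) = y := by omega
  rw [hyK]
  have hn0 : 0 < Fintype.card V := Fintype.card_pos_iff.2 ⟨a 0⟩
  have hn : (Fintype.card V : ℝ) = √(Fintype.card V) ^ 2 := (Real.sq_sqrt (by positivity)).symm
  have hu0 : 0 < √(Fintype.card V : ℝ) := Real.sqrt_pos.2 (by exact_mod_cast hn0)
  rw [hn] at hq
  set u := √(Fintype.card V : ℝ)
  have hK0 : (0 : ℝ) < K := by exact_mod_cast (by omega : 0 < K)
  have hD : (2 + 2 * (x : ℝ)) ^ K ≤ 2 ^ K * (2 ^ K) ^ x := by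
    rw [← pow_mul, mul_comm K x, pow_mul, ← mul_pow]
    have : (1 : ℝ) + x ≤ 2 ^ x := by
      have := one_add_mul_le_pow (a := (1 : ℝ)) (by norm_num) x
      norm_num at this; linarith
    exact pow_le_pow_left₀ (by positivity) (by linarith) _
  -- the vertices of the exploration
  have h1 : (u ^ 2)⁻¹ ^ v ≤ W * (2 ^ K * (2 ^ K) ^ x) * (K : ℝ) ^ (x + 4) := by
    have h2 : (K : ℝ) ^ v * 1 ≤ K ^ v * (W * (2 ^ K * (2 ^ K) ^ x) * K ^ (x + 4) * (u ^ 2) ^ v) := by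
      rw [mul_one]
      refine hq.trans ?_
      calc _ ≤ W * (2 ^ K * (2 ^ K) ^ x) * ((u ^ 2) ^ v * (K : ℝ) ^ (v + x + 4)) := by gcongr
        _ = _ := by ring
    have h3 := le_of_mul_le_mul_left h2 (by positivity)
    rw [inv_pow, inv_le_iff_one_le_mul₀ (by positivity)]
    exact h3
  -- A unit of excess gains `n⁻¹` and loses `K * 2 ^ K`. The assumption on `K` leaves at least the
  -- gain `(√n w)⁻¹`, the same as for a unit of `y`.
  have hux : (K : ℝ) * 2 ^ K * (u ^ 2)⁻¹ ≤ (u * w)⁻¹ := by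
    calc (K : ℝ) * 2 ^ K * (u ^ 2)⁻¹ ≤ u * (u ^ 2)⁻¹ := by gcongr
      _ = u⁻¹ := by field_simp
      _ ≤ (u * w)⁻¹ := by
        apply inv_anti₀ (by positivity)
        exact mul_le_of_le_one_right hu0.le hw1
  have hz1 : (u * w)⁻¹ ≤ 1 := inv_le_one_of_one_le₀ hN
  have hz0 : 0 ≤ (u * w)⁻¹ := by positivity
  calc u⁻¹ ^ K * w⁻¹ ^ y = (u ^ 2)⁻¹ ^ v * ((u ^ 2)⁻¹ ^ x * (u * w)⁻¹ ^ y) := by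
        rw [hy, pow_add, pow_mul, mul_inv, mul_pow, pow_add, inv_pow u 2]; ring
    _ ≤ (W * (2 ^ K * (2 ^ K) ^ x) * (K : ℝ) ^ (x + 4)) * ((u ^ 2)⁻¹ ^ x * (u * w)⁻¹ ^ y) := by
        gcongr
    _ = W * (K ^ 4 * 2 ^ K) * ((K * 2 ^ K * (u ^ 2)⁻¹) ^ x * (u * w)⁻¹ ^ y) := by
        rw [mul_pow, mul_pow]; ring
    _ ≤ W * (K ^ 4 * 2 ^ K) * ((u * w)⁻¹ ^ x * (u * w)⁻¹ ^ y) := by gcongr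
    _ = W * (K ^ 4 * 2 ^ K) * (u * w)⁻¹ ^ (x + y) := by rw [pow_add]
    _ ≤ W * (K ^ 4 * 2 ^ K) * (u * w)⁻¹ ^ 1 := by
        gcongr W * (K ^ 4 * 2 ^ K) * ?_
        exact pow_le_pow_of_le_one hz0 hz1 hxy
    _ = _ := by ring

open Classical in
/-- The sum of the weights of all connected quadruples of cycles that cover every edge at least
twice is small. -/
lemma quad_bound {K : ℕ} (hK : K = (m₁ + 3) + (m₂ + 3) + (m₃ + 3) + (m₄ + 3)) {w : ℝ} (hw : 0 < w)
    (hw1 : w ≤ 1) (hN : 1 ≤ √(Fintype.card V) * w)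
    (hKn : (K : ℝ) * 2 ^ K ≤ √(Fintype.card V)) :
    ∑ a : Fin (m₁ + 3) ↪ V, ∑ b : Fin (m₂ + 3) ↪ V, ∑ c : Fin (m₃ + 3) ↪ V,
      ∑ d : Fin (m₄ + 3) ↪ V,
      (if QuadConn a b c d ∧ 2 * (quadEdges a b c d).card ≤ K then
        (√(Fintype.card V))⁻¹ ^ K * w⁻¹ ^ (K - 2 * (quadEdges a b c d).card) else 0) ≤
      3 ^ K * (K ^ 4 * 2 ^ K * (√(Fintype.card V) * w)⁻¹) := by
  have h := mul_le_mul_of_nonneg_right (sum_quadWt_le V m₁ m₂ m₃ m₄)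
    (by positivity : (0 : ℝ) ≤ (K ^ 4 * 2 ^ K * (√(Fintype.card V) * w)⁻¹))
  rw [← hK] at h
  refine le_trans ?_ h
  simp only [Finset.sum_mul]
  refine Finset.sum_le_sum fun a _ => Finset.sum_le_sum fun b _ => Finset.sum_le_sum fun c _ =>
    Finset.sum_le_sum fun d _ => ?_
  split_ifs with hq
  · exact quad_pointwise a.injective b.injective c.injective d.injective hq.1 hK hq.2 hw hw1 hN hKn
  · exact mul_nonneg (quadWt_nonneg _ _ _ _) (by positivity)

end Quadruples

/-! ### Stein's method for characteristic functions on a finite space -/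

section Stein

variable {Ω : Type*} [Fintype Ω]

/-- Expectation of a real function on a finite weighted space. -/
def ex (π : Ω → ℝ) (f : Ω → ℝ) : ℝ := ∑ ω, π ω * f ω

lemma ex_mono {π : Ω → ℝ} (hπ : ∀ ω, 0 ≤ π ω) {f g : Ω → ℝ} (h : ∀ ω, f ω ≤ g ω) :
    ex π f ≤ ex π g :=
  Finset.sum_le_sum fun ω _ => mul_le_mul_of_nonneg_left (h ω) (hπ ω)

lemma ex_add (π f g : Ω → ℝ) : ex π (fun ω => f ω + g ω) = ex π f + ex π g := by
  simp [ex, mul_add, Finset.sum_add_distrib]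

lemma ex_const_mul (π f : Ω → ℝ) (c : ℝ) : ex π (fun ω => c * f ω) = c * ex π f := by
  simp only [ex, Finset.mul_sum]; exact Finset.sum_congr rfl fun _ _ => by ring

lemma ex_sum {α : Type*} (s : Finset α) (π : Ω → ℝ) (f : α → Ω → ℝ) :
    ex π (fun ω => ∑ a ∈ s, f a ω) = ∑ a ∈ s, ex π (f a) := by
  simp only [ex, Finset.mul_sum]; exact Finset.sum_comm

lemma ex_const {π : Ω → ℝ} (hπ : ∑ ω, π ω = 1) (c : ℝ) : ex π (fun _ => c) = c := by
  simp [ex, ← Finset.sum_mul, hπ]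

lemma sq_ex_abs_le {π : Ω → ℝ} (hπ : ∀ ω, 0 ≤ π ω) (h1 : ∑ ω, π ω = 1) (f : Ω → ℝ) :
    ex π (fun ω => |f ω|) ^ 2 ≤ ex π (fun ω => f ω ^ 2) := by
  have := Finset.sum_sq_le_sum_mul_sum_of_sq_le_mul Finset.univ (r := fun ω => π ω * |f ω|)
    (f := π) (g := fun ω => π ω * f ω ^ 2) (fun ω _ => hπ ω)
    (fun ω _ => mul_nonneg (hπ ω) (sq_nonneg _)) (fun ω _ => by rw [mul_pow, sq_abs]; apply le_of_eq; ring)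
  rwa [h1, one_mul] at this

lemma ex_abs_le_sqrt {π : Ω → ℝ} (hπ : ∀ ω, 0 ≤ π ω) (h1 : ∑ ω, π ω = 1) (f : Ω → ℝ) :
    ex π (fun ω => |f ω|) ≤ √(ex π (fun ω => f ω ^ 2)) :=
  Real.le_sqrt_of_sq_le (sq_ex_abs_le hπ h1 f)

lemma norm_one_sub_exp_sub_le (u : ℝ) :
    ‖1 - Complex.exp (-(Complex.I * u)) - Complex.I * u‖ ≤ 3 * u ^ 2 := by
  have hnorm : ‖-(Complex.I * (u : ℂ))‖ = |u| := by simp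
  have e : 1 - Complex.exp (-(Complex.I * u)) - Complex.I * u =
      -(Complex.exp (-(Complex.I * u)) - 1 - -(Complex.I * u)) := by ring
  rw [e, norm_neg]
  by_cases hu : |u| ≤ 1
  · refine (Complex.norm_exp_sub_one_sub_id_le (by rwa [hnorm])).trans ?_
    rw [hnorm, sq_abs]; nlinarith [sq_nonneg u]
  · have h1 : ‖Complex.exp (-(Complex.I * (u : ℂ)))‖ = 1 := by
      have : -(Complex.I * (u : ℂ)) = ((-u : ℝ) : ℂ) * Complex.I := by push_cast; ring
      rw [this, Complex.norm_exp_ofReal_mul_I]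
    calc _ ≤ ‖Complex.exp (-(Complex.I * (u : ℂ)))‖ + ‖(1 : ℂ)‖ + ‖-(Complex.I * (u : ℂ))‖ :=
          (norm_sub_le _ _).trans (by gcongr; exact norm_sub_le _ _)
      _ = 1 + 1 + |u| := by rw [h1, hnorm, norm_one]
      _ ≤ 3 * |u| ^ 2 := by nlinarith
      _ = _ := by rw [sq_abs]

/-- Expectation of a complex function on a finite weighted space. -/
noncomputable def cex (π : Ω → ℝ) (f : Ω → ℂ) : ℂ := ∑ ω, (π ω : ℂ) * f ω

lemma norm_cex_le {π : Ω → ℝ} (hπ : ∀ ω, 0 ≤ π ω) {f : Ω → ℂ} {g : Ω → ℝ}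
    (h : ∀ ω, ‖f ω‖ ≤ g ω) : ‖cex π f‖ ≤ ex π g := by
  refine (norm_sum_le _ _).trans (Finset.sum_le_sum fun ω _ => ?_)
  rw [norm_mul, Complex.norm_real, Real.norm_of_nonneg (hπ ω)]
  exact mul_le_mul_of_nonneg_left (h ω) (hπ ω)

lemma norm_exp_I_mul_mul (s x : ℝ) : ‖Complex.exp (Complex.I * (s * x))‖ = 1 := by
  have : Complex.I * ((s : ℂ) * x) = ((s * x : ℝ) : ℂ) * Complex.I := by push_cast; ring
  rw [this, Complex.norm_exp_ofReal_mul_I]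

/-- A characteristic function nearly satisfying the Gaussian differential equation is nearly
Gaussian. -/
lemma norm_sub_gaussian_le {g g' : ℝ → ℂ} {v ε : ℝ} (hv : 0 ≤ v) (h0 : g 0 = 1)
    (hg : ∀ s, HasDerivAt g (g' s) s)
    (h : ∀ s ∈ Set.Icc (0 : ℝ) 1, ‖g' s + s * v * g s‖ ≤ ε) :
    ‖g 1 - Complex.exp (-v / 2)‖ ≤ ε := by
  have hε : 0 ≤ ε := (norm_nonneg _).trans (h 0 (by simp))
  -- Integrating factor: `F` is nearly constant, and the bound `exp (v / 2)` for the factor on `[0,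
  -- 1]` is undone when multiplying back by `exp (-v / 2)`.
  set F : ℝ → ℂ := fun s => Complex.exp (((s ^ 2 * v / 2 : ℝ) : ℂ)) * g s with hF
  have hd : ∀ s, HasDerivAt F (Complex.exp (((s ^ 2 * v / 2 : ℝ) : ℂ)) * (g' s + s * v * g s)) s := by
    intro s
    have h1 : HasDerivAt (fun s : ℝ => s ^ 2 * v / 2) (s * v) s := by
      have := (((hasDerivAt_pow 2 s).mul_const v).div_const 2)
      refine this.congr_deriv ?_
      push_cast; ring
    have h2 := (h1.ofReal_comp.cexp).mul (hg s)
    refine h2.congr_deriv ?_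
    push_cast; ring
  have hb := norm_image_sub_le_of_norm_deriv_le_segment_01' (f := F)
    (C := Real.exp (v / 2) * ε)
    (fun s _ => (hd s).hasDerivWithinAt) (fun s hs => by
      rw [norm_mul, Complex.norm_exp_ofReal]
      refine mul_le_mul (Real.exp_le_exp.2 ?_) (h s ⟨hs.1, hs.2.le⟩) (norm_nonneg _)
        (Real.exp_pos _).le
      have : s ^ 2 ≤ 1 := by nlinarith [hs.1, hs.2]
      nlinarith)
  have e : g 1 - Complex.exp (-v / 2) =
      Complex.exp (((-(v / 2) : ℝ) : ℂ)) * (F 1 - F 0) := by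
    simp only [hF]
    rw [h0, mul_sub, ← mul_assoc, ← Complex.exp_add]
    have : ((-(v / 2) : ℝ) : ℂ) + ((1 ^ 2 * v / 2 : ℝ) : ℂ) = 0 := by push_cast; ring
    rw [this]
    simp [neg_div]
  rw [e, norm_mul, Complex.norm_exp_ofReal]
  calc _ ≤ Real.exp (-(v / 2)) * (Real.exp (v / 2) * ε) := by gcongr
    _ = ε := by rw [← mul_assoc, ← Real.exp_add]; simp

/-- **Stein's method with local dependence**: if `F = ∑ X a` and each `X a` is uncorrelated with
functions of `F - Y a`, then the distance of the characteristic function of `F` from a Gaussian one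
is controlled by the fluctuations of `∑ X a Y a` and by third moments. -/
lemma stein_bound {A : Type*} [Fintype A] {π : Ω → ℝ} (hπ : ∀ ω, 0 ≤ π ω) (h1 : ∑ ω, π ω = 1)
    (X Y : A → Ω → ℝ) (F : Ω → ℝ) (hF : ∀ ω, F ω = ∑ a, X a ω)
    (hXY : ∀ a, ∀ s : ℝ,
      cex π (fun ω => X a ω * Complex.exp (Complex.I * (s * (F ω - Y a ω : ℝ)))) = 0)
    {v : ℝ} (hv : 0 ≤ v) :
    ‖cex π (fun ω => Complex.exp (Complex.I * F ω)) - Complex.exp (-v / 2)‖ ≤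
      ex π (fun ω => |(∑ a, X a ω * Y a ω) - v|) +
        3 * ∑ a, ex π (fun ω => |X a ω| * Y a ω ^ 2) := by
  set g : ℝ → ℂ := fun s => cex π (fun ω => Complex.exp (Complex.I * (s * F ω))) with hg
  set g' : ℝ → ℂ := fun s => cex π (fun ω => Complex.I * F ω *
    Complex.exp (Complex.I * (s * F ω))) with hg'
  have hderiv : ∀ s, HasDerivAt g (g' s) s := by
    intro s
    simp only [hg, hg', cex]
    refine HasDerivAt.fun_sum fun ω _ => ?_
    refine HasDerivAt.const_mul _ ?_
    have h2 : HasDerivAt (fun s : ℝ => Complex.I * ((s : ℂ) * F ω)) (Complex.I * F ω) s := by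
      have := ((Complex.ofRealCLM.hasDerivAt (x := s)).mul_const (F ω : ℂ)).const_mul Complex.I
      simpa using this
    refine h2.cexp.congr_deriv ?_
    ring
  have hmain := norm_sub_gaussian_le (g := g) (g' := g') hv (by
    simp [hg, cex]; exact_mod_cast h1) hderiv (ε := ex π (fun ω => |(∑ a, X a ω * Y a ω) - v|) +
        3 * ∑ a, ex π (fun ω => |X a ω| * Y a ω ^ 2)) ?_
  · simpa [hg] using hmain
  intro s hs
  -- Subtract the vanishing terms `E [i X exp (i s (F - Y))]` from `g' s` and expand `exp (-i s Y)`
  -- to first order. The linear part gives `-s ∑ X Y`, which nearly cancels `s v`; the remainder is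
  -- quadratic in `Y`.
  have key : g' s + s * v * g s =
      cex π (fun ω => -(s : ℂ) * (((∑ a, X a ω * Y a ω) - v : ℝ) : ℂ) *
        Complex.exp (Complex.I * (s * F ω))) +
      cex π (fun ω => ∑ a, Complex.I * X a ω * (Complex.exp (Complex.I * (s * F ω)) *
        (1 - Complex.exp (-(Complex.I * ((s * Y a ω : ℝ) : ℂ))) -
          Complex.I * ((s * Y a ω : ℝ) : ℂ)))) := by
    have hz : cex π (fun ω => ∑ a, Complex.I * (X a ω *
        Complex.exp (Complex.I * (s * (F ω - Y a ω : ℝ))))) = 0 := by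
      have : cex π (fun ω => ∑ a, Complex.I * (X a ω *
          Complex.exp (Complex.I * (s * (F ω - Y a ω : ℝ))))) =
          ∑ a, Complex.I * cex π (fun ω => X a ω *
          Complex.exp (Complex.I * (s * (F ω - Y a ω : ℝ)))) := by
        simp only [cex, Finset.mul_sum]
        rw [Finset.sum_comm]
        exact Finset.sum_congr rfl fun _ _ => Finset.sum_congr rfl fun _ _ => by ring
      rw [this]
      exact Finset.sum_eq_zero fun a _ => by rw [hXY, mul_zero]
    rw [← sub_zero (g' s + s * v * g s), ← hz]
    simp only [hg, hg', cex]
    rw [Finset.mul_sum, ← Finset.sum_add_distrib, ← Finset.sum_sub_distrib,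
      ← Finset.sum_add_distrib]
    refine Finset.sum_congr rfl fun ω _ => ?_
    have hexp : ∀ a, Complex.exp (Complex.I * (s * F ω)) *
        Complex.exp (-(Complex.I * ((s * Y a ω : ℝ) : ℂ))) =
        Complex.exp (Complex.I * (s * (F ω - Y a ω : ℝ))) := by
      intro a
      rw [← Complex.exp_add]; congr 1; push_cast; ring
    have hsum : ∀ a, Complex.I * X a ω * (Complex.exp (Complex.I * (s * F ω)) *
        (1 - Complex.exp (-(Complex.I * ((s * Y a ω : ℝ) : ℂ))) -
          Complex.I * ((s * Y a ω : ℝ) : ℂ))) =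
        Complex.I * X a ω * Complex.exp (Complex.I * (s * F ω)) -
        Complex.I * (X a ω * Complex.exp (Complex.I * (s * (F ω - Y a ω : ℝ)))) +
        s * (X a ω * Y a ω) * Complex.exp (Complex.I * (s * F ω)) := by
      intro a
      rw [← hexp]
      push_cast
      linear_combination (-(X a ω * Complex.exp (Complex.I * (s * F ω)) * s * Y a ω : ℂ)) * Complex.I_sq
    rw [Finset.sum_congr rfl fun a _ => hsum a, Finset.sum_add_distrib, Finset.sum_sub_distrib]
    have e1 : ∑ a, Complex.I * X a ω * Complex.exp (Complex.I * (s * F ω)) =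
        Complex.I * F ω * Complex.exp (Complex.I * (s * F ω)) := by
      rw [← Finset.sum_mul, ← Finset.mul_sum, hF ω]; push_cast; rfl
    have e2 : ∑ a, (s : ℂ) * (X a ω * Y a ω) * Complex.exp (Complex.I * (s * F ω)) =
        s * ((∑ a, X a ω * Y a ω : ℝ) : ℂ) * Complex.exp (Complex.I * (s * F ω)) := by
      rw [← Finset.sum_mul, ← Finset.mul_sum]; push_cast; rfl
    rw [e1, e2]
    push_cast
    ring
  rw [key]
  refine (norm_add_le _ _).trans (add_le_add ?_ ?_)
  · refine norm_cex_le hπ fun ω => ?_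
    rw [norm_mul, norm_mul, norm_exp_I_mul_mul, mul_one, norm_neg, Complex.norm_real,
      Complex.norm_real, Real.norm_eq_abs, Real.norm_eq_abs, abs_of_nonneg hs.1]
    exact mul_le_of_le_one_left (abs_nonneg _) hs.2
  · rw [← ex_sum, ← ex_const_mul]
    refine norm_cex_le hπ fun ω => ?_
    rw [Finset.mul_sum]
    refine (norm_sum_le _ _).trans (Finset.sum_le_sum fun a _ => ?_)
    rw [norm_mul, norm_mul, norm_mul, norm_exp_I_mul_mul, one_mul, Complex.norm_I, one_mul,
      Complex.norm_real, Real.norm_eq_abs]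
    calc _ ≤ |X a ω| * (3 * (s * Y a ω) ^ 2) := by
          gcongr; exact norm_one_sub_exp_sub_le _
      _ = s ^ 2 * (3 * (|X a ω| * Y a ω ^ 2)) := by ring
      _ ≤ 1 * (3 * (|X a ω| * Y a ω ^ 2)) := by
          gcongr; nlinarith [hs.1, hs.2]
      _ = _ := by ring

end Stein

/-! ### Moments of monomials in independent centred variables -/

section Noise

variable {ι B : Type*} [Fintype ι] [DecidableEq ι] [Fintype B]

/-- Independent centered variables `ξ i` (with law given by the weights `w i`), bounded by `ρ⁻¹`
and of variance within `ε` of one. -/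
structure IsNoise (w ξ : ι → B → ℝ) (ρ ε : ℝ) : Prop where
  nonneg : ∀ i b, 0 ≤ w i b
  sum_eq_one : ∀ i, ∑ b, w i b = 1
  mean : ∀ i, ∑ b, w i b * ξ i b = 0
  bound : ∀ i b, |ξ i b| ≤ ρ⁻¹
  var : ∀ i, |∑ b, w i b * ξ i b ^ 2 - 1| ≤ ε
  pos : 0 < ρ
  le_one : ρ ≤ 1
  eps_le : ε ≤ 1

/-- Product weights. -/
def prodWt (w : ι → B → ℝ) (ω : ι → B) : ℝ := ∏ i, w i (ω i)

/-- Moments of the coordinates. -/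
def mom (w ξ : ι → B → ℝ) (i : ι) (k : ℕ) : ℝ := ∑ b, w i b * ξ i b ^ k

/-- The monomial with exponents `c`. -/
def mono (ξ : ι → B → ℝ) (c : ι → ℕ) (ω : ι → B) : ℝ := ∏ i, ξ i (ω i) ^ c i

/-- The support of a system of exponents. -/
def expSupp (c : ι → ℕ) : Finset ι := Finset.univ.filter fun i => c i ≠ 0

/-- The bound for the expectation of a monomial. -/
noncomputable def momBound (ρ : ℝ) (c : ι → ℕ) : ℝ :=
  if 2 * (expSupp c).card ≤ ∑ i, c i then
    2 ^ (∑ i, c i) * ρ⁻¹ ^ (∑ i, c i - 2 * (expSupp c).card) else 0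

variable {w ξ : ι → B → ℝ} {ρ ε : ℝ}

lemma prodWt_nonneg (h : IsNoise w ξ ρ ε) (ω : ι → B) : 0 ≤ prodWt w ω :=
  Finset.prod_nonneg fun i _ => h.nonneg i _

lemma ex_prod (f : ι → B → ℝ) : ex (prodWt w) (fun ω => ∏ i, f i (ω i)) =
    ∏ i, ∑ b, w i b * f i b := by
  rw [Finset.prod_univ_sum, Fintype.piFinset_univ]
  simp only [ex, prodWt, Finset.prod_mul_distrib]

lemma sum_prodWt (h : IsNoise w ξ ρ ε) : ∑ ω, prodWt w ω = 1 := by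
  have := ex_prod (w := w) (fun _ _ => 1)
  simpa [ex, h.sum_eq_one] using this

lemma ex_monomial (c : ι → ℕ) : ex (prodWt w) (mono ξ c) = ∏ i, mom w ξ i (c i) :=
  ex_prod fun i b => ξ i b ^ c i

lemma mom_zero (h : IsNoise w ξ ρ ε) (i : ι) : mom w ξ i 0 = 1 := by
  simp [mom, h.sum_eq_one]

lemma mom_one (h : IsNoise w ξ ρ ε) (i : ι) : mom w ξ i 1 = 0 := by
  simp [mom, h.mean]

lemma abs_mom_two_le (h : IsNoise w ξ ρ ε) (i : ι) : |mom w ξ i 2| ≤ 2 := by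
  have h1 := abs_le.1 (h.var i)
  have h2 := h.eps_le
  unfold mom
  rw [abs_le]; constructor <;> linarith

lemma abs_mom_le (h : IsNoise w ξ ρ ε) (i : ι) (k : ℕ) : |mom w ξ i (k + 2)| ≤ 2 * ρ⁻¹ ^ k := by
  have hs : 0 < ρ⁻¹ := inv_pos.2 h.pos
  calc |mom w ξ i (k + 2)| ≤ ∑ b, w i b * ξ i b ^ 2 * ρ⁻¹ ^ k := by
        refine (Finset.abs_sum_le_sum_abs _ _).trans (Finset.sum_le_sum fun b _ => ?_)
        rw [pow_add, abs_mul, abs_of_nonneg (h.nonneg i b), abs_mul, abs_pow, abs_pow, sq_abs]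
        have : |ξ i b| ^ k ≤ ρ⁻¹ ^ k := pow_le_pow_left₀ (abs_nonneg _) (h.bound i b) k
        have h0 := h.nonneg i b
        calc w i b * (|ξ i b| ^ k * ξ i b ^ 2) ≤ w i b * (ρ⁻¹ ^ k * ξ i b ^ 2) := by gcongr
          _ = _ := by ring
    _ = mom w ξ i 2 * ρ⁻¹ ^ k := by rw [← Finset.sum_mul]; rfl
    _ ≤ 2 * ρ⁻¹ ^ k := by
        gcongr; exact (le_abs_self _).trans (abs_mom_two_le h i)

lemma momBound_nonneg (hρ : 0 < ρ) (c : ι → ℕ) : 0 ≤ momBound ρ c := by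
  unfold momBound; split_ifs <;> positivity

lemma ex_monomial_eq_zero (h : IsNoise w ξ ρ ε) {c : ι → ℕ} {i : ι} (hi : c i = 1) :
    ex (prodWt w) (mono ξ c) = 0 := by
  rw [ex_monomial]
  exact Finset.prod_eq_zero (Finset.mem_univ i) (by rw [hi, mom_one h])

/-- An exponent one kills the expectation by centering. Otherwise each variable in the support
contributes a variance, at most `2`, and its remaining powers are bounded by `ρ⁻¹`. -/
lemma abs_ex_monomial_le (h : IsNoise w ξ ρ ε) (c : ι → ℕ) :
    |ex (prodWt w) (mono ξ c)| ≤ momBound ρ c := by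
  have hs : 0 < ρ⁻¹ := inv_pos.2 h.pos
  by_cases hc : ∃ i, c i = 1
  · obtain ⟨i, hi⟩ := hc
    rw [ex_monomial_eq_zero h hi, abs_zero]
    exact momBound_nonneg h.pos c
  push Not at hc
  have hsum : ∑ i, c i = ∑ i ∈ expSupp c, c i := by
    symm
    refine Finset.sum_subset (Finset.subset_univ _) fun i _ hi => ?_
    simpa [expSupp] using hi
  have h2 : ∀ i ∈ expSupp c, 2 ≤ c i := by
    intro i hi
    have h1 : c i ≠ 0 := by simpa [expSupp] using hi
    have := hc i
    omega
  have hsub : ∑ i ∈ expSupp c, (c i - 2) = ∑ i, c i - 2 * (expSupp c).card := by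
    have : ∑ i ∈ expSupp c, c i = ∑ i ∈ expSupp c, (c i - 2) + 2 * (expSupp c).card := by
      rw [mul_comm, ← smul_eq_mul, ← Finset.sum_const, ← Finset.sum_add_distrib]
      exact Finset.sum_congr rfl fun i hi => (Nat.sub_add_cancel (h2 i hi)).symm
    omega
  have hle : 2 * (expSupp c).card ≤ ∑ i, c i := by
    rw [hsum, mul_comm, ← smul_eq_mul]
    exact Finset.card_nsmul_le_sum _ _ _ h2
  rw [ex_monomial, momBound, if_pos hle, Finset.abs_prod]
  calc ∏ i, |mom w ξ i (c i)| = ∏ i ∈ expSupp c, |mom w ξ i (c i)| := by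
        symm
        refine Finset.prod_subset (Finset.subset_univ _) fun i _ hi => ?_
        have : c i = 0 := by simpa [expSupp] using hi
        rw [this, mom_zero h, abs_one]
    _ ≤ ∏ i ∈ expSupp c, (2 * ρ⁻¹ ^ (c i - 2)) := by
        refine Finset.prod_le_prod (fun _ _ => abs_nonneg _) fun i hi => ?_
        have := abs_mom_le h i (c i - 2)
        rwa [Nat.sub_add_cancel (h2 i hi)] at this
    _ = 2 ^ (expSupp c).card * ρ⁻¹ ^ (∑ i, c i - 2 * (expSupp c).card) := by
        rw [Finset.prod_mul_distrib, Finset.prod_const, Finset.prod_pow_eq_pow_sum, hsub]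
    _ ≤ 2 ^ (∑ i, c i) * ρ⁻¹ ^ (∑ i, c i - 2 * (expSupp c).card) := by
        gcongr
        · norm_num
        · omega

lemma expSupp_add (c d : ι → ℕ) : expSupp (c + d) = expSupp c ∪ expSupp d := by
  ext i; simp only [expSupp, Finset.mem_filter, Finset.mem_univ, true_and, Finset.mem_union,
    Pi.add_apply]; omega

/-- The covariance of two monomials is bounded, and vanishes for disjoint supports. -/
lemma abs_cov_monomial_le (h : IsNoise w ξ ρ ε) (c d : ι → ℕ) :
    |ex (prodWt w) (mono ξ (c + d)) - ex (prodWt w) (mono ξ c) * ex (prodWt w) (mono ξ d)| ≤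
      if Disjoint (expSupp c) (expSupp d) then 0 else 2 * momBound ρ (c + d) := by
  have hs1 : 1 ≤ ρ⁻¹ := (one_le_inv₀ h.pos).2 h.le_one
  split_ifs with hd
  · rw [ex_monomial, ex_monomial, ex_monomial, ← Finset.prod_mul_distrib]
    apply le_of_eq
    rw [abs_eq_zero, sub_eq_zero]
    refine Finset.prod_congr rfl fun i _ => ?_
    have : c i = 0 ∨ d i = 0 := by
      by_contra hcd
      push Not at hcd
      exact Finset.disjoint_left.1 hd (by simpa [expSupp] using hcd.1)
        (by simpa [expSupp] using hcd.2)
    rcases this with h0 | h0 <;> simp [h0, mom_zero h]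
  -- `momBound` requires exponents at least two only on average. That weaker condition passes to
  -- sums, since the support of `c + d` has at most the sum of the two cardinalities; this lets the
  -- product of expectations be absorbed.
  · have hprod : momBound ρ c * momBound ρ d ≤ momBound ρ (c + d) := by
      by_cases hc : 2 * (expSupp c).card ≤ ∑ i, c i
      swap
      · rw [momBound, if_neg hc, zero_mul]; exact momBound_nonneg h.pos _
      by_cases hd : 2 * (expSupp d).card ≤ ∑ i, d i
      swap
      · rw [momBound, momBound, if_neg hd, mul_zero]; exact momBound_nonneg h.pos _
      have hcard : (expSupp (c + d)).card ≤ (expSupp c).card + (expSupp d).card := by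
        rw [expSupp_add]; exact Finset.card_union_le _ _
      have hsum : ∑ i, (c + d) i = ∑ i, c i + ∑ i, d i := Finset.sum_add_distrib
      rw [momBound, momBound, momBound, if_pos hc, if_pos hd, if_pos (by omega), hsum]
      calc _ = 2 ^ (∑ i, c i + ∑ i, d i) *
            ρ⁻¹ ^ ((∑ i, c i - 2 * (expSupp c).card) + (∑ i, d i - 2 * (expSupp d).card)) := by
            rw [pow_add, pow_add]; ring
        _ ≤ _ := by gcongr; omega
    calc _ ≤ |ex (prodWt w) (mono ξ (c + d))| +
          |ex (prodWt w) (mono ξ c)| * |ex (prodWt w) (mono ξ d)| := by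
          rw [← abs_mul]; exact abs_sub _ _
      _ ≤ momBound ρ (c + d) + momBound ρ c * momBound ρ d := by
          gcongr
          · exact abs_ex_monomial_le h _
          · exact momBound_nonneg h.pos _
          · exact abs_ex_monomial_le h _
          · exact abs_ex_monomial_le h _
      _ ≤ _ := by linarith

lemma mono_add (c d : ι → ℕ) (ω : ι → B) : mono ξ (c + d) ω = mono ξ c ω * mono ξ d ω := by
  simp [mono, pow_add, Finset.prod_mul_distrib]

/-- The exponents of a squarefree monomial. -/
def indExp (S : Finset ι) (i : ι) : ℕ := if i ∈ S then 1 else 0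

lemma mono_indExp (S : Finset ι) (ω : ι → B) : mono ξ (indExp S) ω = ∏ i ∈ S, ξ i (ω i) := by
  rw [mono, ← Finset.prod_subset (Finset.subset_univ S)]
  · exact Finset.prod_congr rfl fun i hi => by simp [indExp, hi]
  · intro i _ hi; simp [indExp, hi]

lemma expSupp_indExp (S : Finset ι) : expSupp (indExp S) = S := by
  ext i; simp [expSupp, indExp]

lemma sum_indExp (S : Finset ι) : ∑ i, indExp S i = S.card := by
  simp [indExp]

/-- Squarefree monomials are orthogonal. -/
lemma ex_indExp_mul_eq_zero (h : IsNoise w ξ ρ ε) {S T : Finset ι} (hST : S ≠ T) :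
    ex (prodWt w) (mono ξ (indExp S + indExp T)) = 0 := by
  have : ∃ i, (i ∈ S ∧ i ∉ T) ∨ (i ∉ S ∧ i ∈ T) := by
    by_contra hc
    push Not at hc
    exact hST (Finset.ext fun i => ⟨(hc i).1, fun hi => by
      by_contra hS; exact (hc i).2 hS hi⟩)
  obtain ⟨i, ⟨h1, h2⟩ | ⟨h1, h2⟩⟩ := this <;>
  exact ex_monomial_eq_zero h (i := i) (by simp [indExp, h1, h2])

lemma ex_indExp_sq (h : IsNoise w ξ ρ ε) (S : Finset ι) :
    ex (prodWt w) (mono ξ (indExp S + indExp S)) = ∏ i ∈ S, mom w ξ i 2 := by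
  rw [ex_monomial, ← Finset.prod_subset (Finset.subset_univ S)]
  · exact Finset.prod_congr rfl fun i hi => by simp [indExp, hi]
  · intro i _ hi; simp [indExp, hi, mom_zero h]

/-- Sum over the coordinate `i` first, with the others fixed: `g` is constant there and `ξ i` has
mean zero. -/
lemma cex_coord_mul_eq_zero (h : IsNoise w ξ ρ ε) (i : ι) (g : (ι → B) → ℂ)
    (hg : ∀ ω b, g (Function.update ω i b) = g ω) :
    cex (prodWt w) (fun ω => ξ i (ω i) * g ω) = 0 := by
  classical
  have hB : Nonempty B := by
    by_contra hB
    rw [not_nonempty_iff] at hB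
    have := h.sum_eq_one i
    simp at this
  let b₀ := Classical.choice hB
  unfold cex
  rw [← (Equiv.funSplitAt i B).symm.sum_comp, Fintype.sum_prod_type, Finset.sum_comm]
  refine Finset.sum_eq_zero fun r _ => ?_
  have e1 : ∀ b, ((Equiv.funSplitAt i B).symm (b, r)) i = b := by
    intro b; simp [Equiv.funSplitAt]
  have e2 : ∀ b, prodWt w ((Equiv.funSplitAt i B).symm (b, r)) =
      w i b * ∏ j : {j // j ≠ i}, w j (r j) := by
    intro b
    rw [prodWt, ← Finset.mul_prod_erase _ _ (Finset.mem_univ i), e1,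
      Finset.prod_subtype (Finset.univ.erase i) (p := fun j => j ≠ i) (by simp)]
    congr 1
    refine Finset.prod_congr rfl fun j _ => ?_
    simp [Equiv.funSplitAt, j.2]
  have e3 : ∀ b, g ((Equiv.funSplitAt i B).symm (b, r)) =
      g ((Equiv.funSplitAt i B).symm (b₀, r)) := by
    intro b
    rw [← hg ((Equiv.funSplitAt i B).symm (b₀, r)) b]
    congr 1
    ext j
    by_cases hj : j = i
    · subst hj; simp [Equiv.funSplitAt]
    · simp [Equiv.funSplitAt, hj]
  simp only [e1, e2, e3]
  have hm : ∑ b, ((w i b : ℂ) * ξ i b) = 0 := by exact_mod_cast congrArg ((↑) : ℝ → ℂ) (h.mean i)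
  calc _ = (∑ b, ((w i b : ℂ) * ξ i b)) * (((∏ j : {j // j ≠ i}, w j (r j) : ℝ) : ℂ) *
        g ((Equiv.funSplitAt i B).symm (b₀, r))) := by
        rw [Finset.sum_mul]
        refine Finset.sum_congr rfl fun b _ => ?_
        push_cast; ring
    _ = 0 := by rw [hm, zero_mul]

end Noise

/-! ### Cycle sums and their parts through a given edge -/

section CycleSums

variable {V : Type*} [Fintype V] [DecidableEq V] {B : Type*} [Fintype B]
  {w ξ : Sym2 V → B → ℝ} {ρ ε : ℝ}

/-- The product of the noise along a cycle. -/
def cycMono {m : ℕ} (ξ : Sym2 V → B → ℝ) (a : Fin (m + 3) → V) (ω : Sym2 V → B) : ℝ :=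
  ∏ j, ξ (cycEdge a j) (ω (cycEdge a j))

variable (V) in
/-- The inverse square root of the number of vertices. -/
noncomputable def invSqrtCard : ℝ := (√(Fintype.card V))⁻¹

lemma invSqrtCard_nonneg : 0 ≤ invSqrtCard V := by unfold invSqrtCard; positivity

/-- The normalized sum of the cycle products. -/
noncomputable def cycSum (ξ : Sym2 V → B → ℝ) (m : ℕ) (ω : Sym2 V → B) : ℝ :=
  invSqrtCard V ^ (m + 3) * ∑ a : Fin (m + 3) ↪ V, cycMono ξ a ω

/-- The part of the normalized sum of cycle products with first edge `(x, y)`. -/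
noncomputable def cycAt (ξ : Sym2 V → B → ℝ) (m : ℕ) (x y : V) (ω : Sym2 V → B) : ℝ :=
  invSqrtCard V ^ (m + 3) *
    ∑ a : Fin (m + 3) ↪ V, if a 0 = x ∧ a 1 = y then cycMono ξ a ω else 0

lemma cycMono_eq_prod {m : ℕ} {a : Fin (m + 3) → V} (ha : Function.Injective a)
    (ω : Sym2 V → B) : cycMono ξ a ω = ∏ e ∈ cycEdges a, ξ e (ω e) := by
  rw [cycMono, cycEdges, Finset.prod_image fun _ _ _ _ h => cycEdge_injective ha h]

lemma cycMono_eq_mono {m : ℕ} {a : Fin (m + 3) → V} (ha : Function.Injective a)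
    (ω : Sym2 V → B) : cycMono ξ a ω = mono ξ (indExp (cycEdges a)) ω := by
  rw [mono_indExp, cycMono_eq_prod ha]

lemma sum_cycAt (m : ℕ) (ω : Sym2 V → B) :
    ∑ p : V × V, cycAt ξ m p.1 p.2 ω = cycSum ξ m ω := by
  unfold cycAt cycSum
  rw [← Finset.mul_sum, Finset.sum_comm]
  congr 1
  refine Finset.sum_congr rfl fun a _ => ?_
  rw [Finset.sum_eq_single (a 0, a 1)]
  · simp
  · rintro ⟨x, y⟩ _ hne
    rw [if_neg]
    rintro ⟨rfl, rfl⟩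
    exact hne rfl
  · simp

lemma cycMono_rotate {m : ℕ} (a : Fin (m + 3) → V) (r : Fin (m + 3)) (ω : Sym2 V → B) :
    cycMono ξ (fun j => a (j + r)) ω = cycMono ξ a ω := by
  unfold cycMono
  rw [← Equiv.prod_comp (Equiv.addRight r) (fun j => ξ (cycEdge a j) (ω (cycEdge a j)))]
  refine Finset.prod_congr rfl fun j _ => ?_
  have : cycEdge (fun j => a (j + r)) j = cycEdge a (j + r) := by
    simp only [cycEdge]; rw [add_right_comm]
  rw [this]; rfl

lemma cycMono_reflect {m : ℕ} (a : Fin (m + 3) → V) (r : Fin (m + 3)) (ω : Sym2 V → B) :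
    cycMono ξ (fun j => a (r + 1 - j)) ω = cycMono ξ a ω := by
  unfold cycMono
  rw [← (Equiv.subLeft r).prod_comp (fun j => ξ (cycEdge a j) (ω (cycEdge a j)))]
  refine Finset.prod_congr rfl fun j _ => ?_
  have : cycEdge (fun j => a (r + 1 - j)) j = cycEdge a (r - j) := by
    simp only [cycEdge]
    rw [Sym2.eq_swap, add_sub_add_right_eq_sub, sub_add_eq_add_sub]
  rw [this]; rfl

lemma sum_cycMono_at (m : ℕ) (r : Fin (m + 3)) (x y : V) (ω : Sym2 V → B) :
    (∑ a : Fin (m + 3) ↪ V, if a r = x ∧ a (r + 1) = y then cycMono ξ a ω else 0) =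
      ∑ a : Fin (m + 3) ↪ V, if a 0 = x ∧ a 1 = y then cycMono ξ a ω else 0 := by
  rw [← (Equiv.embeddingCongr (Equiv.addRight r).symm (Equiv.refl V)).sum_comp
    (fun a : Fin (m + 3) ↪ V => if a 0 = x ∧ a 1 = y then cycMono ξ a ω else 0)]
  refine Finset.sum_congr rfl fun a _ => ?_
  have h : ((Equiv.embeddingCongr (Equiv.addRight r).symm (Equiv.refl V) a :
      Fin (m + 3) ↪ V) : Fin (m + 3) → V) = fun j => a (j + r) := by
    ext j; simp [Equiv.embeddingCongr]
  rw [h, cycMono_rotate]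
  simp only [zero_add, add_comm 1 r]

lemma sum_cycMono_at_swap (m : ℕ) (r : Fin (m + 3)) (x y : V) (ω : Sym2 V → B) :
    (∑ a : Fin (m + 3) ↪ V, if a r = y ∧ a (r + 1) = x then cycMono ξ a ω else 0) =
      ∑ a : Fin (m + 3) ↪ V, if a 0 = x ∧ a 1 = y then cycMono ξ a ω else 0 := by
  rw [← (Equiv.embeddingCongr (Equiv.subLeft (r + 1)).symm (Equiv.refl V)).sum_comp
    (fun a : Fin (m + 3) ↪ V => if a 0 = x ∧ a 1 = y then cycMono ξ a ω else 0)]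
  refine Finset.sum_congr rfl fun a _ => ?_
  have h : ((Equiv.embeddingCongr (Equiv.subLeft (r + 1)).symm (Equiv.refl V) a :
      Fin (m + 3) ↪ V) : Fin (m + 3) → V) = fun j => a (r + 1 - j) := by
    ext j; simp [Equiv.embeddingCongr]
  rw [h, cycMono_reflect]
  simp only [sub_zero, add_sub_cancel_right, and_comm]

/-- An edge of an injective cycle occurs at exactly one position, in exactly one direction, so at
most one summand on the right is nonzero. -/
lemma ite_mem_cycEdges {m : ℕ} {a : Fin (m + 3) → V} (ha : Function.Injective a) {x y : V}
    (c : ℝ) : (if s(x, y) ∈ cycEdges a then c else 0) =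
      ∑ r, ((if a r = x ∧ a (r + 1) = y then c else 0) +
        (if a r = y ∧ a (r + 1) = x then c else 0)) := by
  by_cases h : s(x, y) ∈ cycEdges a
  · rw [if_pos h]
    simp only [cycEdges, Finset.mem_image, Finset.mem_univ, true_and] at h
    obtain ⟨r, hr⟩ := h
    rw [Finset.sum_eq_single r]
    · have hne : a r ≠ a (r + 1) := fun h => fin_add_one_ne r (ha h).symm
      simp only [cycEdge, Sym2.eq_iff] at hr
      rcases hr with ⟨rfl, rfl⟩ | ⟨rfl, rfl⟩
      · rw [if_pos ⟨rfl, rfl⟩, if_neg (fun h => hne h.1), add_zero]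
      · rw [if_neg (fun h => hne h.1), if_pos ⟨rfl, rfl⟩, zero_add]
    · intro r' _ hr'
      rw [if_neg, if_neg, add_zero]
      · rintro ⟨h1, h2⟩
        apply hr'; apply cycEdge_injective ha
        rw [hr, cycEdge, h1, h2, Sym2.eq_swap]
      · rintro ⟨h1, h2⟩
        apply hr'; apply cycEdge_injective ha
        rw [hr, cycEdge, h1, h2]
    · simp
  · rw [if_neg h]
    symm
    refine Finset.sum_eq_zero fun r _ => ?_
    rw [if_neg, if_neg, add_zero]
    · rintro ⟨rfl, rfl⟩
      exact h (by rw [Sym2.eq_swap]; exact cycEdge_mem a r)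
    · rintro ⟨rfl, rfl⟩
      exact h (cycEdge_mem a r)

/-- Each edge of a cycle can serve as its first edge, in both directions. -/
lemma sum_through_eq (m : ℕ) (x y : V) (ω : Sym2 V → B) :
    invSqrtCard V ^ (m + 3) *
      (∑ a : Fin (m + 3) ↪ V, if s(x, y) ∈ cycEdges a then cycMono ξ a ω else 0) =
      2 * ((m + 3 : ℕ) : ℝ) * cycAt ξ m x y ω := by
  unfold cycAt
  rw [Finset.sum_congr rfl fun (a : Fin (m + 3) ↪ V) _ =>
    ite_mem_cycEdges a.injective (cycMono ξ a ω),
    Finset.sum_comm]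
  simp only [Finset.sum_add_distrib]
  simp only [sum_cycMono_at, Finset.sum_const, Finset.card_univ,
    Fintype.card_fin, nsmul_eq_mul]
  -- Reversing the cycles identifies the sum with first edge `(y, x)` with the one for `(x, y)`,
  -- which produces the factor `2`.
  rw [(sum_cycMono_at m 0 y x ω).symm.trans (sum_cycMono_at_swap m 0 x y ω)]
  ring

lemma cycMono_update {m : ℕ} {a : Fin (m + 3) → V} {e : Sym2 V} (he : e ∉ cycEdges a)
    (ω : Sym2 V → B) (b : B) : cycMono ξ a (Function.update ω e b) = cycMono ξ a ω := by
  unfold cycMono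
  refine Finset.prod_congr rfl fun j _ => ?_
  rw [Function.update_of_ne]
  rintro rfl
  exact he (cycEdge_mem a j)

/-- Removing the cycles through an edge makes the cycle sum independent of that edge. -/
lemma cycSum_sub_update (m : ℕ) (x y : V) (ω : Sym2 V → B) (b : B) :
    cycSum ξ m (Function.update ω s(x, y) b) -
        2 * ((m + 3 : ℕ) : ℝ) * cycAt ξ m x y (Function.update ω s(x, y) b) =
      cycSum ξ m ω - 2 * ((m + 3 : ℕ) : ℝ) * cycAt ξ m x y ω := by
  have key : ∀ ω : Sym2 V → B, cycSum ξ m ω - 2 * ((m + 3 : ℕ) : ℝ) * cycAt ξ m x y ω =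
      invSqrtCard V ^ (m + 3) *
        ∑ a : Fin (m + 3) ↪ V, if s(x, y) ∈ cycEdges a then 0 else cycMono ξ a ω := by
    intro ω
    rw [← sum_through_eq, cycSum, ← mul_sub, ← Finset.sum_sub_distrib]
    congr 1
    refine Finset.sum_congr rfl fun a _ => ?_
    split_ifs <;> simp
  rw [key, key]
  congr 1
  refine Finset.sum_congr rfl fun a _ => ?_
  split_ifs with h
  · rfl
  · exact cycMono_update h ω b

/-- The cycle sums with first edge `(x, y)` are a multiple of the noise at that edge. -/
lemma cycAt_eq_mul (m : ℕ) (x y : V) : ∃ g : (Sym2 V → B) → ℝ,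
    (∀ ω, cycAt ξ m x y ω = ξ s(x, y) (ω s(x, y)) * g ω) ∧
    ∀ ω b, g (Function.update ω s(x, y) b) = g ω := by
  refine ⟨fun ω => invSqrtCard V ^ (m + 3) * ∑ a : Fin (m + 3) ↪ V, if a 0 = x ∧ a 1 = y then
      ∏ e ∈ (cycEdges a).erase s(x, y), ξ e (ω e) else 0, fun ω => ?_, fun ω b => ?_⟩
  · rw [cycAt, mul_left_comm]
    congr 1
    rw [Finset.mul_sum]
    refine Finset.sum_congr rfl fun a _ => ?_
    split_ifs with h
    · have he : s(x, y) ∈ cycEdges a := by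
        have := cycEdge_mem a 0
        rwa [cycEdge, zero_add, h.1, h.2] at this
      rw [cycMono_eq_prod a.injective, Finset.mul_prod_erase _ (fun e => ξ e (ω e)) he]
    · rw [mul_zero]
  · simp only
    congr 1
    refine Finset.sum_congr rfl fun a _ => ?_
    split_ifs with h
    · refine Finset.prod_congr rfl fun e he => ?_
      rw [Function.update_of_ne (Finset.ne_of_mem_erase he)]
    · rfl

/-- The overlap of two cycle sums. -/
noncomputable def overlap (ξ : Sym2 V → B → ℝ) (m m' : ℕ) (ω : Sym2 V → B) : ℝ :=
  ∑ p : V × V, cycAt ξ m p.1 p.2 ω * cycAt ξ m' p.1 p.2 ω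

lemma overlap_eq (m m' : ℕ) (ω : Sym2 V → B) :
    overlap ξ m m' ω = invSqrtCard V ^ ((m + 3) + (m' + 3)) *
      ∑ p : (Fin (m + 3) ↪ V) × (Fin (m' + 3) ↪ V),
        (if p.1 0 = p.2 0 ∧ p.1 1 = p.2 1 then 1 else 0) *
          mono ξ (indExp (cycEdges p.1) + indExp (cycEdges p.2)) ω := by
  unfold overlap cycAt
  have : ∀ p : V × V, (invSqrtCard V ^ (m + 3) *
      ∑ a : Fin (m + 3) ↪ V, if a 0 = p.1 ∧ a 1 = p.2 then cycMono ξ a ω else 0) *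
      (invSqrtCard V ^ (m' + 3) *
      ∑ a : Fin (m' + 3) ↪ V, if a 0 = p.1 ∧ a 1 = p.2 then cycMono ξ a ω else 0) =
      invSqrtCard V ^ ((m + 3) + (m' + 3)) * ∑ a : Fin (m + 3) ↪ V, ∑ b : Fin (m' + 3) ↪ V,
      (if a 0 = p.1 ∧ a 1 = p.2 then cycMono ξ a ω else 0) *
      (if b 0 = p.1 ∧ b 1 = p.2 then cycMono ξ b ω else 0) := by
    intro p
    rw [← Finset.sum_mul_sum, pow_add]; ring
  rw [Finset.sum_congr rfl fun p _ => this p, ← Finset.mul_sum, Fintype.sum_prod_type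
    (f := fun p : (Fin (m + 3) ↪ V) × (Fin (m' + 3) ↪ V) => _), Finset.sum_comm]
  congr 1
  refine Finset.sum_congr rfl fun a _ => ?_
  rw [Finset.sum_comm]
  refine Finset.sum_congr rfl fun b _ => ?_
  rw [Finset.sum_eq_single (a 0, a 1)]
  · rw [mono_add, ← cycMono_eq_mono a.injective, ← cycMono_eq_mono b.injective]
    simp only [and_self, if_true]
    by_cases h : b 0 = a 0 ∧ b 1 = a 1
    · rw [if_pos h, if_pos ⟨h.1.symm, h.2.symm⟩, one_mul]
    · rw [if_neg h, if_neg fun h' => h ⟨h'.1.symm, h'.2.symm⟩, mul_zero, zero_mul]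
  · rintro ⟨x, y⟩ _ hne
    rw [if_neg, zero_mul]
    rintro ⟨rfl, rfl⟩
    exact hne rfl
  · simp

end CycleSums

/-- The birthday estimate: a uniform `k`-tuple fails to be injective with probability at most `k ^ 2
/ n`. -/
lemma one_sub_le_descFactorial_div (n k : ℕ) (hn : 0 < n) :
    1 - (k : ℝ) ^ 2 / n ≤ (n.descFactorial k : ℝ) / n ^ k := by
  have hn' : (0 : ℝ) < n := by exact_mod_cast hn
  induction k with
  | zero => simp
  | succ k ih =>
    have h1 : (n.descFactorial k : ℝ) / n ^ k ≤ 1 := by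
      rw [div_le_one (by positivity)]; exact_mod_cast Nat.descFactorial_le_pow n k
    have h2 : (n : ℝ) - k ≤ ((n - k : ℕ) : ℝ) := by
      rw [sub_le_iff_le_add]; exact_mod_cast (by omega : n ≤ n - k + k)
    have h0 : 0 ≤ (n.descFactorial k : ℝ) / n ^ k := by positivity
    rw [Nat.descFactorial_succ]
    push_cast
    have e : (((n - k : ℕ) : ℝ) * n.descFactorial k) / n ^ (k + 1) =
        ((n - k : ℕ) : ℝ) / n * (n.descFactorial k / n ^ k) := by
      rw [pow_succ]; field_simp
    rw [e]
    have h3 : (1 : ℝ) - ((k : ℝ) + 1) ^ 2 / n ≤ (1 - (k : ℝ) ^ 2 / n) - (k : ℝ) / n := by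
      rw [sub_sub, ← add_div]; gcongr; nlinarith
    have h4 : (n.descFactorial k : ℝ) / n ^ k - (k : ℝ) / n ≤
        (1 - (k : ℝ) / n) * (n.descFactorial k / n ^ k) := by
      have : 0 ≤ (k : ℝ) / n := by positivity
      nlinarith
    have h5 : 1 - (k : ℝ) / n ≤ ((n - k : ℕ) : ℝ) / n := by
      rw [← div_self hn'.ne', ← sub_div]; gcongr
    have h6 := mul_le_mul_of_nonneg_right h5 h0
    linarith

/-! ### Mean and variance of overlaps, and fourth moments -/

section Overlaps

variable {V : Type*} [Fintype V] [DecidableEq V] {B : Type*} [Fintype B]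
  {w ξ : Sym2 V → B → ℝ} {ρ ε : ℝ}

lemma invSqrtCard_sq : invSqrtCard V ^ 2 = (Fintype.card V : ℝ)⁻¹ := by
  rw [invSqrtCard, inv_pow, Real.sq_sqrt (by positivity)]

lemma ex_overlap (m m' : ℕ) :
    ex (prodWt w) (overlap ξ m m') = invSqrtCard V ^ ((m + 3) + (m' + 3)) *
      ∑ p : (Fin (m + 3) ↪ V) × (Fin (m' + 3) ↪ V),
        (if p.1 0 = p.2 0 ∧ p.1 1 = p.2 1 then 1 else 0) *
          ex (prodWt w) (mono ξ (indExp (cycEdges p.1) + indExp (cycEdges p.2))) := by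
  have : overlap ξ m m' = fun ω => invSqrtCard V ^ ((m + 3) + (m' + 3)) *
      ∑ p : (Fin (m + 3) ↪ V) × (Fin (m' + 3) ↪ V),
        (if p.1 0 = p.2 0 ∧ p.1 1 = p.2 1 then 1 else 0) *
          mono ξ (indExp (cycEdges p.1) + indExp (cycEdges p.2)) ω :=
    funext fun ω => overlap_eq m m' ω
  rw [this, ex_const_mul, ex_sum]
  simp only [ex_const_mul]

/-- Cycles of different lengths have different edge sets, and the corresponding squarefree monomials
are orthogonal. This is the asymptotic independence of different lengths. -/
lemma ex_overlap_of_ne (h : IsNoise w ξ ρ ε) {m m' : ℕ} (hm : m ≠ m') :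
    ex (prodWt w) (overlap ξ m m') = 0 := by
  rw [ex_overlap, Finset.sum_eq_zero, mul_zero]
  intro p _
  rw [ex_indExp_mul_eq_zero h, mul_zero]
  intro he
  have h1 := card_cycEdges p.1.injective
  have h2 := card_cycEdges p.2.injective
  rw [he] at h1
  omega

/-- Orthogonality leaves pairs with equal edge sets. Since the first directed edges also agree,
`eq_of_cycEdges_eq` makes the two cycles equal. -/
lemma ex_overlap_self (h : IsNoise w ξ ρ ε) (m : ℕ) :
    ex (prodWt w) (overlap ξ m m) = (Fintype.card V : ℝ)⁻¹ ^ (m + 3) *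
      ∑ a : Fin (m + 3) ↪ V, ∏ e ∈ cycEdges a, mom w ξ e 2 := by
  rw [ex_overlap, ← two_mul, pow_mul, invSqrtCard_sq, Fintype.sum_prod_type]
  congr 1
  refine Finset.sum_congr rfl fun a _ => ?_
  rw [Finset.sum_eq_single a]
  · rw [if_pos ⟨rfl, rfl⟩, one_mul, ex_indExp_sq h]
  · intro b _ hb
    by_cases hc : a 0 = b 0 ∧ a 1 = b 1
    · rw [ex_indExp_mul_eq_zero h, mul_zero]
      intro he
      exact hb (DFunLike.coe_injective (eq_of_cycEdges_eq a.injective b.injective he hc.1 hc.2)).symm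
    · simp only
      rw [if_neg hc, zero_mul]
  · simp

lemma mom_two_mem (h : IsNoise w ξ ρ ε) (e : Sym2 V) :
    1 - ε ≤ mom w ξ e 2 ∧ mom w ξ e 2 ≤ 1 + ε := by
  have := abs_le.1 (h.var e)
  unfold mom
  constructor <;> linarith

lemma eps_nonneg (h : IsNoise w ξ ρ ε) (e : Sym2 V) : 0 ≤ ε :=
  (abs_nonneg _).trans (h.var e)

lemma one_add_pow_le {x : ℝ} (h0 : 0 ≤ x) (h1 : x ≤ 1) (k : ℕ) :
    (1 + x) ^ k ≤ 1 + x * 2 ^ k := by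
  induction k with
  | zero => simp; exact h0
  | succ k ih =>
    have h2 : (1 + x) ^ k ≤ 2 ^ k := pow_le_pow_left₀ (by linarith) (by linarith) k
    calc (1 + x) ^ (k + 1) = (1 + x) ^ k + x * (1 + x) ^ k := by ring
      _ ≤ (1 + x * 2 ^ k) + x * 2 ^ k := by gcongr
      _ = _ := by ring

/-- The two errors come from the variances, each within `ε` of one, and from the proportion of
injective tuples. -/
lemma abs_ex_overlap_self_sub_le [Nonempty V] (h : IsNoise w ξ ρ ε) (m : ℕ) :
    |ex (prodWt w) (overlap ξ m m) - 1| ≤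
      ε * 2 ^ (m + 3) + ((m + 3 : ℕ) : ℝ) ^ 2 / Fintype.card V := by
  obtain ⟨v⟩ := ‹Nonempty V›
  have hε := eps_nonneg h s(v, v)
  have hε1 := h.eps_le
  have hn0 : 0 < Fintype.card V := Fintype.card_pos_iff.2 ⟨v⟩
  have hn : (0 : ℝ) < Fintype.card V := by exact_mod_cast hn0
  have hcard : ∑ a : Fin (m + 3) ↪ V, (1 : ℝ) = (Fintype.card V).descFactorial (m + 3) := by
    simp [Fintype.card_embedding_eq]
  have hlow := one_sub_le_descFactorial_div (Fintype.card V) (m + 3) hn0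
  have hup : ((Fintype.card V).descFactorial (m + 3) : ℝ) / (Fintype.card V : ℝ) ^ (m + 3) ≤ 1 := by
    rw [div_le_one (by positivity)]; exact_mod_cast Nat.descFactorial_le_pow _ _
  set y := ((Fintype.card V).descFactorial (m + 3) : ℝ) / (Fintype.card V : ℝ) ^ (m + 3)
  have hy : y = (Fintype.card V : ℝ)⁻¹ ^ (m + 3) * ∑ a : Fin (m + 3) ↪ V, (1 : ℝ) := by
    rw [hcard, inv_pow, inv_mul_eq_div]
  have hy0 : 0 ≤ y := by positivity
  have h1 : ex (prodWt w) (overlap ξ m m) ≤ y * (1 + ε) ^ (m + 3) := by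
    rw [ex_overlap_self h, hy, mul_assoc, Finset.sum_mul]
    gcongr with a
    rw [one_mul]
    refine (Finset.prod_le_prod (fun e _ => ?_) fun e _ => (mom_two_mem h e).2).trans ?_
    · have := (mom_two_mem h e).1; linarith
    · rw [Finset.prod_const, card_cycEdges a.injective]
  have h2 : y * (1 - ε) ^ (m + 3) ≤ ex (prodWt w) (overlap ξ m m) := by
    rw [ex_overlap_self h, hy, mul_assoc, Finset.sum_mul]
    gcongr with a
    rw [one_mul]
    refine le_trans ?_ (Finset.prod_le_prod (fun e _ => ?_) fun e _ => (mom_two_mem h e).1)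
    · rw [Finset.prod_const, card_cycEdges a.injective]
    · linarith
  have h3 := one_add_pow_le hε hε1 (m + 3)
  have h4 : 1 - ε * 2 ^ (m + 3) ≤ (1 - ε) ^ (m + 3) := by
    have hb := one_add_mul_le_pow (a := -ε) (by linarith) (m + 3)
    have h5 : ((m + 3 : ℕ) : ℝ) ≤ 2 ^ (m + 3) := by exact_mod_cast Nat.lt_two_pow_self.le
    have h6 : ((m + 3 : ℕ) : ℝ) * ε ≤ 2 ^ (m + 3) * ε := by gcongr
    rw [← sub_eq_add_neg] at hb
    linarith
  have h7 : (1 - ε) ^ (m + 3) ≤ 1 := pow_le_one₀ (by linarith) (by linarith)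
  have h8 : 0 ≤ (1 - ε) ^ (m + 3) := pow_nonneg (by linarith) _
  have h9 : 0 ≤ ((m + 3 : ℕ) : ℝ) ^ 2 / Fintype.card V := by positivity
  have h10 : 0 ≤ ε * 2 ^ (m + 3) := by positivity
  rw [abs_le]
  constructor
  · nlinarith
  · nlinarith

/-- The bound on connected quadruples of cycles of total length `K`. -/
noncomputable def quadB (V : Type*) [Fintype V] (ρ : ℝ) (K : ℕ) : ℝ :=
  3 ^ K * (K ^ 4 * 2 ^ K * (√(Fintype.card V) * ρ)⁻¹)

lemma expSupp_quad {m₁ m₂ m₃ m₄ : ℕ} (a : Fin (m₁ + 3) → V) (b : Fin (m₂ + 3) → V)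
    (c : Fin (m₃ + 3) → V) (d : Fin (m₄ + 3) → V) :
    expSupp ((indExp (cycEdges a) + indExp (cycEdges b)) +
      (indExp (cycEdges c) + indExp (cycEdges d))) = quadEdges a b c d := by
  simp only [expSupp_add, expSupp_indExp, quadEdges, Finset.union_assoc]

lemma sum_quad {m₁ m₂ m₃ m₄ : ℕ} {a : Fin (m₁ + 3) → V} {b : Fin (m₂ + 3) → V}
    {c : Fin (m₃ + 3) → V} {d : Fin (m₄ + 3) → V} (ha : Function.Injective a)
    (hb : Function.Injective b) (hc : Function.Injective c) (hd : Function.Injective d) :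
    ∑ e, ((indExp (cycEdges a) + indExp (cycEdges b)) +
      (indExp (cycEdges c) + indExp (cycEdges d))) e =
      (m₁ + 3) + (m₂ + 3) + (m₃ + 3) + (m₄ + 3) := by
  simp only [Pi.add_apply, Finset.sum_add_distrib, sum_indExp, card_cycEdges ha, card_cycEdges hb,
    card_cycEdges hc, card_cycEdges hd]
  ring

/-- Cycles with the same first edge share an edge. -/
lemma not_disjoint_of_first {m m' : ℕ} {a : Fin (m + 3) → V} {b : Fin (m' + 3) → V}
    (h : a 0 = b 0 ∧ a 1 = b 1) : ¬ Disjoint (cycEdges a) (cycEdges b) := by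
  refine Finset.not_disjoint_iff.2 ⟨cycEdge a 0, cycEdge_mem a 0, ?_⟩
  have : cycEdge a 0 = cycEdge b 0 := by simp only [cycEdge, zero_add, h.1, h.2]
  rw [this]; exact cycEdge_mem b 0

open Classical in
lemma momBound_quad {m₁ m₂ m₃ m₄ K : ℕ} {a : Fin (m₁ + 3) → V} {b : Fin (m₂ + 3) → V}
    {c : Fin (m₃ + 3) → V} {d : Fin (m₄ + 3) → V} (ha : Function.Injective a)
    (hb : Function.Injective b) (hc : Function.Injective c) (hd : Function.Injective d)
    (hK : K = (m₁ + 3) + (m₂ + 3) + (m₃ + 3) + (m₄ + 3)) (hq : QuadConn a b c d) :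
    invSqrtCard V ^ K * momBound ρ ((indExp (cycEdges a) + indExp (cycEdges b)) +
      (indExp (cycEdges c) + indExp (cycEdges d))) =
    2 ^ K * (if QuadConn a b c d ∧ 2 * (quadEdges a b c d).card ≤ K then
        (√(Fintype.card V))⁻¹ ^ K * ρ⁻¹ ^ (K - 2 * (quadEdges a b c d).card) else 0) := by
  rw [momBound, expSupp_quad, sum_quad ha hb hc hd, ← hK, invSqrtCard]
  simp only [hq, true_and]
  split_ifs
  · ring
  · simp

variable {K : ℕ}

/-- The variance of an overlap. -/
lemma ex_overlap_sub_sq_le (h : IsNoise w ξ ρ ε) {m m' : ℕ}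
    (hK : K = (m + 3) + (m' + 3) + (m + 3) + (m' + 3))
    (hN : 1 ≤ √(Fintype.card V) * ρ) (hKn : (K : ℝ) * 2 ^ K ≤ √(Fintype.card V)) :
    ex (prodWt w) (fun ω => (overlap ξ m m' ω - ex (prodWt w) (overlap ξ m m')) ^ 2) ≤
      2 * 2 ^ K * quadB V ρ K := by
  classical
  set P := (Fin (m + 3) ↪ V) × (Fin (m' + 3) ↪ V)
  set c : P → Sym2 V → ℕ := fun p => indExp (cycEdges p.1) + indExp (cycEdges p.2) with hc
  set g : P → ℝ := fun p => if p.1 0 = p.2 0 ∧ p.1 1 = p.2 1 then 1 else 0 with hg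
  have hsq : ∀ ω, (overlap ξ m m' ω - ex (prodWt w) (overlap ξ m m')) ^ 2 =
      invSqrtCard V ^ K * ∑ p : P, ∑ q : P, g p * g q *
        ((mono ξ (c p) ω - ex (prodWt w) (mono ξ (c p))) *
          (mono ξ (c q) ω - ex (prodWt w) (mono ξ (c q)))) := by
    intro ω
    rw [ex_overlap, overlap_eq, ← mul_sub, mul_pow, ← pow_mul, ← Finset.sum_sub_distrib, sq (∑ p : P, _),
      Finset.sum_mul_sum, hK]
    congr 1
    · congr 1; ring
    · refine Finset.sum_congr rfl fun p _ => Finset.sum_congr rfl fun q _ => ?_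
      simp only [hc, hg]; ring
  have hcov : ∀ p q : P, ex (prodWt w) (fun ω => (mono ξ (c p) ω - ex (prodWt w) (mono ξ (c p))) *
          (mono ξ (c q) ω - ex (prodWt w) (mono ξ (c q)))) =
      ex (prodWt w) (mono ξ (c p + c q)) -
        ex (prodWt w) (mono ξ (c p)) * ex (prodWt w) (mono ξ (c q)) := by
    intro p q
    have e : (fun ω => (mono ξ (c p) ω - ex (prodWt w) (mono ξ (c p))) *
          (mono ξ (c q) ω - ex (prodWt w) (mono ξ (c q)))) =
        fun ω => (mono ξ (c p + c q) ω + (-ex (prodWt w) (mono ξ (c q))) * mono ξ (c p) ω) +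
          ((-ex (prodWt w) (mono ξ (c p))) * mono ξ (c q) ω +
            ex (prodWt w) (mono ξ (c p)) * ex (prodWt w) (mono ξ (c q))) := by
      funext ω; rw [mono_add (c p) (c q)]; ring
    rw [e, ex_add, ex_add, ex_add, ex_const_mul, ex_const_mul, ex_const (sum_prodWt h)]
    change ex (prodWt w) (mono ξ (c p + c q)) + -ex (prodWt w) (mono ξ (c q)) * ex (prodWt w) (mono ξ (c p)) + (-ex (prodWt w) (mono ξ (c p)) * ex (prodWt w) (mono ξ (c q)) + _) = _
    ring
  -- The indicators force the two cycles within `p`, and within `q`, to share their first edges; a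
  -- nonzero covariance forces `p` and `q` to share an edge. These are the three links of
  -- `QuadConn`.
  have hterm : ∀ p q : P, invSqrtCard V ^ K * (g p * g q * (ex (prodWt w) (mono ξ (c p + c q)) -
        ex (prodWt w) (mono ξ (c p)) * ex (prodWt w) (mono ξ (c q)))) ≤
      2 * 2 ^ K * (if QuadConn p.1 p.2 q.1 q.2 ∧ 2 * (quadEdges p.1 p.2 q.1 q.2).card ≤ K then
        (√(Fintype.card V))⁻¹ ^ K * ρ⁻¹ ^ (K - 2 * (quadEdges p.1 p.2 q.1 q.2).card) else 0) := by
    intro p q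
    have hρ := h.pos
    have hnn : (0 : ℝ) ≤ 2 * 2 ^ K * (if QuadConn p.1 p.2 q.1 q.2 ∧
        2 * (quadEdges p.1 p.2 q.1 q.2).card ≤ K then
        (√(Fintype.card V))⁻¹ ^ K * ρ⁻¹ ^ (K - 2 * (quadEdges p.1 p.2 q.1 q.2).card) else 0) := by
      split_ifs <;> positivity
    by_cases hp : p.1 0 = p.2 0 ∧ p.1 1 = p.2 1
    swap
    · simp only [hg, if_neg hp, zero_mul, mul_zero]; exact hnn
    by_cases hq : q.1 0 = q.2 0 ∧ q.1 1 = q.2 1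
    swap
    · simp only [hg, if_neg hq, zero_mul, mul_zero]; exact hnn
    simp only [hg, if_pos hp, if_pos hq, one_mul]
    have hcv := (le_abs_self _).trans (abs_cov_monomial_le h (c p) (c q))
    have hu : 0 ≤ invSqrtCard V ^ K := pow_nonneg invSqrtCard_nonneg _
    by_cases hd : Disjoint (expSupp (c p)) (expSupp (c q))
    · rw [if_pos hd] at hcv
      exact (mul_nonpos_of_nonneg_of_nonpos hu hcv).trans hnn
    · rw [if_neg hd] at hcv
      have hconn : QuadConn p.1 p.2 q.1 q.2 := by
        refine ⟨not_disjoint_of_first hp, not_disjoint_of_first hq, ?_⟩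
        simpa only [hc, expSupp_add, expSupp_indExp] using hd
      calc _ ≤ invSqrtCard V ^ K * (2 * momBound ρ (c p + c q)) := by gcongr
        _ = 2 * (invSqrtCard V ^ K * momBound ρ (c p + c q)) := by ring
        _ = _ := by
          rw [momBound_quad p.1.injective p.2.injective q.1.injective q.2.injective hK hconn]
          ring
  rw [funext hsq, ex_const_mul, ex_sum]
  simp only [ex_sum, ex_const_mul, hcov, Finset.mul_sum]
  refine (Finset.sum_le_sum fun p _ => Finset.sum_le_sum fun q _ => hterm p q).trans ?_
  have hb := quad_bound (V := V) hK h.pos h.le_one hN hKn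
  simp only [← Finset.mul_sum]
  unfold quadB
  refine mul_le_mul_of_nonneg_left ?_ (by positivity)
  simp only [P, Fintype.sum_prod_type]
  exact hb

/-- The fourth moments of the contributions of the single edges. -/
lemma sum_ex_cycAt_pow_four_le (h : IsNoise w ξ ρ ε) {m : ℕ}
    (hK : K = (m + 3) + (m + 3) + (m + 3) + (m + 3))
    (hN : 1 ≤ √(Fintype.card V) * ρ) (hKn : (K : ℝ) * 2 ^ K ≤ √(Fintype.card V)) :
    ∑ p : V × V, ex (prodWt w) (fun ω => cycAt ξ m p.1 p.2 ω ^ 4) ≤ 2 ^ K * quadB V ρ K := by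
  classical
  have hρ := h.pos
  set E := Fin (m + 3) ↪ V
  have hpow : ∀ p : V × V, ∀ ω, cycAt ξ m p.1 p.2 ω ^ 4 =
      ∑ a : E, ∑ b : E, ∑ c : E, ∑ d : E,
        (if (a 0 = p.1 ∧ a 1 = p.2) ∧ (b 0 = p.1 ∧ b 1 = p.2) ∧ (c 0 = p.1 ∧ c 1 = p.2) ∧
          (d 0 = p.1 ∧ d 1 = p.2) then invSqrtCard V ^ K else 0) *
        mono ξ ((indExp (cycEdges a) + indExp (cycEdges b)) +
          (indExp (cycEdges c) + indExp (cycEdges d))) ω := by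
    intro p ω
    have h4 : ∀ f : E → ℝ, (∑ a, f a) ^ 4 =
        ∑ a, ∑ b, ∑ c, ∑ d, (f a * f b) * (f c * f d) := by
      intro f
      have : (∑ a, f a) ^ 4 = ((∑ a, f a) * ∑ a, f a) * ((∑ a, f a) * ∑ a, f a) := by ring
      rw [this, Finset.sum_mul_sum, Finset.sum_mul]
      refine Finset.sum_congr rfl fun a _ => ?_
      rw [Finset.sum_mul]
      refine Finset.sum_congr rfl fun b _ => ?_
      rw [Finset.mul_sum]
      refine Finset.sum_congr rfl fun c _ => ?_
      rw [Finset.mul_sum]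
    rw [cycAt, mul_pow, h4]
    simp only [Finset.mul_sum]
    refine Finset.sum_congr rfl fun a _ => Finset.sum_congr rfl fun b _ =>
      Finset.sum_congr rfl fun c _ => Finset.sum_congr rfl fun d _ => ?_
    rw [mono_add, mono_add, mono_add, ← cycMono_eq_mono a.injective, ← cycMono_eq_mono b.injective,
      ← cycMono_eq_mono c.injective, ← cycMono_eq_mono d.injective]
    have hKK : (invSqrtCard V ^ (m + 3)) ^ 4 = invSqrtCard V ^ K := by
      rw [← pow_mul, hK]; congr 1; ring
    rw [hKK]
    by_cases h1 : a 0 = p.1 ∧ a 1 = p.2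
    swap
    · simp [h1]
    by_cases h2 : b 0 = p.1 ∧ b 1 = p.2
    swap
    · simp [h2]
    by_cases h3 : c 0 = p.1 ∧ c 1 = p.2
    swap
    · simp [h3]
    by_cases h4 : d 0 = p.1 ∧ d 1 = p.2
    swap
    · simp [h4]
    rw [if_pos h1, if_pos h2, if_pos h3, if_pos h4, if_pos ⟨h1, h2, h3, h4⟩]
  simp only [hpow, ex_sum, ex_const_mul]
  have hb := quad_bound (V := V) hK h.pos h.le_one hN hKn
  have hb' := mul_le_mul_of_nonneg_left hb (by positivity : (0 : ℝ) ≤ 2 ^ K)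
  refine le_trans ?_ hb'
  rw [Finset.sum_comm]
  simp only [Finset.mul_sum]
  refine Finset.sum_le_sum fun a _ => ?_
  rw [Finset.sum_comm]
  refine Finset.sum_le_sum fun b _ => ?_
  rw [Finset.sum_comm]
  refine Finset.sum_le_sum fun c _ => ?_
  rw [Finset.sum_comm]
  refine Finset.sum_le_sum fun d _ => ?_
  -- The directed edge is determined by the first cycle, so summing over it costs nothing; all four
  -- cycles then share it.
  rw [Finset.sum_eq_single (a 0, a 1)]
  · simp only [and_self, true_and]
    by_cases hc : (b 0 = a 0 ∧ b 1 = a 1) ∧ (c 0 = a 0 ∧ c 1 = a 1) ∧ d 0 = a 0 ∧ d 1 = a 1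
    · rw [if_pos hc]
      obtain ⟨⟨b0, b1⟩, ⟨c0, c1⟩, d0, d1⟩ := hc
      have hac := not_disjoint_of_first (a := a) (b := c) ⟨c0.symm, c1.symm⟩
      have hconn : QuadConn a b c d := by
        refine ⟨not_disjoint_of_first ⟨b0.symm, b1.symm⟩, not_disjoint_of_first
          ⟨c0.trans d0.symm, c1.trans d1.symm⟩, fun hd => hac ?_⟩
        exact hd.mono Finset.subset_union_left Finset.subset_union_left
      rw [← momBound_quad a.injective b.injective c.injective d.injective hK hconn]
      refine mul_le_mul_of_nonneg_left ?_ (pow_nonneg invSqrtCard_nonneg _)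
      exact (le_abs_self _).trans (abs_ex_monomial_le h _)
    · rw [if_neg hc, zero_mul]
      split_ifs <;> positivity
  · rintro ⟨x, y⟩ _ hne
    rw [if_neg, zero_mul]
    rintro ⟨⟨rfl, rfl⟩, -⟩
    exact hne rfl
  · simp

end Overlaps

/-! ### Central limit theorem for the noise -/

section MainTerm

variable {V : Type*} [Fintype V] [DecidableEq V] {B : Type*} [Fintype B]
  {w ξ : Sym2 V → B → ℝ} {ρ ε : ℝ}

lemma quadB_mono (hρ : 0 < ρ) {K K' : ℕ} (h : K ≤ K') : quadB V ρ K ≤ quadB V ρ K' := by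
  unfold quadB
  gcongr
  all_goals norm_num

lemma quadB_nonneg (hρ : 0 < ρ) (K : ℕ) : 0 ≤ quadB V ρ K := by
  unfold quadB; positivity

/-- The error of the first moment of an overlap. -/
noncomputable def meanErr (V : Type*) [Fintype V] (ε : ℝ) (M : ℕ) : ℝ :=
  ε * 2 ^ M + (M : ℝ) ^ 2 / Fintype.card V

/-- The error of the second moment of an overlap. -/
noncomputable def varErr (V : Type*) [Fintype V] (ρ : ℝ) (M : ℕ) : ℝ :=
  2 ^ (4 * M) * quadB V ρ (4 * M)

lemma abs_ex_overlap_sub_le [Nonempty V] (h : IsNoise w ξ ρ ε) {m m' M : ℕ} (hm : m + 3 ≤ M) :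
    |ex (prodWt w) (overlap ξ m m') - if m = m' then 1 else 0| ≤ meanErr V ε M := by
  obtain ⟨v⟩ := ‹Nonempty V›
  have hε := eps_nonneg h s(v, v)
  have hn : (0 : ℝ) < Fintype.card V := by
    exact_mod_cast (Fintype.card_pos_iff.2 ⟨v⟩ : 0 < Fintype.card V)
  unfold meanErr
  by_cases hmm : m = m'
  · subst hmm
    rw [if_pos rfl]
    have : Nonempty V := ⟨v⟩
    refine (abs_ex_overlap_self_sub_le h m).trans ?_
    gcongr
    norm_num
  · rw [if_neg hmm, ex_overlap_of_ne h hmm]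
    simp only [sub_zero, abs_zero]
    positivity

lemma ex_abs_overlap_sub_le [Nonempty V] (h : IsNoise w ξ ρ ε) {m m' M : ℕ} (hm : m + 3 ≤ M)
    (hm' : m' + 3 ≤ M) (hN : 1 ≤ √(Fintype.card V) * ρ)
    (hMn : ((4 * M : ℕ) : ℝ) * 2 ^ (4 * M) ≤ √(Fintype.card V)) :
    ex (prodWt w) (fun ω => |overlap ξ m m' ω - if m = m' then 1 else 0|) ≤
      √(2 * varErr V ρ M) + meanErr V ε M := by
  set K := (m + 3) + (m' + 3) + (m + 3) + (m' + 3) with hK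
  have hKM : K ≤ 4 * M := by omega
  have hKn : (K : ℝ) * 2 ^ K ≤ √(Fintype.card V) := by
    refine le_trans ?_ hMn
    gcongr
    norm_num
  have hvar := ex_overlap_sub_sq_le h hK hN hKn
  have h1 := ex_abs_le_sqrt (prodWt_nonneg h) (sum_prodWt h)
    (fun ω => overlap ξ m m' ω - ex (prodWt w) (overlap ξ m m'))
  have h2 : √(ex (prodWt w) (fun ω => (overlap ξ m m' ω - ex (prodWt w) (overlap ξ m m')) ^ 2)) ≤
      √(2 * varErr V ρ M) := by
    refine Real.sqrt_le_sqrt (hvar.trans ?_)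
    rw [varErr, mul_assoc]
    have := quadB_mono (V := V) h.pos hKM
    have h0 := quadB_nonneg (V := V) h.pos K
    gcongr
    norm_num
  calc _ ≤ ex (prodWt w) (fun ω => |overlap ξ m m' ω - ex (prodWt w) (overlap ξ m m')| +
        |ex (prodWt w) (overlap ξ m m') - if m = m' then 1 else 0|) :=
        ex_mono (prodWt_nonneg h) fun ω => by
          refine le_trans (le_of_eq ?_) (abs_add_le _ _)
          congr 1; ring
    _ ≤ _ := by
        rw [ex_add, ex_const (sum_prodWt h)]
        exact add_le_add (h1.trans h2) (abs_ex_overlap_sub_le h hm)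

lemma sum_ex_cycAt_sq_le [Nonempty V] (h : IsNoise w ξ ρ ε) {m M : ℕ} (hm : m + 3 ≤ M) :
    ∑ p : V × V, ex (prodWt w) (fun ω => cycAt ξ m p.1 p.2 ω ^ 2) ≤ 1 + meanErr V ε M := by
  have h1 := abs_le.1 (abs_ex_overlap_sub_le h (m' := m) hm)
  rw [if_pos rfl] at h1
  have : ∑ p : V × V, ex (prodWt w) (fun ω => cycAt ξ m p.1 p.2 ω ^ 2) =
      ex (prodWt w) (overlap ξ m m) := by
    rw [← ex_sum]
    refine congrArg _ (funext fun ω => ?_)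
    simp only [overlap, sq]
  rw [this]
  linarith

lemma sum_ex_cycAt_four_le (h : IsNoise w ξ ρ ε) {m M : ℕ} (hm : m + 3 ≤ M)
    (hN : 1 ≤ √(Fintype.card V) * ρ)
    (hMn : ((4 * M : ℕ) : ℝ) * 2 ^ (4 * M) ≤ √(Fintype.card V)) :
    ∑ p : V × V, ex (prodWt w) (fun ω => cycAt ξ m p.1 p.2 ω ^ 4) ≤ varErr V ρ M := by
  set K := (m + 3) + (m + 3) + (m + 3) + (m + 3) with hK
  have hKM : K ≤ 4 * M := by omega
  have hKn : (K : ℝ) * 2 ^ K ≤ √(Fintype.card V) := by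
    refine le_trans ?_ hMn
    gcongr
    norm_num
  refine (sum_ex_cycAt_pow_four_le h hK hN hKn).trans ?_
  rw [varErr]
  have := quadB_mono (V := V) h.pos hKM
  have h0 := quadB_nonneg (V := V) h.pos K
  gcongr
  norm_num

/-- Quantitative joint central limit theorem for the cycle sums of independent noise. -/
lemma norm_cex_cycSum_sub_le [Nonempty V] (h : IsNoise w ξ ρ ε) {l : ℕ} {m : Fin l → ℕ}
    (hm : Function.Injective m) {M : ℕ} (hM : 1 ≤ M) (hmM : ∀ i, m i + 3 ≤ M)
    (hN : 1 ≤ √(Fintype.card V) * ρ)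
    (hMn : ((4 * M : ℕ) : ℝ) * 2 ^ (4 * M) ≤ √(Fintype.card V)) (t : Fin l → ℝ) :
    ‖cex (prodWt w) (fun ω => Complex.exp (Complex.I *
        ((∑ i, t i / √(2 * (m i + 3 : ℕ)) * cycSum ξ (m i) ω : ℝ) : ℂ))) -
      Complex.exp (-((∑ i, t i ^ 2 : ℝ) : ℂ) / 2)‖ ≤
    2 * M * (∑ i, |t i|) ^ 2 * (√(2 * varErr V ρ M) + meanErr V ε M) +
      6 * M ^ 2 * √(varErr V ρ M) * ((∑ i, t i ^ 2) * (l * (1 + meanErr V ε M)) +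
        (∑ i, t i ^ 2) ^ 2 * l * (l : ℝ)) := by
  set α : Fin l → ℝ := fun i => t i / √(2 * (m i + 3 : ℕ)) with hα
  set X : V × V → (Sym2 V → B) → ℝ := fun p ω => ∑ i, α i * cycAt ξ (m i) p.1 p.2 ω with hX
  -- By `sum_through_eq`, the factor `2 k` turns the cycles whose first edge is `(x, y)` into all
  -- cycles through that edge.
  set Y : V × V → (Sym2 V → B) → ℝ :=
    fun p ω => ∑ i, α i * (2 * ((m i + 3 : ℕ) : ℝ) * cycAt ξ (m i) p.1 p.2 ω) with hY
  set F : (Sym2 V → B) → ℝ := fun ω => ∑ i, α i * cycSum ξ (m i) ω with hF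
  have hFX : ∀ ω, F ω = ∑ p, X p ω := by
    intro ω
    simp only [hF, hX]
    rw [Finset.sum_comm]
    refine Finset.sum_congr rfl fun i _ => ?_
    rw [← Finset.mul_sum, sum_cycAt]
  have hXY : ∀ p : V × V, ∀ s : ℝ, cex (prodWt w)
      (fun ω => X p ω * Complex.exp (Complex.I * (s * (F ω - Y p ω : ℝ)))) = 0 := by
    intro p s
    choose g hg hg' using fun i => cycAt_eq_mul (ξ := ξ) (m i) p.1 p.2
    have e : (fun ω => (X p ω : ℂ) * Complex.exp (Complex.I * (s * (F ω - Y p ω : ℝ)))) =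
        fun ω => (ξ s(p.1, p.2) (ω s(p.1, p.2)) : ℂ) * (((∑ i, α i * g i ω : ℝ) : ℂ) *
          Complex.exp (Complex.I * (s * (F ω - Y p ω : ℝ)))) := by
      funext ω
      have : X p ω = ξ s(p.1, p.2) (ω s(p.1, p.2)) * ∑ i, α i * g i ω := by
        simp only [hX, hg, Finset.mul_sum]
        exact Finset.sum_congr rfl fun _ _ => by ring
      rw [this]; push_cast; ring
    rw [e]
    refine cex_coord_mul_eq_zero h _ _ fun ω b => ?_
    have e1 : F (Function.update ω s(p.1, p.2) b) - Y p (Function.update ω s(p.1, p.2) b) =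
        F ω - Y p ω := by
      simp only [hF, hY]
      rw [← Finset.sum_sub_distrib, ← Finset.sum_sub_distrib]
      refine Finset.sum_congr rfl fun i _ => ?_
      rw [← mul_sub, ← mul_sub, cycSum_sub_update]
    simp only [hg', e1]
  set v : ℝ := ∑ i, t i ^ 2 with hv
  have hv0 : 0 ≤ v := Finset.sum_nonneg fun _ _ => sq_nonneg _
  have hαt : ∀ i, |α i| ≤ |t i| := by
    intro i
    simp only [hα, abs_div]
    refine div_le_self (abs_nonneg _) ?_
    rw [abs_of_nonneg (Real.sqrt_nonneg _)]
    refine Real.one_le_sqrt.2 ?_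
    have : (1 : ℝ) ≤ (m i + 3 : ℕ) := by exact_mod_cast (by omega)
    linarith
  have hk : ∀ i, ((m i + 3 : ℕ) : ℝ) ≤ M := fun i => by exact_mod_cast hmM i
  have hM0 : (0 : ℝ) < M := by exact_mod_cast hM
  have hη : 0 ≤ meanErr V ε M := by
    obtain ⟨x⟩ := ‹Nonempty V›
    have hε := eps_nonneg h s(x, x)
    unfold meanErr; positivity
  have hstein := stein_bound (prodWt_nonneg h) (sum_prodWt h) X Y F hFX hXY hv0
  refine hstein.trans (add_le_add ?_ ?_)
  · -- the quadratic term
    -- On the diagonal the `2 k` from `Y` cancels the two normalizations `1 / √(2 k)`, so the target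
    -- variance is exactly `∑ t i ^ 2`.
    have hΓ : ∀ ω, (∑ p, X p ω * Y p ω) - v =
        ∑ i, ∑ j, α i * α j * (2 * ((m j + 3 : ℕ) : ℝ)) *
          (overlap ξ (m i) (m j) ω - if m i = m j then 1 else 0) := by
      intro ω
      have hv' : v = ∑ i, ∑ j, α i * α j * (2 * ((m j + 3 : ℕ) : ℝ)) *
          (if m i = m j then 1 else 0) := by
        refine Finset.sum_congr rfl fun i _ => ?_
        rw [Finset.sum_eq_single i]
        · rw [if_pos rfl, mul_one]
          simp only [hα]
          have h2 : (0 : ℝ) < 2 * ((m i + 3 : ℕ) : ℝ) := by positivity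
          rw [div_mul_div_comm, Real.mul_self_sqrt h2.le, div_mul_cancel₀ _ h2.ne', sq]
        · intro j _ hj
          rw [if_neg (fun he => hj (hm he).symm), mul_zero]
        · simp
      rw [hv']
      simp only [mul_sub, Finset.sum_sub_distrib]
      congr 1
      have hXYp : ∀ p, X p ω * Y p ω = ∑ i, ∑ j, α i * α j * (2 * ((m j + 3 : ℕ) : ℝ)) *
          (cycAt ξ (m i) p.1 p.2 ω * cycAt ξ (m j) p.1 p.2 ω) := by
        intro p
        simp only [hX, hY]
        rw [Finset.sum_mul_sum]
        exact Finset.sum_congr rfl fun i _ => Finset.sum_congr rfl fun j _ => by ring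
      rw [Finset.sum_congr rfl fun p _ => hXYp p, Finset.sum_comm]
      refine Finset.sum_congr rfl fun i _ => ?_
      rw [Finset.sum_comm]
      exact Finset.sum_congr rfl fun j _ => by rw [overlap, Finset.mul_sum]
    calc _ ≤ ex (prodWt w) (fun ω => ∑ i, ∑ j, |t i| * |t j| * (2 * M) *
          |overlap ξ (m i) (m j) ω - if m i = m j then 1 else 0|) := by
          refine ex_mono (prodWt_nonneg h) fun ω => ?_
          rw [hΓ]
          refine (Finset.abs_sum_le_sum_abs _ _).trans (Finset.sum_le_sum fun i _ => ?_)
          refine (Finset.abs_sum_le_sum_abs _ _).trans (Finset.sum_le_sum fun j _ => ?_)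
          rw [abs_mul, abs_mul, abs_mul, abs_of_nonneg (by positivity :
            (0 : ℝ) ≤ 2 * ((m j + 3 : ℕ) : ℝ))]
          have := hαt i
          have := hαt j
          have := hk j
          gcongr
      _ = ∑ i, ∑ j, |t i| * |t j| * (2 * M) * ex (prodWt w)
          (fun ω => |overlap ξ (m i) (m j) ω - if m i = m j then 1 else 0|) := by
          rw [ex_sum]
          refine Finset.sum_congr rfl fun i _ => ?_
          rw [ex_sum]
          exact Finset.sum_congr rfl fun j _ => ex_const_mul _ _ _
      _ ≤ ∑ i, ∑ j, |t i| * |t j| * (2 * M) * (√(2 * varErr V ρ M) + meanErr V ε M) := by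
          gcongr with i _ j _
          exact ex_abs_overlap_sub_le h (hmM i) (hmM j) hN hMn
      _ = _ := by
          simp only [← Finset.sum_mul, ← Finset.sum_mul_sum]
          ring
  · -- the cubic term
    set Z : V × V → (Sym2 V → B) → ℝ := fun p ω => ∑ i, |t i| * |cycAt ξ (m i) p.1 p.2 ω| with hZ
    have hXZ : ∀ p ω, |X p ω| ≤ Z p ω := by
      intro p ω
      refine (Finset.abs_sum_le_sum_abs _ _).trans (Finset.sum_le_sum fun i _ => ?_)
      rw [abs_mul]
      have := hαt i
      gcongr
    have hYZ : ∀ p ω, |Y p ω| ≤ 2 * M * Z p ω := by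
      intro p ω
      refine (Finset.abs_sum_le_sum_abs _ _).trans ?_
      simp only [hZ, Finset.mul_sum]
      refine Finset.sum_le_sum fun i _ => ?_
      rw [abs_mul, abs_mul, abs_of_nonneg (by positivity :
            (0 : ℝ) ≤ 2 * ((m i + 3 : ℕ) : ℝ))]
      have := hαt i
      have := hk i
      calc |α i| * (2 * ((m i + 3 : ℕ) : ℝ) * |cycAt ξ (m i) p.1 p.2 ω|) ≤
          |t i| * (2 * M * |cycAt ξ (m i) p.1 p.2 ω|) := by gcongr
        _ = _ := by ring
    have hZ0 : ∀ p ω, 0 ≤ Z p ω := fun p ω => (abs_nonneg _).trans (hXZ p ω)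
    have hZ2 : ∀ p ω, Z p ω ^ 2 ≤ v * ∑ i, cycAt ξ (m i) p.1 p.2 ω ^ 2 := by
      intro p ω
      have := Finset.sum_mul_sq_le_sq_mul_sq Finset.univ (fun i => |t i|)
        (fun i => |cycAt ξ (m i) p.1 p.2 ω|)
      simpa only [sq_abs] using this
    have hZ4 : ∀ p ω, Z p ω ^ 4 ≤ v ^ 2 * l * ∑ i, cycAt ξ (m i) p.1 p.2 ω ^ 4 := by
      intro p ω
      have h1 := sq_sum_le_card_mul_sum_sq (s := (Finset.univ : Finset (Fin l)))
        (f := fun i => cycAt ξ (m i) p.1 p.2 ω ^ 2)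
      simp only [Finset.card_univ, Fintype.card_fin, ← pow_mul] at h1
      calc Z p ω ^ 4 = (Z p ω ^ 2) ^ 2 := by ring
        _ ≤ (v * ∑ i, cycAt ξ (m i) p.1 p.2 ω ^ 2) ^ 2 :=
            pow_le_pow_left₀ (sq_nonneg _) (hZ2 p ω) 2
        _ = v ^ 2 * (∑ i, cycAt ξ (m i) p.1 p.2 ω ^ 2) ^ 2 := by ring
        _ ≤ v ^ 2 * (l * ∑ i, cycAt ξ (m i) p.1 p.2 ω ^ 4) := by gcongr
        _ = _ := by ring
    have hQ : 0 < varErr V ρ M := by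
      have := h.pos
      have : 0 < √(Fintype.card V : ℝ) * ρ := by linarith
      unfold varErr quadB; positivity
    set Q := varErr V ρ M
    have hQ' : 0 < √Q := Real.sqrt_pos.2 hQ
    have hpt : ∀ p ω, |X p ω| * Y p ω ^ 2 ≤
        2 * M ^ 2 * √Q * (v * ∑ i, cycAt ξ (m i) p.1 p.2 ω ^ 2) +
          2 * M ^ 2 * (√Q)⁻¹ * (v ^ 2 * l * ∑ i, cycAt ξ (m i) p.1 p.2 ω ^ 4) := by
      intro p ω
      -- Interpolation of the third moment. The summed second moments are bounded and the summed
      -- fourth moments are of order `Q`, so the weight `√Q` balances the two terms at order `√Q`.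
      have h3 : Z p ω ^ 3 ≤ (√Q * Z p ω ^ 2 + (√Q)⁻¹ * Z p ω ^ 4) / 2 := by
        have h4 : 0 ≤ (√Q)⁻¹ * (Z p ω * (√Q - Z p ω)) ^ 2 := by positivity
        have h5 : (√Q)⁻¹ * (Z p ω * (√Q - Z p ω)) ^ 2 =
            √Q * Z p ω ^ 2 - 2 * Z p ω ^ 3 + (√Q)⁻¹ * Z p ω ^ 4 := by
          field_simp; ring
        linarith
      calc |X p ω| * Y p ω ^ 2 = |X p ω| * |Y p ω| ^ 2 := by rw [sq_abs]
        _ ≤ Z p ω * (2 * M * Z p ω) ^ 2 := by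
            have := hXZ p ω
            have := hYZ p ω
            have := hZ0 p ω
            gcongr
        _ = 4 * M ^ 2 * Z p ω ^ 3 := by ring
        _ ≤ 4 * M ^ 2 * ((√Q * Z p ω ^ 2 + (√Q)⁻¹ * Z p ω ^ 4) / 2) := by gcongr
        _ ≤ 4 * M ^ 2 * ((√Q * (v * ∑ i, cycAt ξ (m i) p.1 p.2 ω ^ 2) +
            (√Q)⁻¹ * (v ^ 2 * l * ∑ i, cycAt ξ (m i) p.1 p.2 ω ^ 4)) / 2) := by
            have := hZ2 p ω
            have := hZ4 p ω
            gcongr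
        _ = _ := by ring
    have hsum2 : ∑ p : V × V, ex (prodWt w) (fun ω => ∑ i, cycAt ξ (m i) p.1 p.2 ω ^ 2) ≤
        l * (1 + meanErr V ε M) := by
      simp only [ex_sum]
      rw [Finset.sum_comm]
      refine (Finset.sum_le_sum fun i _ => sum_ex_cycAt_sq_le h (hmM i)).trans ?_
      simp [mul_add]
    have hsum4 : ∑ p : V × V, ex (prodWt w) (fun ω => ∑ i, cycAt ξ (m i) p.1 p.2 ω ^ 4) ≤
        l * Q := by
      simp only [ex_sum]
      rw [Finset.sum_comm]
      refine (Finset.sum_le_sum fun i _ => sum_ex_cycAt_four_le h (hmM i) hN hMn).trans ?_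
      simp [Q]
    calc 3 * ∑ p, ex (prodWt w) (fun ω => |X p ω| * Y p ω ^ 2) ≤
        3 * ∑ p : V × V, ex (prodWt w) (fun ω =>
          2 * M ^ 2 * √Q * v * (∑ i, cycAt ξ (m i) p.1 p.2 ω ^ 2) +
          2 * M ^ 2 * (√Q)⁻¹ * (v ^ 2 * l) * ∑ i, cycAt ξ (m i) p.1 p.2 ω ^ 4) := by
          gcongr with p _
          refine ex_mono (prodWt_nonneg h) fun ω => (hpt p ω).trans (le_of_eq ?_)
          ring
      _ = 3 * (2 * M ^ 2 * √Q * v * (∑ p : V × V, ex (prodWt w) (fun ω =>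
            ∑ i, cycAt ξ (m i) p.1 p.2 ω ^ 2)) +
          2 * M ^ 2 * (√Q)⁻¹ * (v ^ 2 * l) * ∑ p : V × V, ex (prodWt w) (fun ω =>
            ∑ i, cycAt ξ (m i) p.1 p.2 ω ^ 4)) := by
          simp only [ex_add, ex_const_mul, Finset.sum_add_distrib]
          rw [Finset.mul_sum (f := fun p : V × V => ex (prodWt w) (fun ω =>
            ∑ i, cycAt ξ (m i) p.1 p.2 ω ^ 2)), Finset.mul_sum (f := fun p : V × V =>
            ex (prodWt w) (fun ω => ∑ i, cycAt ξ (m i) p.1 p.2 ω ^ 4))]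
      _ ≤ 3 * (2 * M ^ 2 * √Q * v * (l * (1 + meanErr V ε M)) +
          2 * M ^ 2 * (√Q)⁻¹ * (v ^ 2 * l) * (l * Q)) := by gcongr
      _ = _ := by
          have : (√Q)⁻¹ * Q = √Q := by
            rw [inv_mul_eq_div, Real.div_sqrt]
          linear_combination (6 * M ^ 2 * v ^ 2 * l * l : ℝ) * this

end MainTerm

/-! ### Expansion into noise, signal and mixed terms -/

section Remainder

variable {V : Type*} [Fintype V] [DecidableEq V] {B : Type*} [Fintype B]
  {w ξ : Sym2 V → B → ℝ} {ρ ε : ℝ}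

/-- Counting walks some of whose steps are constrained to have at most `d` choices. -/
lemma sum_walks_le (N : V → Finset V) (d : ℕ) (hN : ∀ y, (N y).card ≤ d) (r : ℕ)
    (T : Fin r → Prop) [DecidablePred T] (U : Finset V) :
    (∑ f : Fin (r + 1) → V,
      if f 0 ∈ U ∧ ∀ i : Fin r, T i → f i.succ ∈ N (f i.castSucc) then 1 else 0) ≤
      U.card * ∏ i, (if T i then d else Fintype.card V) := by
  induction r generalizing U with
  | zero =>
    rw [← (Fin.consEquiv fun _ : Fin 1 => V).sum_comp, Fintype.sum_prod_type]
    simp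
  | succ r ih =>
    rw [← (Fin.consEquiv fun _ : Fin (r + 2) => V).sum_comp, Fintype.sum_prod_type,
      Fin.prod_univ_succ]
    calc _ ≤ ∑ x, if x ∈ U then (if T 0 then d else Fintype.card V) *
          ∏ i : Fin r, (if T i.succ then d else Fintype.card V) else 0 := by
          refine Finset.sum_le_sum fun x _ => ?_
          by_cases hx : x ∈ U
          · rw [if_pos hx]
            refine le_trans ?_ ((ih (fun i => T i.succ)
              (if T 0 then N x else Finset.univ)).trans (Nat.mul_le_mul_right _ ?_))
            · refine Finset.sum_le_sum fun g _ => ?_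
              by_cases h1 : (Fin.consEquiv fun _ : Fin (r + 2) => V) (x, g) 0 ∈ U ∧
                  ∀ i : Fin (r + 1), T i → (Fin.consEquiv fun _ : Fin (r + 2) => V) (x, g) i.succ ∈
                    N ((Fin.consEquiv fun _ : Fin (r + 2) => V) (x, g) i.castSucc)
              · rw [if_pos h1, if_pos]
                refine ⟨?_, fun i hi => h1.2 i.succ hi⟩
                by_cases h0 : T 0
                · rw [if_pos h0]; exact h1.2 0 h0
                · rw [if_neg h0]; exact Finset.mem_univ _
              · rw [if_neg h1]; exact Nat.zero_le _
            · split_ifs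
              · exact hN x
              · simp
          · rw [if_neg hx]
            refine (Finset.sum_eq_zero fun g _ => ?_).le
            rw [if_neg]
            rintro ⟨h, -⟩
            exact hx h
      _ = _ := by rw [← Finset.sum_filter, Finset.sum_const, smul_eq_mul]; simp

lemma card_nbrs_cycEdges_le {m : ℕ} {a : Fin (m + 3) → V} (ha : Function.Injective a) (y : V) :
    (nbrs (cycEdges a) y).card ≤ 2 := by
  by_cases hy : y ∈ cycVerts a
  · simp only [cycVerts, Finset.mem_image, Finset.mem_univ, true_and] at hy
    obtain ⟨j, rfl⟩ := hy
    refine (Finset.card_le_card (t := {a (j + 1), a (j - 1)}) ?_).trans Finset.card_le_two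
    intro z hz
    simp only [nbrs, Finset.mem_filter, Finset.mem_univ, true_and] at hz
    simpa using eq_or_eq_of_mem_cycEdges ha hz
  · rw [Finset.card_eq_zero.2]
    · simp
    · rw [Finset.eq_empty_iff_forall_notMem]
      intro z hz
      simp only [nbrs, Finset.mem_filter, Finset.mem_univ, true_and] at hz
      exact hy (mem_cycVerts_of_mem_cycEdges hz (by simp))

/-- The number of cycles whose edges at the positions `T` are edges of a given cycle. -/
lemma sum_cycles_le {m : ℕ} {a : Fin (m + 3) → V} (ha : Function.Injective a)
    {T : Finset (Fin (m + 3))} (hT : T.Nonempty) (hT' : T ≠ Finset.univ) :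
    (∑ b : Fin (m + 3) ↪ V, if ∀ j ∈ T, cycEdge b j ∈ cycEdges a then 1 else 0) ≤
      (m + 3) * (2 ^ T.card * Fintype.card V ^ (m + 2 - T.card)) := by
  classical
  -- The cycle is cut open at a position `r` where `T` begins. The dropped edge carries no
  -- constraint, while the next one lies on `a`, so the starting vertex has only `m + 3` choices
  -- instead of `n`. This is the saved factor `n`.
  obtain ⟨r, hr, hr'⟩ : ∃ r, r + 1 ∈ T ∧ r ∉ T := by
    by_contra hc
    push Not at hc
    obtain ⟨j, hj⟩ : ∃ j, j ∉ T := by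
      by_contra h
      push Not at h
      exact hT' (Finset.eq_univ_iff_forall.2 h)
    obtain ⟨i, hi⟩ := hT
    exact fin_forall_of_succ (P := fun i => i ∉ T) hj (fun i hi h => hi (hc i h)) i hi
  set T' : Fin (m + 2) → Prop := fun i => i.castSucc + (r + 1) ∈ T with hT'def
  have hcardT : (Finset.univ.filter T').card = T.card := by
    have h1 : T.card = ∑ j : Fin (m + 3), if j + (r + 1) ∈ T then 1 else 0 := by
      have h2 : T.card = ∑ j : Fin (m + 3), if j ∈ T then 1 else 0 := by simp
      rw [h2]
      exact (Equiv.sum_comp (Equiv.addRight (r + 1)) (fun j => if j ∈ T then 1 else 0)).symm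
    rw [h1, Fin.sum_univ_castSucc, Finset.card_filter]
    have : Fin.last (m + 2) + (r + 1) ∉ T := by
      have h2 : Fin.last (m + 2) + (r + 1) = r := by
        rw [add_comm r 1, ← add_assoc, Fin.last_add_one, zero_add]
      rwa [h2]
    rw [if_neg this, add_zero]
  have hprod : ∏ i, (if T' i then 2 else Fintype.card V) =
      2 ^ T.card * Fintype.card V ^ (m + 2 - T.card) := by
    rw [Finset.prod_ite, Finset.prod_const, Finset.prod_const, hcardT]
    congr 2
    have := Finset.card_filter_add_card_filter_not (s := (Finset.univ : Finset (Fin (m + 2)))) T'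
    rw [hcardT, Finset.card_univ, Fintype.card_fin] at this
    omega
  have hw := sum_walks_le (nbrs (cycEdges a)) 2 (card_nbrs_cycEdges_le ha) (m + 2) T' (cycVerts a)
  rw [hprod] at hw
  have hcv : (cycVerts a).card = m + 3 := by
    simp [cycVerts, Finset.card_image_of_injective _ ha]
  rw [hcv] at hw
  refine le_trans ?_ hw
  rw [← Finset.sum_filter, ← Finset.sum_filter, Finset.sum_const, Finset.sum_const,
    smul_eq_mul, smul_eq_mul, mul_one, mul_one]
  refine Finset.card_le_card_of_injOn (fun b j => b (j + (r + 1))) ?_ ?_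
  · intro b hb
    simp only [Finset.coe_filter, Finset.mem_univ, true_and, Set.mem_ofPred_eq] at hb ⊢
    refine ⟨?_, fun i hi => ?_⟩
    · rw [zero_add]
      exact mem_cycVerts_of_mem_cycEdges (hb _ hr) (by simp [cycEdge])
    · have h1 := hb _ hi
      simp only [nbrs, Finset.mem_filter, Finset.mem_univ, true_and]
      have e : i.castSucc + (r + 1) + 1 = i.succ + (r + 1) := by
        rw [← Fin.coeSucc_eq_succ]; exact add_right_comm _ _ _
      rw [cycEdge, e] at h1
      exact h1
  · intro b _ b' _ h
    ext j
    have := congrFun h (j - (r + 1))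
    simpa using this

/-- The cycle sum of noise plus signal. -/
noncomputable def fullSum (ξ : Sym2 V → B → ℝ) (θ : ℝ) (τ : V → ℝ) (m : ℕ) (ω : Sym2 V → B) : ℝ :=
  ∑ a : Fin (m + 3) ↪ V, ∏ j, (invSqrtCard V * ξ (cycEdge a j) (ω (cycEdge a j)) +
    θ * invSqrtCard V ^ 2 * (τ (a j) * τ (a (j + 1))))

/-- The nonempty proper sets of positions. -/
def properSets (k : ℕ) : Finset (Finset (Fin k)) :=
  Finset.univ.filter fun S => S.Nonempty ∧ S ≠ Finset.univ

/-- The coefficients of the mixed terms. -/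
noncomputable def mixCoef (θ : ℝ) (τ : V → ℝ) {m : ℕ} (a : Fin (m + 3) ↪ V)
    (S : Finset (Fin (m + 3))) : ℝ :=
  invSqrtCard V ^ S.card * ∏ j ∈ Finset.univ \ S, (θ * invSqrtCard V ^ 2 * (τ (a j) * τ (a (j + 1))))

/-- The mixed terms in the expansion of the cycle sum of noise plus signal. -/
noncomputable def mixSum (ξ : Sym2 V → B → ℝ) (θ : ℝ) (τ : V → ℝ) (m : ℕ) (ω : Sym2 V → B) : ℝ :=
  ∑ p ∈ (Finset.univ : Finset (Fin (m + 3) ↪ V)) ×ˢ properSets (m + 3),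
    mixCoef θ τ p.1 p.2 * mono ξ (indExp (p.2.image (cycEdge p.1))) ω

/-- Each vertex of a closed walk is the start of one step and the end of another, so every label
appears squared. -/
lemma prod_sign_eq_one {m : ℕ} {τ : V → ℝ} (hτ : ∀ x, τ x * τ x = 1) (a : Fin (m + 3) → V) :
    ∏ j, (τ (a j) * τ (a (j + 1))) = 1 := by
  have : ∏ j, τ (a (j + 1)) = ∏ j, τ (a j) :=
    Equiv.prod_comp (Equiv.addRight (1 : Fin (m + 3))) (fun j => τ (a j))
  rw [Finset.prod_mul_distrib, this, ← Finset.prod_mul_distrib]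
  simp [hτ]

/-- Each product is expanded over the set of positions where the noise is chosen: all positions give
`cycSum`, none gives the deterministic term, the others make up `mixSum`. -/
lemma fullSum_eq {τ : V → ℝ} (hτ : ∀ x, τ x * τ x = 1) (θ : ℝ) (m : ℕ) (ω : Sym2 V → B) :
    fullSum ξ θ τ m ω = cycSum ξ m ω +
      θ ^ (m + 3) * ((Fintype.card V).descFactorial (m + 3) / (Fintype.card V : ℝ) ^ (m + 3)) +
      mixSum ξ θ τ m ω := by
  classical
  have hprod : ∀ a : Fin (m + 3) ↪ V, ∏ j, (invSqrtCard V * ξ (cycEdge a j) (ω (cycEdge a j)) +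
      θ * invSqrtCard V ^ 2 * (τ (a j) * τ (a (j + 1)))) =
      invSqrtCard V ^ (m + 3) * cycMono ξ a ω + θ ^ (m + 3) * (Fintype.card V : ℝ)⁻¹ ^ (m + 3) +
      ∑ S ∈ properSets (m + 3), mixCoef θ τ a S * mono ξ (indExp (S.image (cycEdge a))) ω := by
    intro a
    have hS : ∀ S : Finset (Fin (m + 3)), (∏ j ∈ S, invSqrtCard V * ξ (cycEdge a j) (ω (cycEdge a j))) *
        ∏ j ∈ Finset.univ \ S, (θ * invSqrtCard V ^ 2 * (τ (a j) * τ (a (j + 1)))) =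
        mixCoef θ τ a S * mono ξ (indExp (S.image (cycEdge a))) ω := by
      intro S
      rw [mono_indExp, Finset.prod_image fun _ _ _ _ h => cycEdge_injective a.injective h, mixCoef,
        Finset.prod_mul_distrib, Finset.prod_const]
      ring
    rw [Finset.prod_add, Finset.powerset_univ]
    simp only [hS]
    rw [← Finset.sum_filter_add_sum_filter_not Finset.univ
      (fun S : Finset (Fin (m + 3)) => S.Nonempty ∧ S ≠ Finset.univ), add_comm]
    congr 1
    have : Finset.univ.filter (fun S : Finset (Fin (m + 3)) => ¬ (S.Nonempty ∧ S ≠ Finset.univ)) =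
        {Finset.univ, ∅} := by
      ext S
      simp only [Finset.mem_filter, Finset.mem_univ, true_and, Finset.mem_insert,
        Finset.mem_singleton, not_and_or, not_not, Finset.not_nonempty_iff_eq_empty]
      tauto
    rw [this, Finset.sum_pair Finset.univ_nonempty.ne_empty]
    congr 1
    · rw [mixCoef, Finset.sdiff_self, Finset.prod_empty, Finset.card_univ, Fintype.card_fin, mul_one,
        cycMono_eq_mono a.injective]
      rfl
    · rw [mixCoef, Finset.sdiff_empty, Finset.prod_mul_distrib, prod_sign_eq_one hτ,
        Finset.prod_const, Finset.card_univ, Fintype.card_fin, mul_pow, invSqrtCard_sq]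
      simp [mono, indExp]
  unfold fullSum
  rw [Finset.sum_congr rfl fun a _ => hprod a, Finset.sum_add_distrib, Finset.sum_add_distrib]
  congr 1
  · congr 1
    · rw [cycSum, Finset.mul_sum]
    · rw [Finset.sum_const, Finset.card_univ, Fintype.card_embedding_eq, nsmul_eq_mul,
        Fintype.card_fin, inv_pow]
      ring
  · rw [mixSum, Finset.sum_product]

lemma abs_mixCoef_le {θ Θ : ℝ} (hθ : |θ| ≤ Θ) (hΘ : 1 ≤ Θ) {τ : V → ℝ}
    (hτ : ∀ x, τ x * τ x = 1) {m : ℕ} (a : Fin (m + 3) ↪ V) (S : Finset (Fin (m + 3))) :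
    |mixCoef θ τ a S| ≤ Θ ^ (m + 3) * (invSqrtCard V ^ S.card *
      (invSqrtCard V ^ 2) ^ (m + 3 - S.card)) := by
  have hu : 0 ≤ invSqrtCard V := invSqrtCard_nonneg
  have habs : ∀ x, |τ x| = 1 := by
    intro x
    have h2 : |τ x| * |τ x| = 1 := by rw [← abs_mul, hτ, abs_one]
    nlinarith [abs_nonneg (τ x)]
  rw [mixCoef, abs_mul, abs_of_nonneg (pow_nonneg hu _), Finset.abs_prod]
  have : ∏ j ∈ Finset.univ \ S, |θ * invSqrtCard V ^ 2 * (τ (a j) * τ (a (j + 1)))| =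
      (|θ| * invSqrtCard V ^ 2) ^ (m + 3 - S.card) := by
    rw [Finset.prod_congr rfl fun j _ => (by
      rw [abs_mul, abs_mul, abs_mul, habs, habs, mul_one, mul_one,
        abs_of_nonneg (pow_nonneg hu 2)] :
        |θ * invSqrtCard V ^ 2 * (τ (a j) * τ (a (j + 1)))| = |θ| * invSqrtCard V ^ 2)]
    rw [Finset.prod_const, Finset.card_univ_sdiff, Fintype.card_fin]
  rw [this, mul_pow]
  have h1 : |θ| ^ (m + 3 - S.card) ≤ Θ ^ (m + 3) :=
    (pow_le_pow_left₀ (abs_nonneg _) hθ _).trans (pow_le_pow_right₀ hΘ (Nat.sub_le _ _))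
  calc _ ≤ invSqrtCard V ^ S.card * (Θ ^ (m + 3) * (invSqrtCard V ^ 2) ^ (m + 3 - S.card)) := by
        gcongr
    _ = _ := by ring

lemma inv_pow_mul_pow_sub_eq {x : ℝ} (hx : x ≠ 0) {t k : ℕ} (h : t < k) :
    x⁻¹ ^ t * (x⁻¹ ^ (k - t)) ^ 2 * x ^ (k - 1 - t) = x⁻¹ ^ (k + 1) := by
  obtain ⟨s, rfl⟩ : ∃ s, k = t + 1 + s := ⟨k - t - 1, by omega⟩
  have e1 : t + 1 + s - 1 - t = s := by omega
  have e2 : t + 1 + s - t = s + 1 := by omega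
  rw [e1, e2]
  have : x⁻¹ ^ s * x ^ s = 1 := by rw [← mul_pow, inv_mul_cancel₀ hx, one_pow]
  calc _ = x⁻¹ ^ t * x⁻¹ ^ (s + 2) * (x⁻¹ ^ s * x ^ s) := by ring
    _ = _ := by rw [this]; ring

/-- The mixed terms are negligible. -/
lemma ex_mixSum_sq_le [Nonempty V] (h : IsNoise w ξ ρ ε) {θ Θ : ℝ} (hθ : |θ| ≤ Θ) (hΘ : 1 ≤ Θ)
    {τ : V → ℝ} (hτ : ∀ x, τ x * τ x = 1) (m : ℕ) :
    ex (prodWt w) (fun ω => mixSum ξ θ τ m ω ^ 2) ≤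
      (Θ ^ (m + 3)) ^ 2 * ((m + 3 : ℕ) * 16 ^ (m + 3)) / Fintype.card V := by
  classical
  set P := (Finset.univ : Finset (Fin (m + 3) ↪ V)) ×ˢ properSets (m + 3) with hP
  have hn0 : 0 < Fintype.card V := Fintype.card_pos
  have hn : (0 : ℝ) < Fintype.card V := by exact_mod_cast hn0
  have hu : 0 ≤ invSqrtCard V := invSqrtCard_nonneg
  have hun : invSqrtCard V ^ 2 = (Fintype.card V : ℝ)⁻¹ := invSqrtCard_sq
  have hexp : ex (prodWt w) (fun ω => mixSum ξ θ τ m ω ^ 2) =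
      ∑ p ∈ P, ∑ q ∈ P, mixCoef θ τ p.1 p.2 * mixCoef θ τ q.1 q.2 *
        ex (prodWt w) (mono ξ (indExp (p.2.image (cycEdge p.1)) + indExp (q.2.image (cycEdge q.1)))) := by
    have e : ∀ ω, mixSum ξ θ τ m ω ^ 2 = ∑ p ∈ P, ∑ q ∈ P,
        (mixCoef θ τ p.1 p.2 * mixCoef θ τ q.1 q.2) * mono ξ
          (indExp (p.2.image (cycEdge p.1)) + indExp (q.2.image (cycEdge q.1))) ω := by
      intro ω
      rw [mixSum, sq, Finset.sum_mul_sum]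
      refine Finset.sum_congr rfl fun p _ => Finset.sum_congr rfl fun q _ => ?_
      rw [mono_add]; ring
    rw [funext e, ex_sum]
    refine Finset.sum_congr rfl fun p _ => ?_
    rw [ex_sum]
    exact Finset.sum_congr rfl fun q _ => ex_const_mul _ _ _
  -- the weight of a set of positions
  set c : Finset (Fin (m + 3)) → ℝ := fun T => Θ ^ (m + 3) * (invSqrtCard V ^ T.card *
      (invSqrtCard V ^ 2) ^ (m + 3 - T.card)) with hc
  have hc0 : ∀ T, 0 ≤ c T := fun T => by positivity
  have hterm : ∀ p ∈ P, ∀ q ∈ P, mixCoef θ τ p.1 p.2 * mixCoef θ τ q.1 q.2 *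
        ex (prodWt w) (mono ξ (indExp (p.2.image (cycEdge p.1)) +
          indExp (q.2.image (cycEdge q.1)))) ≤
      2 ^ (m + 3) * c q.2 ^ 2 * (if ∀ j ∈ q.2, cycEdge q.1 j ∈ cycEdges p.1 then (1 : ℕ) else 0 : ℕ) := by
    intro p _ q _
    by_cases he : p.2.image (cycEdge p.1) = q.2.image (cycEdge q.1)
    swap
    · rw [ex_indExp_mul_eq_zero h he, mul_zero]; positivity
    have hcard : p.2.card = q.2.card := by
      rw [← Finset.card_image_of_injective p.2 (cycEdge_injective p.1.injective), he,
        Finset.card_image_of_injective _ (cycEdge_injective q.1.injective)]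
    have hsub : ∀ j ∈ q.2, cycEdge q.1 j ∈ cycEdges p.1 := by
      intro j hj
      have : cycEdge q.1 j ∈ p.2.image (cycEdge p.1) := by
        rw [he]; exact Finset.mem_image_of_mem _ hj
      exact Finset.image_subset_image (Finset.subset_univ _) this
    rw [if_pos hsub, ← he, ex_indExp_sq h]
    have h1 : |∏ i ∈ p.2.image (cycEdge p.1), mom w ξ i 2| ≤ 2 ^ (m + 3) := by
      rw [Finset.abs_prod]
      calc _ ≤ ∏ i ∈ p.2.image (cycEdge p.1), (2 : ℝ) :=
            Finset.prod_le_prod (fun _ _ => abs_nonneg _) fun i _ => abs_mom_two_le h i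
        _ ≤ 2 ^ (m + 3) := by
            rw [Finset.prod_const]
            refine pow_le_pow_right₀ (by norm_num) (Finset.card_image_le.trans ?_)
            exact (Finset.card_le_univ _).trans (by simp)
    have h2 : |mixCoef θ τ p.1 p.2| ≤ c q.2 := by
      have : c q.2 = c p.2 := by simp only [hc, hcard]
      rw [this]; exact abs_mixCoef_le hθ hΘ hτ p.1 p.2
    have h3 : |mixCoef θ τ q.1 q.2| ≤ c q.2 := abs_mixCoef_le hθ hΘ hτ q.1 q.2
    have := hc0 q.2
    refine (le_abs_self _).trans ?_
    rw [abs_mul, abs_mul]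
    calc _ ≤ c q.2 * c q.2 * 2 ^ (m + 3) := by gcongr
      _ = _ := by push_cast; ring
  -- Power counting with `k = m + 3`: the squared coefficient has `n^(-|T|) n^(-2 (k - |T|))` and
  -- there are of order `n^(k - 1 - |T|)` cycles `b`, together `n^(-(k + 1))`. The remaining sum
  -- over `a` leaves `1 / n`.
  have hcount : ∀ a : Fin (m + 3) ↪ V, ∀ T ∈ properSets (m + 3), ∑ b : Fin (m + 3) ↪ V,
      (2 : ℝ) ^ (m + 3) * c T ^ 2 *
        (if ∀ j ∈ T, cycEdge b j ∈ cycEdges a then (1 : ℕ) else 0 : ℕ) ≤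
      (Θ ^ (m + 3)) ^ 2 * ((m + 3 : ℕ) * 4 ^ (m + 3)) * (Fintype.card V : ℝ)⁻¹ ^ (m + 3 + 1) := by
    intro a T hT
    simp only [properSets, Finset.mem_filter, Finset.mem_univ, true_and] at hT
    have hb := sum_cycles_le a.injective hT.1 hT.2
    have hb' : (((∑ b : Fin (m + 3) ↪ V,
        if ∀ j ∈ T, cycEdge b j ∈ cycEdges a then (1 : ℕ) else 0) : ℕ) : ℝ) ≤
        (m + 3 : ℕ) * (2 ^ T.card * (Fintype.card V : ℝ) ^ (m + 3 - 1 - T.card)) := by exact_mod_cast hb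
    have hTk : T.card < m + 3 := by
      have := Finset.card_lt_card (Finset.ssubset_univ_iff.2 hT.2)
      simpa using this
    rw [← Finset.mul_sum, ← Nat.cast_sum]
    have h2 : (2 : ℝ) ^ T.card ≤ 2 ^ (m + 3) := pow_le_pow_right₀ (by norm_num) hTk.le
    calc _ ≤ 2 ^ (m + 3) * c T ^ 2 * ((m + 3 : ℕ) * (2 ^ (m + 3) * (Fintype.card V : ℝ) ^ (m + 3 - 1 - T.card))) := by
          refine mul_le_mul_of_nonneg_left (hb'.trans ?_) (by positivity)
          gcongr
      _ = (Θ ^ (m + 3)) ^ 2 * ((m + 3 : ℕ) * 4 ^ (m + 3)) * ((Fintype.card V : ℝ)⁻¹ ^ T.card * ((Fintype.card V : ℝ)⁻¹ ^ (m + 3 - T.card)) ^ 2 *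
            (Fintype.card V : ℝ) ^ (m + 3 - 1 - T.card)) := by
          have : c T ^ 2 = (Θ ^ (m + 3)) ^ 2 * ((Fintype.card V : ℝ)⁻¹ ^ T.card * ((Fintype.card V : ℝ)⁻¹ ^ (m + 3 - T.card)) ^ 2) := by
            simp only [hc]
            rw [← hun]; ring
          rw [this, show (4 : ℝ) = 2 * 2 by norm_num, mul_pow]; ring
      _ = _ := by
          rw [inv_pow_mul_pow_sub_eq hn.ne' hTk]
  have hcardE : ((Finset.univ : Finset (Fin (m + 3) ↪ V)).card : ℝ) ≤ (Fintype.card V : ℝ) ^ (m + 3) := by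
    rw [Finset.card_univ, Fintype.card_embedding_eq, Fintype.card_fin]
    exact_mod_cast Nat.descFactorial_le_pow _ _
  have hcardI : ((properSets (m + 3)).card : ℝ) ≤ 2 ^ (m + 3) := by
    have := Finset.card_le_univ (properSets (m + 3))
    rw [Fintype.card_finset, Fintype.card_fin] at this
    exact_mod_cast this
  rw [hexp]
  calc _ ≤ ∑ p ∈ P, ∑ q ∈ P, 2 ^ (m + 3) * c q.2 ^ 2 *
        (if ∀ j ∈ q.2, cycEdge q.1 j ∈ cycEdges p.1 then (1 : ℕ) else 0 : ℕ) :=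
        Finset.sum_le_sum fun p hp => Finset.sum_le_sum fun q hq => hterm p hp q hq
    _ ≤ ∑ p ∈ P, (2 ^ (m + 3) * ((Θ ^ (m + 3)) ^ 2 * ((m + 3 : ℕ) * 4 ^ (m + 3)) * (Fintype.card V : ℝ)⁻¹ ^ (m + 3 + 1))) := by
        refine Finset.sum_le_sum fun p _ => ?_
        rw [hP, Finset.sum_product_right]
        refine (Finset.sum_le_sum fun T hT => hcount p.1 T hT).trans ?_
        rw [Finset.sum_const, nsmul_eq_mul]
        gcongr
    _ = (Finset.univ : Finset (Fin (m + 3) ↪ V)).card * (properSets (m + 3)).card *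
          (2 ^ (m + 3) * ((Θ ^ (m + 3)) ^ 2 * ((m + 3 : ℕ) * 4 ^ (m + 3)) * (Fintype.card V : ℝ)⁻¹ ^ (m + 3 + 1))) := by
        rw [Finset.sum_const, hP, Finset.card_product, nsmul_eq_mul]; push_cast; ring
    _ ≤ (Fintype.card V : ℝ) ^ (m + 3) * 2 ^ (m + 3) * (2 ^ (m + 3) * ((Θ ^ (m + 3)) ^ 2 * ((m + 3 : ℕ) * 4 ^ (m + 3)) * (Fintype.card V : ℝ)⁻¹ ^ (m + 3 + 1))) := by gcongr
    _ = _ := by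
        have : (Fintype.card V : ℝ) ^ (m + 3) * (Fintype.card V : ℝ)⁻¹ ^ (m + 3 + 1) = (Fintype.card V : ℝ)⁻¹ := by
          rw [pow_succ _ (m + 3), ← mul_assoc, ← mul_pow, mul_inv_cancel₀ hn.ne', one_pow, one_mul]
        -- One factor `2` per position for each of the two sets of positions, and `4` for the second
        -- moments times the choices of neighbours.
        have e16 : (16 : ℝ) ^ (m + 3) = 2 ^ (m + 3) * 2 ^ (m + 3) * 4 ^ (m + 3) := by
          rw [← mul_pow, ← mul_pow]; norm_num
        calc _ = (Θ ^ (m + 3)) ^ 2 * ((m + 3 : ℕ) * (2 ^ (m + 3) * 2 ^ (m + 3) * 4 ^ (m + 3))) *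
              ((Fintype.card V : ℝ) ^ (m + 3) * (Fintype.card V : ℝ)⁻¹ ^ (m + 3 + 1)) := by
              generalize (m + 3 : ℕ) = k
              ring
          _ = _ := by rw [this, ← e16, div_eq_mul_inv]

end Remainder

/-! ### Characteristic functions for fixed labels -/

section CharacteristicFunction

variable {V : Type*} [Fintype V] [DecidableEq V] {B : Type*} [Fintype B]
  {w ξ : Sym2 V → B → ℝ} {ρ ε : ℝ}

/-- The error in the characteristic function of the noise part. -/
noncomputable def noiseErr (V : Type*) [Fintype V] (ρ ε : ℝ) (M : ℕ) {l : ℕ} (t : Fin l → ℝ) : ℝ :=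
  2 * M * (∑ i, |t i|) ^ 2 * (√(2 * varErr V ρ M) + meanErr V ε M) +
    6 * M ^ 2 * √(varErr V ρ M) * ((∑ i, t i ^ 2) * (l * (1 + meanErr V ε M)) +
      (∑ i, t i ^ 2) ^ 2 * l * (l : ℝ))

/-- The error in the characteristic function due to the signal. -/
noncomputable def signalErr (V : Type*) [Fintype V] (Θ : ℝ) (M : ℕ) {l : ℕ} (t : Fin l → ℝ) : ℝ :=
  (∑ i, |t i|) * (Θ ^ M * ((M : ℝ) ^ 2 / Fintype.card V) +
    √((Θ ^ M) ^ 2 * (M * 16 ^ M) / Fintype.card V))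

lemma norm_exp_I_sub_exp_I_le (x y : ℝ) :
    ‖Complex.exp (Complex.I * (y : ℂ)) - Complex.exp (Complex.I * (x : ℂ))‖ ≤ |y - x| := by
  have e : Complex.exp (Complex.I * (y : ℂ)) - Complex.exp (Complex.I * (x : ℂ)) =
      Complex.exp (Complex.I * (x : ℂ)) * (Complex.exp (Complex.I * ((y - x : ℝ) : ℂ)) - 1) := by
    rw [mul_sub, ← Complex.exp_add, mul_one]
    congr 2
    push_cast; ring
  rw [e, norm_mul, mul_comm Complex.I (x : ℂ), Complex.norm_exp_ofReal_mul_I, one_mul]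
  exact Real.norm_exp_I_mul_ofReal_sub_one_le

lemma cex_sub (π : (Sym2 V → B) → ℝ) (f g : (Sym2 V → B) → ℂ) :
    cex π f - cex π g = cex π (fun ω => f ω - g ω) := by
  simp [cex, mul_sub]

/-- The two errors are the defect of the falling factorial in the signal term and the mixed terms.
The condition `1 ≤ Θ` allows replacing every length by the common bound `M`. -/
lemma ex_abs_fullSum_sub_le [Nonempty V] (h : IsNoise w ξ ρ ε) {θ Θ : ℝ} (hθ : |θ| ≤ Θ)
    (hΘ : 1 ≤ Θ) {τ : V → ℝ} (hτ : ∀ x, τ x * τ x = 1) {m M : ℕ} (hm : m + 3 ≤ M) :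
    ex (prodWt w) (fun ω => |fullSum ξ θ τ m ω - θ ^ (m + 3) - cycSum ξ m ω|) ≤
      Θ ^ M * ((M : ℝ) ^ 2 / Fintype.card V) +
        √((Θ ^ M) ^ 2 * (M * 16 ^ M) / Fintype.card V) := by
  have hn0 : 0 < Fintype.card V := Fintype.card_pos
  have hn : (0 : ℝ) < Fintype.card V := by exact_mod_cast hn0
  have hmR : ((m + 3 : ℕ) : ℝ) ≤ M := by exact_mod_cast hm
  have hpow : Θ ^ (m + 3) ≤ Θ ^ M := pow_le_pow_right₀ hΘ hm
  set d : ℝ := (Fintype.card V).descFactorial (m + 3) / (Fintype.card V : ℝ) ^ (m + 3) with hd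
  have hd1 : d ≤ 1 := by
    rw [hd, div_le_one (by positivity)]
    exact_mod_cast Nat.descFactorial_le_pow _ _
  have hd2 : 1 - ((m + 3 : ℕ) : ℝ) ^ 2 / Fintype.card V ≤ d := one_sub_le_descFactorial_div _ _ hn0
  have hθd : |θ ^ (m + 3) * (d - 1)| ≤ Θ ^ M * ((M : ℝ) ^ 2 / Fintype.card V) := by
    rw [abs_mul, abs_pow]
    refine mul_le_mul ((pow_le_pow_left₀ (abs_nonneg _) hθ _).trans hpow) ?_ (abs_nonneg _)
      (by positivity)
    rw [abs_sub_comm, abs_of_nonneg (by linarith)]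
    calc 1 - d ≤ ((m + 3 : ℕ) : ℝ) ^ 2 / Fintype.card V := by linarith
      _ ≤ _ := by gcongr
  calc _ ≤ ex (prodWt w) (fun ω => |θ ^ (m + 3) * (d - 1)| + |mixSum ξ θ τ m ω|) := by
        refine ex_mono (prodWt_nonneg h) fun ω => ?_
        rw [fullSum_eq hτ]
        refine le_trans (le_of_eq ?_) (abs_add_le _ _)
        congr 1
        ring
    _ = |θ ^ (m + 3) * (d - 1)| + ex (prodWt w) (fun ω => |mixSum ξ θ τ m ω|) := by
        rw [ex_add, ex_const (sum_prodWt h)]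
    _ ≤ _ := by
        refine add_le_add hθd ((ex_abs_le_sqrt (prodWt_nonneg h) (sum_prodWt h) _).trans ?_)
        refine Real.sqrt_le_sqrt ((ex_mixSum_sq_le h hθ hΘ hτ m).trans ?_)
        have h16 : (16 : ℝ) ^ (m + 3) ≤ 16 ^ M := pow_le_pow_right₀ (by norm_num) hm
        gcongr

/-- The characteristic function of the centered cycle sums is nearly Gaussian. -/
lemma norm_cex_fullSum_sub_le [Nonempty V] (h : IsNoise w ξ ρ ε) {θ Θ : ℝ} (hθ : |θ| ≤ Θ)
    (hΘ : 1 ≤ Θ) {τ : V → ℝ} (hτ : ∀ x, τ x * τ x = 1) {l : ℕ} {m : Fin l → ℕ}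
    (hm : Function.Injective m) {M : ℕ} (hM : 1 ≤ M) (hmM : ∀ i, m i + 3 ≤ M)
    (hN : 1 ≤ √(Fintype.card V) * ρ)
    (hMn : ((4 * M : ℕ) : ℝ) * 2 ^ (4 * M) ≤ √(Fintype.card V)) (t : Fin l → ℝ) :
    ‖cex (prodWt w) (fun ω => Complex.exp (Complex.I *
        ((∑ i, t i / √(2 * (m i + 3 : ℕ)) * (fullSum ξ θ τ (m i) ω - θ ^ (m i + 3)) : ℝ) : ℂ))) -
      Complex.exp (-((∑ i, t i ^ 2 : ℝ) : ℂ) / 2)‖ ≤ noiseErr V ρ ε M t + signalErr V Θ M t := by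
  have h1 := norm_cex_cycSum_sub_le h hm hM hmM hN hMn t
  set F : (Sym2 V → B) → ℝ := fun ω => ∑ i, t i / √(2 * (m i + 3 : ℕ)) * cycSum ξ (m i) ω
  set G : (Sym2 V → B) → ℝ := fun ω =>
    ∑ i, t i / √(2 * (m i + 3 : ℕ)) * (fullSum ξ θ τ (m i) ω - θ ^ (m i + 3))
  have h2 : ‖cex (prodWt w) (fun ω => Complex.exp (Complex.I * (G ω : ℂ))) -
      cex (prodWt w) (fun ω => Complex.exp (Complex.I * (F ω : ℂ)))‖ ≤ signalErr V Θ M t := by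
    rw [cex_sub]
    refine (norm_cex_le (g := fun ω => |G ω - F ω|) (prodWt_nonneg h)
      fun ω => norm_exp_I_sub_exp_I_le _ _).trans ?_
    calc _ ≤ ex (prodWt w) (fun ω => ∑ i, |t i| *
          |fullSum ξ θ τ (m i) ω - θ ^ (m i + 3) - cycSum ξ (m i) ω|) := by
          refine ex_mono (prodWt_nonneg h) fun ω => ?_
          rw [← Finset.sum_sub_distrib]
          refine (Finset.abs_sum_le_sum_abs _ _).trans (Finset.sum_le_sum fun i _ => ?_)
          rw [← mul_sub, abs_mul, abs_div, abs_of_nonneg (Real.sqrt_nonneg _)]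
          refine mul_le_mul_of_nonneg_right (div_le_self (abs_nonneg _) ?_) (abs_nonneg _)
          rw [Real.one_le_sqrt]
          push_cast
          have : (0 : ℝ) ≤ m i := Nat.cast_nonneg _
          linarith
      _ = ∑ i, |t i| * ex (prodWt w) (fun ω =>
          |fullSum ξ θ τ (m i) ω - θ ^ (m i + 3) - cycSum ξ (m i) ω|) := by
          rw [ex_sum]
          exact Finset.sum_congr rfl fun i _ => ex_const_mul _ _ _
      _ ≤ _ := by
          rw [signalErr, Finset.sum_mul]
          exact Finset.sum_le_sum fun i _ => mul_le_mul_of_nonneg_left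
            (ex_abs_fullSum_sub_le h hθ hΘ hτ (hmM i)) (abs_nonneg _)
  calc _ = ‖(cex (prodWt w) (fun ω => Complex.exp (Complex.I * (F ω : ℂ))) -
        Complex.exp (-((∑ i, t i ^ 2 : ℝ) : ℂ) / 2)) +
        (cex (prodWt w) (fun ω => Complex.exp (Complex.I * (G ω : ℂ))) -
          cex (prodWt w) (fun ω => Complex.exp (Complex.I * (F ω : ℂ))))‖ := by
        congr 1; ring
    _ ≤ _ := (norm_add_le _ _).trans (add_le_add h1 h2)

end CharacteristicFunction

/-! ### Vanishing of the error terms -/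

section Asymptotics

/-- If `M` is of smaller order than `-log x`, then powers `D ^ M` are of smaller order than
`x⁻¹`. -/
lemma tendsto_pow_mul_zero {α : Type*} {f : Filter α} {M : α → ℕ} {x : α → ℝ}
    (hx0 : ∀ᶠ n in f, 0 < x n) (hx : Tendsto x f (𝓝 0))
    (hM : (fun n => (M n : ℝ)) =o[f] fun n => Real.log (x n)) {D : ℝ} (hD : 1 ≤ D) :
    Tendsto (fun n => D ^ M n * x n) f (𝓝 0) := by
  have hx1 : ∀ᶠ n in f, x n < 1 := hx.eventually_lt_const one_pos
  have hsqrt : Tendsto (fun n => √(x n)) f (𝓝 0) := by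
    simpa using hx.sqrt
  -- With this constant `M * log D` is at most half of `-log x`, so `D ^ M * x ≤ √x`. The `+ 1`
  -- covers `D = 1`.
  have hc : (0 : ℝ) < 1 / (2 * (Real.log D + 1)) := by
    have := Real.log_nonneg hD
    positivity
  refine tendsto_of_tendsto_of_tendsto_of_le_of_le' tendsto_const_nhds hsqrt ?_ ?_
  · filter_upwards [hx0] with n hn
    positivity
  · filter_upwards [hx0, hx1, hM.bound hc] with n hn hn1 hMn
    have hlog : Real.log (x n) < 0 := Real.log_neg hn hn1
    have hlD := Real.log_nonneg hD
    rw [Real.norm_of_nonneg (Nat.cast_nonneg _), Real.norm_of_nonpos hlog.le] at hMn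
    have h1 : M n * Real.log D ≤ -Real.log (x n) / 2 := by
      calc M n * Real.log D ≤ (1 / (2 * (Real.log D + 1)) * -Real.log (x n)) * (Real.log D + 1) := by
            refine mul_le_mul hMn (by linarith) hlD ?_
            exact mul_nonneg hc.le (by linarith)
        _ = _ := by field_simp
    rw [← Real.log_le_log_iff (by positivity) (by positivity),
      Real.log_mul (by positivity) hn.ne', Real.log_pow, Real.log_sqrt hn.le]
    linarith

lemma natCast_pow_le_pow (M j : ℕ) : (M : ℝ) ^ j ≤ (2 ^ j) ^ M := by
  have h : (M : ℝ) ≤ 2 ^ M := by exact_mod_cast Nat.lt_two_pow_self.le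
  calc (M : ℝ) ^ j ≤ (2 ^ M) ^ j := pow_le_pow_left₀ (Nat.cast_nonneg _) h _
    _ = _ := by rw [← pow_mul, ← pow_mul, mul_comm]

/-- Polynomial factors are absorbed through `M ≤ 2 ^ M`. The base is `48 ^ 4`, and `256 = 4 ^ 4`
comes from the power `(4 * M) ^ 4` in `quadB`. -/
lemma pow_mul_varErr_le {n : ℕ} {ρ : ℝ} (hρ : 0 < ρ) (M : ℕ) :
    (M : ℝ) ^ 4 * varErr (Fin n) ρ M ≤ 256 * (5308416 ^ M * (√n * ρ)⁻¹) := by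
  have h := natCast_pow_le_pow M 4
  have hx : 0 ≤ (√n * ρ)⁻¹ := by positivity
  have e : (5308416 : ℝ) ^ M = (2 ^ 4) ^ M * (2 ^ 4) ^ M * 2 ^ (4 * M) * 3 ^ (4 * M) * 2 ^ (4 * M) := by
    rw [pow_mul, pow_mul, ← mul_pow, ← mul_pow, ← mul_pow, ← mul_pow]; norm_num
  unfold varErr quadB
  rw [Fintype.card_fin, e]
  push_cast
  calc _ = 256 * ((M : ℝ) ^ 4 * (M : ℝ) ^ 4 * 2 ^ (4 * M) * 3 ^ (4 * M) * 2 ^ (4 * M) *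
        (√n * ρ)⁻¹) := by ring
    _ ≤ _ := by gcongr

lemma inv_natCast_le {n : ℕ} (hn : 0 < n) {ρ : ℝ} (hρ : 0 < ρ) (hρ1 : ρ ≤ 1)
    (hx1 : (√n * ρ)⁻¹ ≤ 1) : (n : ℝ)⁻¹ ≤ (√n * ρ)⁻¹ := by
  have hn' : (0 : ℝ) < n := by exact_mod_cast hn
  have hs : 0 < √(n : ℝ) := Real.sqrt_pos.2 hn'
  have h1 : 1 ≤ √n * ρ := by rwa [inv_le_one₀ (by positivity)] at hx1
  have h2 : √(n : ℝ) * √n = n := Real.mul_self_sqrt hn'.le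
  refine inv_anti₀ (by positivity) ?_
  nlinarith

variable {ρ : ℕ → ℝ} {M : ℕ → ℕ}

/-- Every factor that must vanish is dominated by terms `D ^ M * (√n * ρ)⁻¹` or their square roots,
even after multiplication by the powers of `M` in front. -/
lemma tendsto_noiseErr (hρ : ∀ᶠ n in atTop, 0 < ρ n) (hρ1 : ∀ᶠ n in atTop, ρ n ≤ 1)
    (hx : Tendsto (fun n : ℕ => (√n * ρ n)⁻¹) atTop (𝓝 0))
    (hM : (fun n => (M n : ℝ)) =o[atTop] fun n : ℕ => Real.log (√n * ρ n)⁻¹)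
    {Θ : ℝ} (hΘ : 0 ≤ Θ) {l : ℕ} (t : Fin l → ℝ) :
    Tendsto (fun n : ℕ => noiseErr (Fin n) (ρ n) (Θ * (√n * ρ n)⁻¹) (M n) t) atTop (𝓝 0) := by
  have hx0 : ∀ᶠ n : ℕ in atTop, 0 < (√n * ρ n)⁻¹ := by
    filter_upwards [hρ, eventually_gt_atTop 0] with n hn hn0
    have : 0 < √(n : ℝ) := Real.sqrt_pos.2 (by exact_mod_cast hn0)
    positivity
  have hD : ∀ D : ℝ, 1 ≤ D → Tendsto (fun n => D ^ M n * (√n * ρ n)⁻¹) atTop (𝓝 0) :=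
    fun D => tendsto_pow_mul_zero hx0 hx hM
  have hvar : Tendsto (fun n => (M n : ℝ) ^ 2 * √(varErr (Fin n) (ρ n) (M n))) atTop (𝓝 0) := by
    have h1 : Tendsto (fun n => √(256 * (5308416 ^ M n * (√n * ρ n)⁻¹))) atTop (𝓝 0) := by
      simpa using ((hD 5308416 (by norm_num)).const_mul 256).sqrt
    refine tendsto_of_tendsto_of_tendsto_of_le_of_le' tendsto_const_nhds h1 ?_ ?_
    · exact Eventually.of_forall fun n => by positivity
    · filter_upwards [hρ] with n hn
      refine le_trans (le_of_eq ?_) (Real.sqrt_le_sqrt (pow_mul_varErr_le hn (M n)))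
      rw [Real.sqrt_mul (by positivity), show (M n : ℝ) ^ 4 = ((M n : ℝ) ^ 2) ^ 2 by ring,
        Real.sqrt_sq (by positivity)]
  have hmean : Tendsto (fun n => (M n : ℝ) * meanErr (Fin n) (Θ * (√n * ρ n)⁻¹) (M n)) atTop
      (𝓝 0) := by
    have h1 : Tendsto (fun n => Θ * (4 ^ M n * (√n * ρ n)⁻¹) + 8 ^ M n * (√n * ρ n)⁻¹) atTop
        (𝓝 0) := by
      simpa using ((hD 4 (by norm_num)).const_mul Θ).add (hD 8 (by norm_num))
    refine tendsto_of_tendsto_of_tendsto_of_le_of_le' tendsto_const_nhds h1 ?_ ?_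
    · filter_upwards [hx0] with n hn
      unfold meanErr; positivity
    · filter_upwards [hρ, hρ1, hx0, eventually_gt_atTop 0, hx.eventually_le_const one_pos]
        with n hn hn1 hxn hn0 hxn1
      have h2 := natCast_pow_le_pow (M n) 1
      have h3 := natCast_pow_le_pow (M n) 3
      have h4 := inv_natCast_le hn0 hn hn1 hxn1
      unfold meanErr
      rw [Fintype.card_fin]
      calc _ = Θ * ((M n : ℝ) ^ 1 * 2 ^ M n * (√n * ρ n)⁻¹) + (M n : ℝ) ^ 3 * (n : ℝ)⁻¹ := by
            field_simp
        _ ≤ Θ * ((2 ^ 1) ^ M n * 2 ^ M n * (√n * ρ n)⁻¹) + (2 ^ 3) ^ M n * (√n * ρ n)⁻¹ := by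
            gcongr
        _ = _ := by rw [← mul_pow]; norm_num
  have hmean' : Tendsto (fun n => meanErr (Fin n) (Θ * (√n * ρ n)⁻¹) (M n)) atTop (𝓝 0) := by
    have h1 : Tendsto (fun n => Θ * (2 ^ M n * (√n * ρ n)⁻¹) + 4 ^ M n * (√n * ρ n)⁻¹) atTop
        (𝓝 0) := by
      simpa using ((hD 2 (by norm_num)).const_mul Θ).add (hD 4 (by norm_num))
    refine tendsto_of_tendsto_of_tendsto_of_le_of_le' tendsto_const_nhds h1 ?_ ?_
    · filter_upwards [hx0] with n hn
      unfold meanErr; positivity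
    · filter_upwards [hρ, hρ1, hx0, eventually_gt_atTop 0, hx.eventually_le_const one_pos]
        with n hn hn1 hxn hn0 hxn1
      have h2 := natCast_pow_le_pow (M n) 2
      have h4 := inv_natCast_le hn0 hn hn1 hxn1
      unfold meanErr
      rw [Fintype.card_fin]
      calc _ = Θ * (2 ^ M n * (√n * ρ n)⁻¹) + (M n : ℝ) ^ 2 * (n : ℝ)⁻¹ := by
            field_simp
        _ ≤ Θ * (2 ^ M n * (√n * ρ n)⁻¹) + (2 ^ 2) ^ M n * (√n * ρ n)⁻¹ := by
            gcongr
        _ = _ := by norm_num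
  have hvar' : Tendsto (fun n => (M n : ℝ) * √(2 * varErr (Fin n) (ρ n) (M n))) atTop (𝓝 0) := by
    have h1 := hvar.const_mul √2
    rw [mul_zero] at h1
    refine tendsto_of_tendsto_of_tendsto_of_le_of_le tendsto_const_nhds h1
      (fun n => by positivity) fun n => ?_
    have h2 : (M n : ℝ) ≤ (M n : ℝ) ^ 2 := by
      exact_mod_cast Nat.le_self_pow two_ne_zero _
    simp only
    rw [Real.sqrt_mul zero_le_two]
    calc _ = √2 * ((M n : ℝ) * √(varErr (Fin n) (ρ n) (M n))) := by ring
      _ ≤ _ := by gcongr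
  have h := ((hvar'.add hmean).const_mul (2 * (∑ i, |t i|) ^ 2)).add
    ((hvar.const_mul 6).mul (((hmean'.const_add 1).const_mul ((∑ i, t i ^ 2) * l)).add_const
      ((∑ i, t i ^ 2) ^ 2 * l * (l : ℝ))))
  simp only [add_zero, mul_zero, zero_mul] at h
  refine h.congr fun n => ?_
  unfold noiseErr
  ring

lemma tendsto_signalErr (hρ : ∀ᶠ n in atTop, 0 < ρ n) (hρ1 : ∀ᶠ n in atTop, ρ n ≤ 1)
    (hx : Tendsto (fun n : ℕ => (√n * ρ n)⁻¹) atTop (𝓝 0))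
    (hM : (fun n => (M n : ℝ)) =o[atTop] fun n : ℕ => Real.log (√n * ρ n)⁻¹)
    {Θ : ℝ} (hΘ : 1 ≤ Θ) {l : ℕ} (t : Fin l → ℝ) :
    Tendsto (fun n : ℕ => signalErr (Fin n) Θ (M n) t) atTop (𝓝 0) := by
  have hx0 : ∀ᶠ n : ℕ in atTop, 0 < (√n * ρ n)⁻¹ := by
    filter_upwards [hρ, eventually_gt_atTop 0] with n hn hn0
    have : 0 < √(n : ℝ) := Real.sqrt_pos.2 (by exact_mod_cast hn0)
    positivity
  have hD : ∀ D : ℝ, 1 ≤ D → Tendsto (fun n => D ^ M n * (√n * ρ n)⁻¹) atTop (𝓝 0) :=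
    fun D => tendsto_pow_mul_zero hx0 hx hM
  have h1 : Tendsto (fun n => (∑ i, |t i|) * ((Θ * 4) ^ M n * (√n * ρ n)⁻¹ +
      √((Θ ^ 2 * (2 * 16)) ^ M n * (√n * ρ n)⁻¹))) atTop (𝓝 0) := by
    simpa using ((hD (Θ * 4) (by linarith)).add
      (hD (Θ ^ 2 * (2 * 16)) (by nlinarith)).sqrt).const_mul (∑ i, |t i|)
  refine tendsto_of_tendsto_of_tendsto_of_le_of_le' tendsto_const_nhds h1 ?_ ?_
  · exact Eventually.of_forall fun n => by unfold signalErr; positivity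
  · filter_upwards [hρ, hρ1, hx0, eventually_gt_atTop 0, hx.eventually_le_const one_pos]
      with n hn hn1 hxn hn0 hxn1
    have h2 := natCast_pow_le_pow (M n) 1
    have h3 := natCast_pow_le_pow (M n) 2
    have h4 := inv_natCast_le hn0 hn hn1 hxn1
    rw [pow_one, pow_one] at h2
    norm_num at h3
    unfold signalErr
    rw [Fintype.card_fin, div_eq_mul_inv, div_eq_mul_inv, mul_pow Θ 4, mul_pow (Θ ^ 2), mul_pow 2 16,
      mul_assoc (Θ ^ M n), ← pow_mul Θ 2, mul_comm 2 (M n), pow_mul Θ]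
    gcongr

end Asymptotics

/-! ### The block model as independent noise plus signal -/

section Law

instance {V : Type*} [Countable V] : MeasurableSingletonClass (SimpleGraph V) where
  measurableSet_singleton G := by
    have : ({G} : Set (SimpleGraph V)) = SimpleGraph.edgeSet ⁻¹' {G.edgeSet} := by
      ext H
      exact SimpleGraph.edgeSet_inj.symm
    rw [this]
    exact SimpleGraph.measurable_edgeSet (measurableSet_singleton _)

instance : MeasurableSingletonClass ℤˣ where
  measurableSet_singleton u := by
    have : ({u} : Set ℤˣ) = Units.val ⁻¹' {(u : ℤ)} := by
      ext v
      exact Units.ext_iff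
    rw [this]
    exact ⟨_, MeasurableSet.of_discrete, rfl⟩

variable {V : Type*} [Fintype V] [DecidableEq V] {F : Type*} [NormedAddCommGroup F]
  [NormedSpace ℝ F] [CompleteSpace F]

open Classical in
/-- The indicator of a proposition. -/
noncomputable def propInd (b : Prop) : ℝ := if b then 1 else 0

/-- The weights of the outcomes of the toss for a pair of vertices. -/
noncomputable def edgeWt (p q : I) (τ : V → ℤˣ) (e : Sym2 V) (b : Prop) : ℝ :=
  propInd b * edgeProb p q τ e + (1 - propInd b) * (1 - edgeProb p q τ e)

/-- The normalized outcome of the toss for a pair of vertices. -/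
noncomputable def edgeNoise (p q : I) (ρ : ℝ) (τ : V → ℤˣ) (e : Sym2 V) (b : Prop) : ℝ :=
  (propInd b - edgeProb p q τ e) / ρ

lemma sum_prop {M : Type*} [AddCommMonoid M] (f : Prop → M) : ∑ b, f b = f True + f False := by
  rw [Fintype.univ_Prop, Finset.sum_pair (by simp)]

@[simp] lemma propInd_true : propInd True = 1 := by simp [propInd]

@[simp] lemma propInd_false : propInd False = 0 := by simp [propInd]

lemma edgeWt_nonneg (p q : I) (τ : V → ℤˣ) (e : Sym2 V) (b : Prop) : 0 ≤ edgeWt p q τ e b := by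
  have h0 := (edgeProb p q τ e).2.1
  have h1 := (edgeProb p q τ e).2.2
  by_cases hb : b
  · simpa [edgeWt, hb] using h0
  · simpa [edgeWt, hb] using h1

lemma bernoulliMeasure_real_singleton (x : I) (b : Prop) :
    (bernoulliMeasure True False x).real {b} = propInd b * x + (1 - propInd b) * (1 - x) := by
  classical
  rw [bernoulliMeasure_real_apply x MeasurableSet.of_discrete]
  by_cases hb : b
  · simp [hb]
  · simp [hb]

lemma integral_graphLaw (p q : I) (τ : V → ℤˣ) (f : SimpleGraph V → F) :
    ∫ G, f G ∂graphLaw p q τ =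
      ∑ ω : Sym2 V → Prop, prodWt (edgeWt p q τ) ω • f (SimpleGraph.fromEdgeSet {e | ω e}) := by
  have hmeas : Measurable fun E : Sym2 V → Prop => SimpleGraph.fromEdgeSet {e | E e} :=
    SimpleGraph.measurable_fromEdgeSet.comp MeasurableEquiv.setOfPred.measurable
  rw [graphLaw, integral_map hmeas.aemeasurable .of_discrete, integral_fintype .of_finite]
  refine Finset.sum_congr rfl fun ω _ => ?_
  congr 1
  rw [measureReal_def, Measure.pi_singleton, ENNReal.toReal_prod]
  exact Finset.prod_congr rfl fun e _ => bernoulliMeasure_real_singleton _ _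

lemma integral_sbm (n : ℕ) (p q : I) (f : LabelledGraph n → F) :
    ∫ ω, f ω ∂sbm n p q = ((2 : ℝ) ^ n)⁻¹ • ∑ τ, ∫ G, f (τ, G) ∂graphLaw p q τ := by
  rw [sbm, integral_smul_measure, integral_finsetSum_measure fun _ _ => .of_finite]
  congr 1
  · simp
  · refine Finset.sum_congr rfl fun τ _ => ?_
    rw [Measure.dirac_prod, integral_map (by fun_prop) .of_discrete]

lemma edgeInd_fromEdgeSet {x y : V} (h : x ≠ y) (ω : Sym2 V → Prop) :
    edgeInd (SimpleGraph.fromEdgeSet {e | ω e}) x y = propInd (ω s(x, y)) := by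
  have hadj : (SimpleGraph.fromEdgeSet {e | ω e}).Adj x y ↔ ω s(x, y) := by
    rw [SimpleGraph.fromEdgeSet_adj]; exact and_iff_left h
  by_cases hb : ω s(x, y)
  · rw [edgeInd, propInd, if_pos hb, if_pos (hadj.2 hb)]
  · rw [edgeInd, propInd, if_neg hb, if_neg (mt hadj.1 hb)]

lemma integral_edgeInd_graphLaw (p q : I) (τ : V → ℤˣ) {x y : V} (h : x ≠ y) :
    ∫ G, edgeInd G x y ∂graphLaw p q τ = edgeProb p q τ s(x, y) := by
  have hmeas : Measurable fun E : Sym2 V → Prop => SimpleGraph.fromEdgeSet {e | E e} :=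
    SimpleGraph.measurable_fromEdgeSet.comp MeasurableEquiv.setOfPred.measurable
  rw [graphLaw, integral_map hmeas.aemeasurable .of_discrete]
  simp only [edgeInd_fromEdgeSet h]
  have h1 := measurePreserving_eval
    (fun e : Sym2 V => bernoulliMeasure True False (edgeProb p q τ e)) s(x, y)
  have h2 := integral_map (μ := Measure.pi fun e : Sym2 V =>
    bernoulliMeasure True False (edgeProb p q τ e)) (f := propInd) h1.measurable.aemeasurable
    .of_discrete
  rw [h1.map_eq, integral_bernoulliMeasure] at h2
  simpa using h2.symm

/-- Flipping the label of `x` is a bijection of the labellings that exchanges `p` and `q` on the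
pair. -/
lemma sum_edgeProb (p q : I) {x y : V} (h : x ≠ y) :
    ∑ τ : V → ℤˣ, (edgeProb p q τ s(x, y) : ℝ) = 2 ^ Fintype.card V * (((p : ℝ) + q) / 2) := by
  have hflip : ∀ τ : V → ℤˣ, (edgeProb p q τ s(x, y) : ℝ) +
      edgeProb p q (Pi.mulSingle x (-1) * τ) s(x, y) = p + q := by
    intro τ
    have e : edgeProb p q (Pi.mulSingle x (-1) * τ) s(x, y) = if τ x = τ y then q else p := by
      simp only [edgeProb, Sym2.lift_mk, Pi.mul_apply, Pi.mulSingle_eq_same,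
        Pi.mulSingle_eq_of_ne h.symm, one_mul, neg_mul]
      by_cases hxy : τ x = τ y
      · rw [if_pos hxy, if_neg]
        rw [hxy]
        exact Int.units_ne_iff_eq_neg.2 rfl
      · rw [if_neg hxy, if_pos]
        rw [Int.units_ne_iff_eq_neg.1 hxy, neg_neg]
    rw [e]
    simp only [edgeProb, Sym2.lift_mk]
    split_ifs <;> ring
  have hsum := Equiv.sum_comp (Equiv.mulLeft (Pi.mulSingle x (-1) : V → ℤˣ))
    (fun τ => (edgeProb p q τ s(x, y) : ℝ))
  have h2 : ∑ τ : V → ℤˣ, ((edgeProb p q τ s(x, y) : ℝ) +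
      edgeProb p q (Pi.mulSingle x (-1) * τ) s(x, y)) = 2 ^ Fintype.card V * ((p : ℝ) + q) := by
    simp only [hflip]
    simp [Fintype.card_units_int, mul_add]
  rw [Finset.sum_add_distrib] at h2
  simp only [Equiv.coe_mulLeft] at hsum
  rw [hsum] at h2
  linarith

/-- The average connection probability of the stochastic block model. -/
lemma avgConnProb_sbm {n : ℕ} (hn : 2 ≤ n) (p q : I) : avgConnProb (sbm n p q) = ((p : ℝ) + q) / 2 := by
  have hint : ∀ i j : Fin n, i ≠ j → ∫ ω, edgeInd ω.2 i j ∂sbm n p q = ((p : ℝ) + q) / 2 := by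
    intro i j hij
    rw [integral_sbm]
    simp only [integral_edgeInd_graphLaw p q _ hij]
    rw [sum_edgeProb p q hij, Fintype.card_fin, smul_eq_mul, inv_mul_cancel_left₀ (by positivity)]
  have h2 : (2 : ℝ) ≤ n := by exact_mod_cast hn
  have h1 : (n : ℝ) - 1 ≠ 0 := by linarith
  have h0 : (n : ℝ) ≠ 0 := by linarith
  have : ∑ i : Fin n, ∑ j ∈ Finset.univ.erase i, ∫ ω, edgeInd ω.2 i j ∂sbm n p q =
      n * ((n - 1) * (((p : ℝ) + q) / 2)) := by
    rw [Finset.sum_congr rfl fun i _ => Finset.sum_congr rfl fun j hj =>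
      hint i j (Finset.ne_of_mem_erase hj).symm]
    simp [Finset.card_erase_of_mem, Nat.cast_sub (by omega : 1 ≤ n)]
  rw [avgConnProb, this]
  field_simp

lemma edgeProb_eq (p q : I) (τ : V → ℤˣ) (x y : V) : (edgeProb p q τ s(x, y) : ℝ) =
    ((p : ℝ) + q) / 2 + ((p : ℝ) - q) / 2 * (((τ x : ℤ) : ℝ) * ((τ y : ℤ) : ℝ)) := by
  simp only [edgeProb, Sym2.lift_mk]
  rcases Int.units_eq_one_or (τ x) with h | h <;> rcases Int.units_eq_one_or (τ y) with h' | h' <;>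
    simp [h, h'] <;> ring

/-- With `r = (p + q) / 2` and edge probability `P`, the variance defect is `(P (1 - P) - r (1 - r))
/ ρ²`, that is `(P - r) (1 - r - P) / ρ²`, where `|P - r| = |p - q| / 2` and the second factor has
modulus at most one. -/
lemma isNoise_edgeNoise (p q : I) (τ : V → ℤˣ) {ρ ε : ℝ} (hρ : 0 < ρ)
    (hρ2 : ρ ^ 2 = ((p : ℝ) + q) / 2 * (1 - ((p : ℝ) + q) / 2))
    (hε : |((p : ℝ) - q) / 2| / ρ ^ 2 ≤ ε) (hε1 : ε ≤ 1) :
    IsNoise (edgeWt p q τ) (edgeNoise p q ρ τ) ρ ε where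
  nonneg := edgeWt_nonneg p q τ
  sum_eq_one e := by rw [sum_prop]; simp [edgeWt]
  mean e := by
    rw [sum_prop]
    simp only [edgeWt, edgeNoise, propInd_true, propInd_false]
    ring
  bound e b := by
    have h0 := (edgeProb p q τ e).2.1
    have h1 := (edgeProb p q τ e).2.2
    rw [edgeNoise, abs_div, abs_of_pos hρ, div_eq_mul_inv]
    refine mul_le_of_le_one_left (by positivity) ?_
    by_cases hb : b
    · simp only [hb, propInd_true]; rw [abs_le]; constructor <;> linarith
    · simp only [hb, propInd_false]; rw [abs_le]; constructor <;> linarith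
  var e := by
    refine le_trans ?_ hε
    rw [sum_prop]
    simp only [edgeWt, edgeNoise, propInd_true, propInd_false]
    induction e with | h x y => ?_
    have h0 := (edgeProb p q τ s(x, y)).2.1
    have h1 := (edgeProb p q τ s(x, y)).2.2
    have hp0 := p.2.1
    have hp1 := p.2.2
    have hq0 := q.2.1
    have hq1 := q.2.2
    have he := edgeProb_eq p q τ x y
    have hs : |((τ x : ℤ) : ℝ) * ((τ y : ℤ) : ℝ)| = 1 := by
      rcases Int.units_eq_one_or (τ x) with h | h <;>
        rcases Int.units_eq_one_or (τ y) with h' | h' <;> simp [h, h']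
    set P : ℝ := (edgeProb p q τ s(x, y) : ℝ)
    set s : ℝ := ((τ x : ℤ) : ℝ) * ((τ y : ℤ) : ℝ)
    have hP : |((p : ℝ) - q) / 2 * s * (1 - ((p : ℝ) + q) / 2 - P)| ≤ |((p : ℝ) - q) / 2| := by
      rw [abs_mul, abs_mul, hs, mul_one]
      refine mul_le_of_le_one_right (abs_nonneg _) ?_
      rw [abs_le]; constructor <;> linarith
    rw [← abs_of_pos (pow_pos hρ 2), ← abs_div]
    have e1 : (1 * P + (1 - 1) * (1 - P)) * ((1 - P) / ρ) ^ 2 +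
        (0 * P + (1 - 0) * (1 - P)) * ((0 - P) / ρ) ^ 2 - 1 =
        ((p : ℝ) - q) / 2 * s * (1 - ((p : ℝ) + q) / 2 - P) / ρ ^ 2 := by
      have e2 : ((p : ℝ) - q) / 2 * s = P - ((p : ℝ) + q) / 2 := by rw [he]; ring
      rw [e2]
      field_simp
      rw [hρ2]
      ring
    rw [e1, abs_div, abs_div]
    gcongr
  pos := hρ
  le_one := by
    have h : ρ ^ 2 ≤ 1 := by
      rw [hρ2]; nlinarith [sq_nonneg (((p : ℝ) + q) / 2 - 1 / 2)]
    nlinarith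
  eps_le := hε1

/-- The signed cycle count is a cycle sum of noise plus signal. -/
lemma signedCycleCount_eq_fullSum {n : ℕ} (hn : 0 < n) (p q : I) (τ : Fin n → ℤˣ) {ρ : ℝ}
    (hρ : 0 < ρ) (hρ2 : ρ ^ 2 = ((p : ℝ) + q) / 2 * (1 - ((p : ℝ) + q) / 2)) (m : ℕ)
    (ω : Sym2 (Fin n) → Prop) :
    signedCycleCount (((p : ℝ) + q) / 2) (m + 3) (SimpleGraph.fromEdgeSet {e | ω e}) =
      fullSum (edgeNoise p q ρ τ) (((p : ℝ) - q) / 2 * √n / ρ) (fun x => ((τ x : ℤ) : ℝ)) m ω := by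
  have hn' : (0 : ℝ) < n := by exact_mod_cast hn
  have hs : 0 < √(n : ℝ) := Real.sqrt_pos.2 hn'
  have hsqrt : √(n * (((p : ℝ) + q) / 2) * (1 - ((p : ℝ) + q) / 2)) = √n * ρ := by
    rw [mul_assoc, ← hρ2, Real.sqrt_mul hn'.le, Real.sqrt_sq hρ.le]
  rw [signedCycleCount, hsqrt, Finset.mul_sum, fullSum]
  refine Finset.sum_congr rfl fun a _ => ?_
  have hpow : (1 / (√n * ρ)) ^ (m + 3) = ∏ _j : Fin (m + 3), 1 / (√n * ρ) := by simp
  rw [hpow, ← Finset.prod_mul_distrib]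
  refine Finset.prod_congr rfl fun j _ => ?_
  -- The edge indicator agrees with the toss only off the diagonal, so consecutive vertices must be
  -- distinct.
  have hj : a j ≠ a (j + 1) := fun h => fin_add_one_ne j (a.injective h).symm
  rw [finRotate_apply, edgeInd_fromEdgeSet hj, cycEdge, edgeNoise, edgeProb_eq, invSqrtCard,
    Fintype.card_fin]
  field_simp
  ring

end Law

/-! ### Averaging over labels and passage to the limit -/

section Convergence

/-- The quantity under the root is the square of `(p - q) / 2 * √n / ρ`, and the sign restores what
the root forgets. -/
lemma cycleMean_eq {n : ℕ} (hn : 0 < n) (p q : I) {ρ : ℝ} (hρ : 0 < ρ)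
    (hρ2 : ρ ^ 2 = ((p : ℝ) + q) / 2 * (1 - ((p : ℝ) + q) / 2)) (k : ℕ) :
    cycleMean n p q k = (((p : ℝ) - q) / 2 * √n / ρ) ^ k := by
  have hn' : (0 : ℝ) < n := by exact_mod_cast hn
  have hp0 := p.2.1
  have hp1 := p.2.2
  have hq0 := q.2.1
  have hq1 := q.2.2
  have hpos : 0 < ((p : ℝ) + q) / 2 * (1 - ((p : ℝ) + q) / 2) := hρ2 ▸ pow_pos hρ 2
  have h1 : 0 < (p : ℝ) + q := by
    rcases (add_nonneg hp0 hq0).lt_or_eq with h | h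
    · exact h
    · rw [← h] at hpos; simp at hpos
  have h2 : 0 < 1 - ((p : ℝ) + q) / 2 := pos_of_mul_pos_right hpos (by positivity)
  have e : signal n p q / (2 * (1 - ((p : ℝ) + q) / 2)) = (|((p : ℝ) - q) / 2| * √n / ρ) ^ 2 := by
    rw [div_pow, mul_pow, sq_abs, Real.sq_sqrt hn'.le, hρ2, signal]
    field_simp
  have hs : Real.sign ((p : ℝ) - q) * |((p : ℝ) - q) / 2| = ((p : ℝ) - q) / 2 := by
    rcases lt_trichotomy ((p : ℝ) - q) 0 with h | h | h
    · rw [Real.sign_of_neg h, abs_of_neg (by linarith)]; ring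
    · simp [h]
    · rw [Real.sign_of_pos h, abs_of_pos (by linarith)]; ring
  change (Real.sign ((p : ℝ) - q) * √(signal n p q / (2 * (1 - ((p : ℝ) + q) / 2)))) ^ k = _
  rw [e, Real.sqrt_sq (by positivity)]
  rw [mul_div_assoc, mul_div_assoc, ← mul_assoc, hs]

/-- The normalized signed cycles, centered at `c`. -/
noncomputable def normalizedCycles {n l : ℕ} (P : Measure (LabelledGraph n)) (k : Fin l → ℕ)
    (c : Fin l → ℝ) (ω : LabelledGraph n) : EuclideanSpace ℝ (Fin l) :=
  WithLp.toLp 2 fun i : Fin l => (signedCycle P (k i) ω - c i) / √(2 * (k i : ℝ))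

/-- The characteristic function is the average over labellings of conditional ones. The error for
fixed labels does not depend on them, because both the centering and the bound depend on the signal
only through `θ` and `Θ`. -/
lemma norm_charFun_sub_le {n : ℕ} (hn : 2 ≤ n) (p q : I) {ρ Θ : ℝ} (hρ : 0 < ρ)
    (hρ2 : ρ ^ 2 = ((p : ℝ) + q) / 2 * (1 - ((p : ℝ) + q) / 2)) (hΘ : 1 ≤ Θ)
    (hθ : |((p : ℝ) - q) / 2 * √n / ρ| ≤ Θ) (hε : Θ * (√n * ρ)⁻¹ ≤ 1) {l : ℕ} {k : Fin l → ℕ}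
    (hk : Function.Injective k) (hk3 : ∀ i, 3 ≤ k i) {M : ℕ} (hM : 1 ≤ M) (hkM : ∀ i, k i ≤ M)
    (hMn : ((4 * M : ℕ) : ℝ) * 2 ^ (4 * M) ≤ √n) (t : EuclideanSpace ℝ (Fin l)) :
    ‖charFun ((sbm n p q).map (normalizedCycles (sbm n p q) k fun i => cycleMean n p q (k i))) t -
        charFun (stdGaussian (EuclideanSpace ℝ (Fin l))) t‖ ≤
      noiseErr (Fin n) ρ (Θ * (√n * ρ)⁻¹) M t + signalErr (Fin n) Θ M t := by
  have hn0 : 0 < n := by omega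
  have hn' : (0 : ℝ) < n := by exact_mod_cast hn0
  have hs : 0 < √(n : ℝ) := Real.sqrt_pos.2 hn'
  have : Nonempty (Fin n) := ⟨⟨0, hn0⟩⟩
  obtain ⟨m, rfl⟩ : ∃ m : Fin l → ℕ, k = fun i => m i + 3 :=
    ⟨fun i => k i - 3, funext fun i => (Nat.sub_add_cancel (hk3 i)).symm⟩
  have hm : Function.Injective m := fun i j h => hk (by simp [h])
  beta_reduce
  set θ : ℝ := ((p : ℝ) - q) / 2 * √n / ρ with hθdef
  have hnoise : ∀ τ : Fin n → ℤˣ, IsNoise (edgeWt p q τ) (edgeNoise p q ρ τ) ρ (Θ * (√(n : ℝ) * ρ)⁻¹) := by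
    intro τ
    refine isNoise_edgeNoise (V := Fin n) p q τ hρ hρ2 ?_ hε
    have : |((p : ℝ) - q) / 2| / ρ ^ 2 = |θ| * (√(n : ℝ) * ρ)⁻¹ := by
      rw [hθdef, abs_div (_ * _) ρ, abs_mul, abs_of_pos hs, abs_of_pos hρ]
      field_simp
    rw [this]
    gcongr
  have hτ : ∀ (τ : Fin n → ℤˣ) (x : Fin n), ((τ x : ℤ) : ℝ) * ((τ x : ℤ) : ℝ) = 1 := by
    intro τ x
    rcases Int.units_eq_one_or (τ x) with h | h <;> simp [h]
  have hN : 1 ≤ √(n : ℝ) * ρ := by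
    rw [← div_eq_mul_inv, div_le_one (by positivity)] at hε
    linarith
  have hgauss : charFun (stdGaussian (EuclideanSpace ℝ (Fin l))) t =
      Complex.exp (-((∑ i, t i ^ 2 : ℝ) : ℂ) / 2) := by
    rw [charFun_stdGaussian, ← Complex.ofReal_pow, EuclideanSpace.norm_sq_eq]
    simp
  have hchar : charFun ((sbm n p q).map
      (normalizedCycles (sbm n p q) (fun i => m i + 3) fun i => cycleMean n p q (m i + 3))) t =
      ((2 : ℝ) ^ n)⁻¹ • ∑ τ : Fin n → ℤˣ, cex (prodWt (edgeWt p q τ)) (fun ω =>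
        Complex.exp (Complex.I * ((∑ i, t i / √(2 * (m i + 3 : ℕ)) *
          (fullSum (edgeNoise p q ρ τ) θ (fun x => ((τ x : ℤ) : ℝ)) (m i) ω -
            θ ^ (m i + 3)) : ℝ) : ℂ))) := by
    rw [charFun_apply, integral_map Measurable.of_discrete.aemeasurable
      (Measurable.aestronglyMeasurable (by fun_prop)), integral_sbm]
    congr 1
    refine Finset.sum_congr rfl fun τ _ => ?_
    rw [integral_graphLaw, cex]
    refine Finset.sum_congr rfl fun ω _ => ?_
    rw [Complex.real_smul]
    congr 2
    rw [mul_comm]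
    congr 2
    rw [PiLp.inner_apply]
    refine Finset.sum_congr rfl fun i _ => ?_
    simp only [normalizedCycles, signedCycle, avgConnProb_sbm hn]
    rw [signedCycleCount_eq_fullSum hn0 p q τ hρ hρ2, cycleMean_eq hn0 p q hρ hρ2, ← hθdef]
    simp only [RCLike.inner_apply, conj_trivial]
    ring
  rw [hgauss, hchar]
  set g : ℂ := Complex.exp (-((∑ i, t i ^ 2 : ℝ) : ℂ) / 2)
  set E := noiseErr (Fin n) ρ (Θ * (√n * ρ)⁻¹) M t + signalErr (Fin n) Θ M t
  have hcard : (Finset.univ : Finset (Fin n → ℤˣ)).card = 2 ^ n := by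
    simp [Fintype.card_units_int]
  have hg : g = ((2 : ℝ) ^ n)⁻¹ • ∑ _τ : Fin n → ℤˣ, g := by
    rw [Finset.sum_const, hcard, ← Nat.cast_smul_eq_nsmul ℝ, smul_smul, Nat.cast_pow,
      Nat.cast_ofNat, inv_mul_cancel₀ (by positivity), one_smul]
  rw [hg]
  rw [← smul_sub, ← Finset.sum_sub_distrib, norm_smul, norm_inv, norm_pow, Real.norm_ofNat,
    inv_mul_le_iff₀ (by positivity)]
  refine (norm_sum_le _ _).trans ((Finset.sum_le_card_nsmul _ _ E fun τ _ => ?_).trans_eq ?_)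
  · exact norm_cex_fullSum_sub_le (hnoise τ) hθ hΘ (hτ τ) hm hM hkM (by simpa using hN)
      (by simpa using hMn) t
  · rw [hcard, nsmul_eq_mul]; push_cast; ring

/-- The signed cycles are asymptotically normal. -/
theorem tendstoInDistribution_normalizedCycles (p q : ℕ → I) (l : ℕ) (k : ℕ → Fin l → ℕ)
    (c : ℕ → Fin l → ℝ) {δ C : ℝ} (hδ : 0 < δ)
    (hp1 : ∀ᶠ n in atTop, (avgProb (p n) (q n) : ℝ) ≤ 1 - δ)
    (hk3 : ∀ᶠ n in atTop, ∀ i, 3 ≤ k n i) (hkinj : ∀ᶠ n in atTop, Function.Injective (k n))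
    (hpq : Tendsto (fun n : ℕ => (avgProb (p n) (q n) : ℝ) * n) atTop atTop)
    (hC : ∀ᶠ n in atTop, signal n (p n) (q n) ≤ C)
    (hk : ∀ i, (fun n => (k n i : ℝ)) =o[atTop]
      fun n : ℕ => Real.log ((avgProb (p n) (q n) : ℝ) * n))
    (hc : ∀ᶠ n in atTop, ∀ i, c n i = cycleMean n (p n) (q n) (k n i)) :
    TendstoInDistribution
      (fun (n : ℕ) (ω : LabelledGraph n) => normalizedCycles (sbm n (p n) (q n)) (k n) (c n) ω)
      atTop (id : EuclideanSpace ℝ (Fin l) → EuclideanSpace ℝ (Fin l))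
      (fun n => sbm n (p n) (q n)) (stdGaussian (EuclideanSpace ℝ (Fin l))) := by
  set r : ℕ → ℝ := fun n => (avgProb (p n) (q n) : ℝ) with hr
  have hreq : ∀ n, r n = ((p n : ℝ) + q n) / 2 := fun n => rfl
  have hr0 : ∀ᶠ n in atTop, 0 < r n := by
    filter_upwards [hpq.eventually_gt_atTop 0] with n hn
    exact pos_of_mul_pos_left hn (Nat.cast_nonneg n)
  set ρ : ℕ → ℝ := fun n => √(r n * (1 - r n)) with hρdef
  have hs : ∀ᶠ n in atTop, 0 < r n * (1 - r n) := by
    filter_upwards [hr0, hp1] with n h0 h1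
    exact mul_pos h0 (by linarith)
  have hρ : ∀ᶠ n in atTop, 0 < ρ n := hs.mono fun n h => Real.sqrt_pos.2 h
  have hρ1 : ∀ᶠ n in atTop, ρ n ≤ 1 := by
    refine Eventually.of_forall fun n => Real.sqrt_le_one.2 ?_
    nlinarith [sq_nonneg (r n - 1 / 2)]
  have hNeq : ∀ n : ℕ, √n * ρ n = √(n * (r n * (1 - r n))) := fun n =>
    (Real.sqrt_mul (Nat.cast_nonneg n) _).symm
  have hNlow : ∀ᶠ n : ℕ in atTop, δ * (r n * n) ≤ n * (r n * (1 - r n)) := by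
    filter_upwards [hr0, hp1] with n h0 h1
    have : (0 : ℝ) ≤ n := Nat.cast_nonneg n
    have h2 : δ * (r n * n) ≤ (1 - r n) * (r n * n) := by
      have := mul_nonneg h0.le this
      exact mul_le_mul_of_nonneg_right (by linarith) this
    linarith
  have hx : Tendsto (fun n : ℕ => (√n * ρ n)⁻¹) atTop (𝓝 0) := by
    refine tendsto_inv_atTop_zero.comp ?_
    have h1 : Tendsto (fun n : ℕ => (n : ℝ) * (r n * (1 - r n))) atTop atTop :=
      tendsto_atTop_mono' _ hNlow (hpq.const_mul_atTop hδ)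
    simpa only [hNeq, Function.comp_def] using Real.tendsto_sqrt_atTop.comp h1
  -- Since `(√n ρ)² ≥ δ n r`, the logarithm of `√n ρ` is at least half of `log δ + log (n r)`. Half
  -- of that is given up to absorb `log δ`, whence the constant `4`.
  have hlog : (fun n : ℕ => Real.log (r n * n)) =O[atTop] fun n : ℕ => Real.log (√n * ρ n)⁻¹ := by
    refine IsBigO.of_bound 4 ?_
    filter_upwards [hNlow, hpq.eventually_gt_atTop 1,
      (Real.tendsto_log_atTop.comp hpq).eventually_ge_atTop (2 * |Real.log δ|)] with n h1 h2 h3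
    simp only [Function.comp_apply] at h3
    have h4 : 0 < Real.log (r n * n) := Real.log_pos h2
    have h5 : Real.log δ + Real.log (r n * n) ≤ Real.log (n * (r n * (1 - r n))) := by
      rw [← Real.log_mul hδ.ne' (by positivity)]
      exact Real.log_le_log (by positivity) h1
    have h6 : (0 : ℝ) < n * (r n * (1 - r n)) := lt_of_lt_of_le (by positivity) h1
    rw [Real.log_inv, hNeq, Real.log_sqrt h6.le, norm_neg, Real.norm_of_nonneg h4.le]
    refine le_trans ?_ (mul_le_mul_of_nonneg_left (Real.le_norm_self _) (by norm_num))
    have := neg_abs_le (Real.log δ)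
    linarith
  -- One bound for all lengths, still of smaller order than the logarithm because `l` is fixed; the
  -- `1` gives `1 ≤ M` even for `l = 0`.
  set M : ℕ → ℕ := fun n => 1 + ∑ i, k n i with hMdef
  have hM : (fun n => (M n : ℝ)) =o[atTop] fun n : ℕ => Real.log (√n * ρ n)⁻¹ := by
    refine IsLittleO.trans_isBigO ?_ hlog
    simp only [hMdef, Nat.cast_add, Nat.cast_sum, Nat.cast_one]
    refine IsLittleO.add ?_ (IsLittleO.fun_sum fun i _ => hk i)
    rw [isLittleO_const_left]
    exact Or.inr (tendsto_norm_atTop_atTop.comp (Real.tendsto_log_atTop.comp hpq))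
  -- `θ²` is the signal over `2 (1 - r)`, hence at most `|C| / (2 * δ)`; adding one makes `Θ ≥ 1`
  -- and `Θ²` larger than this bound.
  set Θ : ℝ := 1 + |C| / (2 * δ) with hΘdef
  have hΘ : 1 ≤ Θ := by
    have : 0 ≤ |C| / (2 * δ) := by positivity
    linarith
  have hx0 : ∀ᶠ n : ℕ in atTop, 0 < (√n * ρ n)⁻¹ := by
    filter_upwards [hρ, eventually_gt_atTop 0] with n hn hn0
    have : 0 < √(n : ℝ) := Real.sqrt_pos.2 (by exact_mod_cast hn0)
    positivity
  have hMn : ∀ᶠ n : ℕ in atTop, ((4 * M n : ℕ) : ℝ) * 2 ^ (4 * M n) ≤ √n := by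
    have h1 := (tendsto_pow_mul_zero hx0 hx hM (D := 32) (by norm_num)).eventually_le_const
      (show (0 : ℝ) < 1 / 4 by norm_num)
    filter_upwards [h1, hx0, hρ1] with n h2 h3 h4
    have h5 := natCast_pow_le_pow (M n) 1
    rw [pow_one, pow_one] at h5
    have h6 : 0 < √n * ρ n := inv_pos.1 h3
    rw [← div_eq_mul_inv, div_le_iff₀ h6] at h2
    push_cast
    calc 4 * (M n : ℝ) * 2 ^ (4 * M n) ≤ 4 * 2 ^ M n * 2 ^ (4 * M n) := by gcongr
      _ = 4 * 32 ^ M n := by rw [pow_mul, mul_assoc, ← mul_pow]; norm_num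
      _ ≤ √n * ρ n := by linarith
      _ ≤ √n := mul_le_of_le_one_right (Real.sqrt_nonneg _) h4
  refine ⟨fun n => Measurable.of_discrete.aemeasurable, by fun_prop, ?_⟩
  -- Lévy's continuity theorem: from here `t` is fixed, so the dependence of the errors on `t` is
  -- harmless.
  refine ProbabilityMeasure.tendsto_of_tendsto_charFun fun t => ?_
  simp only [ProbabilityMeasure.coe_mk, Measure.map_id]
  rw [tendsto_iff_norm_sub_tendsto_zero]
  have herr : Tendsto (fun n : ℕ => noiseErr (Fin n) (ρ n) (Θ * (√n * ρ n)⁻¹) (M n) t +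
      signalErr (Fin n) Θ (M n) t) atTop (𝓝 0) := by
    simpa using (tendsto_noiseErr hρ hρ1 hx hM (zero_le_one.trans hΘ) t).add
      (tendsto_signalErr hρ hρ1 hx hM hΘ t)
  refine squeeze_zero' (Eventually.of_forall fun n => norm_nonneg _) ?_ herr
  have hε : ∀ᶠ n : ℕ in atTop, Θ * (√n * ρ n)⁻¹ ≤ 1 := by
    have := hx.const_mul Θ
    rw [mul_zero] at this
    exact this.eventually_le_const one_pos
  filter_upwards [hs, hρ, hε, hMn, hk3, hkinj, hc, hC, hp1, hr0, eventually_ge_atTop 2]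
    with n hsn hρn hεn hMnn hk3n hkinjn hcn hCn hp1n hr0n hn2
  have hρ2 : ρ n ^ 2 = ((p n : ℝ) + q n) / 2 * (1 - ((p n : ℝ) + q n) / 2) := Real.sq_sqrt hsn.le
  have hθ : |((p n : ℝ) - q n) / 2 * √n / ρ n| ≤ Θ := by
    refine abs_le_of_sq_le_sq ?_ (by linarith)
    have hn' : (0 : ℝ) < n := by exact_mod_cast (by omega : 0 < n)
    have h1 : (((p n : ℝ) - q n) / 2 * √n / ρ n) ^ 2 =
        signal n (p n) (q n) / (2 * (1 - r n)) := by
      have h2 : 0 < (p n : ℝ) + q n := by have := hreq n; linarith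
      have h3 : 0 < 1 - ((p n : ℝ) + q n) / 2 := by have := hreq n; linarith
      rw [div_pow, mul_pow, Real.sq_sqrt hn'.le, hρ2, signal, hreq]
      field_simp
    have h4 : signal n (p n) (q n) / (2 * (1 - r n)) ≤ |C| / (2 * δ) := by
      refine div_le_div₀ (abs_nonneg _) (hCn.trans (le_abs_self _)) (by positivity) ?_
      have : r n ≤ 1 - δ := hp1n
      linarith
    rw [h1]
    have h5 : 0 ≤ |C| / (2 * δ) := by positivity
    nlinarith
  have hceq : c n = fun i => cycleMean n (p n) (q n) (k n i) := funext hcn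
  rw [hceq]
  exact norm_charFun_sub_le hn2 (p n) (q n) hρn hρ2 hΘ hθ hεn hkinjn hk3n
    (Nat.le_add_right _ _) (fun i => (Finset.single_le_sum (f := k n) (fun _ _ => Nat.zero_le _)
      (Finset.mem_univ i)).trans (Nat.le_add_left _ _)) hMnn t

end Convergence

end SignedCycles
-- Specialization to the two models
theorem mainTheorem5 (p q : ℕ → unitInterval) (l : ℕ) (k : ℕ → Fin l → ℕ)
    (hp1 : ∃ δ : ℝ, 0 < δ ∧ ∀ᶠ n in atTop, (SignedCycles.avgProb (p n) (q n) : ℝ) ≤ 1 - δ)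
    (hk3 : ∀ᶠ n in atTop, ∀ i, 3 ≤ k n i)
    (hkmono : ∀ᶠ n in atTop, StrictMono (k n)) :
    -- the Erdős–Rényi case
    ((Tendsto (fun n : ℕ => (n : ℝ) * ((p n : ℝ) + q n)) atTop atTop →
      (∀ i, (fun n => (k n i : ℝ)) =o[atTop]
        fun n : ℕ => Real.log ((SignedCycles.avgProb (p n) (q n) : ℝ) * n)) →
      TendstoInDistribution
        (fun (n : ℕ) (ω : SignedCycles.LabelledGraph n) =>
          (WithLp.toLp 2 fun i : Fin l =>
            SignedCycles.signedCycle
              (SignedCycles.sbm n (SignedCycles.avgProb (p n) (q n))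
                (SignedCycles.avgProb (p n) (q n))) (k n i) ω / √(2 * (k n i : ℝ)) :
            EuclideanSpace ℝ (Fin l)))
        atTop (id : EuclideanSpace ℝ (Fin l) → EuclideanSpace ℝ (Fin l))
        (fun n => SignedCycles.sbm n (SignedCycles.avgProb (p n) (q n))
          (SignedCycles.avgProb (p n) (q n)))
        (stdGaussian (EuclideanSpace ℝ (Fin l))))) ∧
    -- the stochastic block model
    ((Tendsto (fun n : ℕ => (n : ℝ) * (p n : ℝ)) atTop atTop →
      (fun n => SignedCycles.signal n (p n) (q n)) =Θ[atTop] (fun _ => (1 : ℝ)) →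
      (∀ i, (fun n => (k n i : ℝ)) =o[atTop]
        fun n : ℕ => min (Real.log ((SignedCycles.avgProb (p n) (q n) : ℝ) * n))
          (√(Real.log n))) →
      TendstoInDistribution
        (fun (n : ℕ) (ω : SignedCycles.LabelledGraph n) =>
          (WithLp.toLp 2 fun i : Fin l =>
            (SignedCycles.signedCycle (SignedCycles.sbm n (p n) (q n)) (k n i) ω -
              SignedCycles.cycleMean n (p n) (q n) (k n i)) / √(2 * (k n i : ℝ)) :
            EuclideanSpace ℝ (Fin l)))
        atTop (id : EuclideanSpace ℝ (Fin l) → EuclideanSpace ℝ (Fin l))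
        (fun n => SignedCycles.sbm n (p n) (q n))
        (stdGaussian (EuclideanSpace ℝ (Fin l))))) := by
  obtain ⟨δ, hδ, hp1⟩ := hp1
  have hkinj : ∀ᶠ n in atTop, Function.Injective (k n) := hkmono.mono fun n h => h.injective
  refine ⟨fun hpq hk => ?_, fun hp hc hk => ?_⟩
  · have hself : ∀ r : unitInterval, (SignedCycles.avgProb r r : ℝ) = r := fun r =>
      show ((r : ℝ) + r) / 2 = r by ring
    -- The Erdős–Rényi law is the block model with both parameters equal to the average, so the
    -- signal is zero and `C = 0` serves.
    have h := SignedCycles.tendstoInDistribution_normalizedCycles (fun n => SignedCycles.avgProb (p n) (q n))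
      (fun n => SignedCycles.avgProb (p n) (q n)) l k (fun _ _ => 0) (C := 0) hδ
      (by simpa only [hself] using hp1) hk3 hkinj ?_ ?_ (by simpa only [hself] using hk) ?_
    · simpa only [SignedCycles.normalizedCycles, sub_zero] using h
    · simp only [hself]
      refine (hpq.atTop_div_const two_pos).congr fun n => ?_
      change _ = ((p n : ℝ) + q n) / 2 * n
      ring
    · exact Eventually.of_forall fun n => by simp [SignedCycles.signal]
    · filter_upwards [hk3] with n hn i
      -- The centering is a power of zero here; it vanishes only because the exponent is nonzero, as
      -- `0 ^ 0 = 1`.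
      have : k n i ≠ 0 := by have := hn i; omega
      simp [SignedCycles.cycleMean, this]
  · obtain ⟨C, hC⟩ := hc.isBigO.bound
    refine SignedCycles.tendstoInDistribution_normalizedCycles p q l k _ (C := C) hδ hp1 hk3 hkinj ?_ ?_
      (fun i => (hk i).trans_isBigO ?_) (Eventually.of_forall fun n i => rfl)
    · refine tendsto_atTop_mono (fun n => ?_) (hp.atTop_div_const two_pos)
      change (n : ℝ) * p n / 2 ≤ ((p n : ℝ) + q n) / 2 * n
      have h1 := mul_nonneg (Nat.cast_nonneg (α := ℝ) n) (q n).2.1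
      linarith
    · filter_upwards [hC] with n hn
      simpa using (le_abs_self _).trans hn
    -- The minimum is at most the logarithm, and both are nonnegative once the logarithm is, so
    -- `o(min)` gives `o(log)`.
    · refine IsBigO.of_bound 1 ?_
      have hpq : Tendsto (fun n : ℕ => (SignedCycles.avgProb (p n) (q n) : ℝ) * n) atTop atTop := by
        refine tendsto_atTop_mono (fun n => ?_) (hp.atTop_div_const two_pos)
        change (n : ℝ) * p n / 2 ≤ ((p n : ℝ) + q n) / 2 * n
        have h1 := mul_nonneg (Nat.cast_nonneg (α := ℝ) n) (q n).2.1
        linarith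
      filter_upwards [(Real.tendsto_log_atTop.comp hpq).eventually_ge_atTop 0] with n hn
      simp only [Function.comp_apply] at hn
      rw [Real.norm_of_nonneg (le_min hn (Real.sqrt_nonneg _)), Real.norm_of_nonneg hn, one_mul]
      exact min_le_left _ _
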